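/- Set-operads are non-symmetric, unital, and indexed by arities $n\ge 1$. Let $\mathrm{Mon}(n)$ be the set of monomials in $u_1,\dots,u_n$ with composition $F\circ_i G=F(u_1,\dots,u_{i-1},u_iu_{i+1}\cdots u_{i+n-1},u_{i+n},\dots,u_{m+n-1})\,G(u_i,\dots,u_{i+n-1})$ for $F\in \mathrm{Mon}(m)$, $G\in \mathrm{Mon}(n)$, and unit $1$. Let $\mathrm{FF}(n)$ be the set of simplified fractions whose numerator and denominator are products of formal symbols $[S]$, $\emptyset\ne S\subseteq\{1,\dots,n\}$, with composition $F\circ_iG=[S_{i,n}]\,F(1,\dots,i-1,S_{i,n},i+n,\dots,m+n-1)\,G(i,\dots,i+n-1)$, where $S_{i,n}=\{i,\dots,i+n-1\}$ (substitution of sets is by union), and unit $1/[1]$. Let $\mathrm{FF}_6$ be the sub-operad of the Hadamard product $\mathrm{Mon}\times \mathrm{FF}$ (pairs $(m,f)$, written $mf$, composed componentwise) generated by $$\prec\,=\tfrac1{[2][12]},\quad \succ\,=\tfrac1{[1][12]},\quad \circ=\tfrac1{[12]},\quad \odot=\tfrac1{[1][2]},\quad \ll\,=\tfrac{u_2}{[2][12]},\quad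 \gg\,=\tfrac{u_1}{[1][12]}.$$ Let $\mathcal{GR}_6$ be the quotient of the free operad on six binary generators $\prec,\succ,\circ,\odot,\ll,\gg$ (planar binary trees with nodes labelled by the generators) by the smallest operadic congruence that contains the following 16 relations, where $(a,b\mid c,d)$ means $a\circ_1 b=c\circ_2 d$: $(\odot,\odot\mid\odot,\odot)$, $(\circ,\circ\mid\circ,\circ)$, $(\circ,\prec\mid\circ,\succ)$, $(\circ,\ll\mid\circ,\gg)$, $(\prec,\prec\mid\prec,\odot)$, $(\ll,\ll\mid\ll,\odot)$, $(\succ,\odot\mid\succ,\succ)$, $(\gg,\odot\mid\gg,\gg)$, $(\prec,\circ\mid\circ,\prec)$, $(\ll,\circ\mid\circ,\ll)$, $(\circ,\succ\mid\succ,\circ)$, $(\circ,\gg\mid\gg,\circ)$, $(\prec,\succ\mid\succ,\prec)$, $(\ll,\succ\mid\succ,\ll)$, $(\prec,\gg\mid\gg,\prec)$, $(\ll,\gg\mid\gg,\ll)$. A *dotted red and white tree* labelled by $\{1,\dots,n\}$ is a rooted tree without order on the children, whose nodes carry pairwise disjoint, possibly empty sets of labels with union $\{1,\dots,n\}$, such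 that each node without labels has at least two children; a node is *red* if it has no label and none of its children is red, and *white* otherwise; any edge between two white nodes may be dotted. It is *recursively labelled* if for each node the set of all labels of its descendants (itself included) is an interval. Let $\mathrm{RW}_6(n)$ be the set of recursively labelled dotted red and white trees. For $A\in\mathrm{RW}_6(m)$, $B\in\mathrm{RW}_6(n)$ and $1\le x\le m$, the tree $A\circ_xB$ is defined as follows. Shift the labels of $A$ greater than $x$ by $n-1$ and those of $B$ by $x-1$, and let $z$ be the node of $A$ containing $x$. If the root of $B$ is white, erase $x$ in $z$ and add to $z$ the labels and the children of the root of $B$ (with their edges). If the root of $B$ is red: when $A$ is the single node labelled $x$, the result is $B$; when $z$ is a leaf other than the root with $x$ as only label, remove $z$ and make the children of the root of $B$ children of the parent of $z$, by dotted edges if the edge to $z$ was dotted and by plain edges otherwise; in the other cases erase $x$ in $z$ and attach $B$ as a child of $z$ by a plain edge. The unit is the single node labelled $1$. **Theorem.** $\mathrm{FF}_6$, $\mathcal{GR}_6$ and $\mathrm{RW}_6$ are set-operads, and they are isomorphic. More precisely, there are isomorphisms of operads $\mathcal{GR}_6\to\mathrm{FF}_6$ and $\mathcal{GR}_6\to\mathrm{RW}_6$;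 the first sends each generator to the fraction of the same name, and the second sends $\prec$ (resp. $\ll$) to the root $\{1\}$ with child $\{2\}$ through a plain (resp. dotted) edge, $\succ$ (resp. $\gg$) to the root $\{2\}$ with child $\{1\}$ through a plain (resp. dotted) edge, $\circ$ to the single node $\{1,2\}$, and $\odot$ to the red root with children $\{1\}$ and $\{2\}$. The sets $\mathrm{FF}_6(n)$ are finite, and the generating series $F=\sum_{n\ge1}|\mathrm{FF}_6(n)|\,x^n\in\mathbb{Z}[[x]]$ satisfies $$F=x+3xF+(3+x)F^2+(1-x)F^3-F^4.$$ -/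

import Mathlib

/-- A collection of sets `Op n` for `n ≥ 1` (there is nothing in arity `0`), with an element of
`Op 1` and partial composition maps `∘ᵢ : Op m × Op n → Op (m + n - 1)` for `1 ≤ i ≤ m`.
The arity `k = m + n - 1` of the result is given through `k + 1 = m + n`. -/
structure PreOperad where
  Op : ℕ → Type
  arity_pos : ∀ {n : ℕ}, Op n → 1 ≤ n
  one : Op 1
  circ : ∀ {m n k : ℕ} (_ : k + 1 = m + n) (i : ℕ) (_ : 1 ≤ i ∧ i ≤ m), Op m → Op n → Op k

namespace PreOperad

/-- The axioms of a (non-symmetric, unital) set-operad. -/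
structure IsOperad (P : PreOperad) : Prop where
  one_circ : ∀ {n : ℕ} (h : n + 1 = 1 + n) (hi : 1 ≤ 1 ∧ 1 ≤ 1) (a : P.Op n),
    P.circ h 1 hi P.one a = a
  circ_one : ∀ {m : ℕ} (h : m + 1 = m + 1) (i : ℕ) (hi : 1 ≤ i ∧ i ≤ m) (a : P.Op m),
    P.circ h i hi a P.one = a
  /-- `(a ∘ᵢ b) ∘_{i+j-1} c = a ∘ᵢ (b ∘ⱼ c)` -/
  assoc_seq : ∀ {m n p r s k : ℕ} (h₁ : r + 1 = m + n) (h₂ : k + 1 = r + p)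
    (h₃ : s + 1 = n + p) (h₄ : k + 1 = m + s) (i j : ℕ) (hi : 1 ≤ i ∧ i ≤ m)
    (hj : 1 ≤ j ∧ j ≤ n) (hij : 1 ≤ i + j - 1 ∧ i + j - 1 ≤ r)
    (a : P.Op m) (b : P.Op n) (c : P.Op p),
    P.circ h₂ (i + j - 1) hij (P.circ h₁ i hi a b) c = P.circ h₄ i hi a (P.circ h₃ j hj b c)
  /-- `(a ∘ᵢ b) ∘_{j+n-1} c = (a ∘ⱼ c) ∘ᵢ b` for `i < j` -/
  assoc_par : ∀ {m n p r s k : ℕ} (h₁ : r + 1 = m + n) (h₂ : k + 1 = r + p)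
    (h₃ : s + 1 = m + p) (h₄ : k + 1 = s + n) (i j : ℕ) (hi : 1 ≤ i ∧ i ≤ m)
    (hj : 1 ≤ j ∧ j ≤ m) (_ : i < j) (hj' : 1 ≤ j + n - 1 ∧ j + n - 1 ≤ r)
    (hi' : 1 ≤ i ∧ i ≤ s) (a : P.Op m) (b : P.Op n) (c : P.Op p),
    P.circ h₂ (j + n - 1) hj' (P.circ h₁ i hi a b) c
      = P.circ h₄ i hi' (P.circ h₃ j hj a c) b

/-- Isomorphisms: arity-wise bijections compatible with the unit and all compositions. -/
structure Iso (P Q : PreOperad) where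
  equiv : ∀ n : ℕ, P.Op n ≃ Q.Op n
  map_one : equiv 1 P.one = Q.one
  map_circ : ∀ {m n k : ℕ} (h : k + 1 = m + n) (i : ℕ) (hi : 1 ≤ i ∧ i ≤ m)
    (a : P.Op m) (b : P.Op n),
    equiv k (P.circ h i hi a b) = Q.circ h i hi (equiv m a) (equiv n b)

/-- The Hadamard product: pairs of operations of the same arity, composed componentwise. -/
def hadamard (P Q : PreOperad) : PreOperad where
  Op n := P.Op n × Q.Op n
  arity_pos a := P.arity_pos a.1
  one := (P.one, Q.one)
  circ h i hi a b := (P.circ h i hi a.1 b.1, Q.circ h i hi a.2 b.2)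

/-- Membership in the sub-operad generated by a family `S` of subsets. -/
inductive Generated (P : PreOperad) (S : ∀ n : ℕ, Set (P.Op n)) : ∀ n : ℕ, P.Op n → Prop
  | one : Generated P S 1 P.one
  | of {n : ℕ} (a : P.Op n) : a ∈ S n → Generated P S n a
  | circ {m n k : ℕ} (h : k + 1 = m + n) (i : ℕ) (hi : 1 ≤ i ∧ i ≤ m) (a : P.Op m) (b : P.Op n) :
      Generated P S m a → Generated P S n b → Generated P S k (P.circ h i hi a b)

/-- The sub-operad of `P` generated by `S`. -/
def generatedBy (P : PreOperad) (S : ∀ n : ℕ, Set (P.Op n)) : PreOperad where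
  Op n := {a : P.Op n // Generated P S n a}
  arity_pos a := P.arity_pos a.1
  one := ⟨P.one, .one⟩
  circ h i hi a b := ⟨P.circ h i hi a.1 b.1, .circ h i hi a.1 b.1 a.2 b.2⟩

/-- The smallest operadic congruence containing a family of relations `R`. -/
inductive Cong (P : PreOperad) (R : ∀ n : ℕ, P.Op n → P.Op n → Prop) :
    ∀ n : ℕ, P.Op n → P.Op n → Prop
  | of {n : ℕ} {a b : P.Op n} : R n a b → Cong P R n a b
  | refl {n : ℕ} (a : P.Op n) : Cong P R n a a
  | symm {n : ℕ} {a b : P.Op n} : Cong P R n a b → Cong P R n b a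
  | trans {n : ℕ} {a b c : P.Op n} : Cong P R n a b → Cong P R n b c → Cong P R n a c
  | circ {m n k : ℕ} (h : k + 1 = m + n) (i : ℕ) (hi : 1 ≤ i ∧ i ≤ m)
      {a a' : P.Op m} {b b' : P.Op n} : Cong P R m a a' → Cong P R n b b' →
      Cong P R k (P.circ h i hi a b) (P.circ h i hi a' b')

/-- The congruence as a setoid. -/
def congSetoid (P : PreOperad) (R : ∀ n : ℕ, P.Op n → P.Op n → Prop) (n : ℕ) :
    Setoid (P.Op n) :=
  ⟨Cong P R n, .refl, .symm, .trans⟩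

/-- The quotient of `P` by the relations `R`. -/
def quotientBy (P : PreOperad) (R : ∀ n : ℕ, P.Op n → P.Op n → Prop) : PreOperad where
  Op n := Quotient (congSetoid P R n)
  arity_pos a := Quotient.inductionOn a P.arity_pos
  one := Quotient.mk _ P.one
  circ h i hi := Quotient.map₂ (P.circ h i hi) fun _ _ ha _ _ hb => .circ h i hi ha hb

end PreOperad

/-! ### Monomials and formal fractions -/

/-- The substitution `j ↦ {j}` for `j < i`, `i ↦ {i, …, i + n - 1}`, `j ↦ {j + n - 1}` for
`j > i`, used in `F ∘ᵢ G` with `G` of arity `n`. -/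
def blowUp (i n j : ℕ) : Finset ℕ :=
  if j < i then {j} else if j = i then Finset.Icc i (i + n - 1) else {j + n - 1}

theorem mem_blowUp {i n j l : ℕ} : l ∈ blowUp i n j ↔
    (j < i ∧ l = j) ∨ (j = i ∧ i ≤ l ∧ l ≤ i + n - 1) ∨ (i < j ∧ l = j + n - 1) := by
  unfold blowUp
  split_ifs <;> simp <;> omega

/-- The operad of monomials: a monomial in `u₁, …, uₙ` is the finite multiset of the indices of its
variables. In `F ∘ᵢ G` each `uⱼ` in `F` is replaced by the product of the `u_l`, `l ∈ blowUp i n j`,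
and the result is multiplied by `G(uᵢ, …, u_{i+n-1})`. -/
def Mon : PreOperad where
  Op n := {M : Multiset ℕ // 1 ≤ n ∧ ∀ j ∈ M, 1 ≤ j ∧ j ≤ n}
  arity_pos a := a.2.1
  one := ⟨0, le_refl 1, by simp⟩
  circ {m n k} h i hi F G :=
    ⟨F.1.bind (fun j => (blowUp i n j).val) + G.1.map (fun j => j + (i - 1)), by
      have hG := G.2.1
      refine ⟨by omega, fun l hl => ?_⟩
      rw [Multiset.mem_add, Multiset.mem_bind, Multiset.mem_map] at hl
      rcases hl with ⟨j, hj, hl⟩ | ⟨j, hj, rfl⟩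
      · have := F.2.2 j hj
        rw [Finset.mem_val, mem_blowUp] at hl
        omega
      · have := G.2.2 j hj
        omega⟩

/-- The operad of formal fractions. A (simplified) fraction in the symbols `[S]`, with `S` a
non-empty subset of `{1, …, n}`, is the finitely supported function sending `S` to the exponent in
`ℤ` of `[S]`; so the product of fractions is the sum of functions. The composition is
`F ∘ᵢ G = [Sᵢₙ] · F(1, …, Sᵢₙ, …, m + n - 1) · G(i, …, i + n - 1)`, with
`Sᵢₙ = {i, …, i + n - 1}`; the unit is `1 / [1]`. -/
noncomputable def FF : PreOperad where
  Op n := {f : Finset ℕ →₀ ℤ // 1 ≤ n ∧ ∀ S ∈ f.support, S.Nonempty ∧ S ⊆ Finset.Icc 1 n}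
  arity_pos a := a.2.1
  one := ⟨-Finsupp.single {1} 1, le_refl 1, by
    intro S hS
    rw [Finsupp.support_neg] at hS
    rw [Finset.mem_singleton.1 (Finsupp.support_single_subset hS)]
    simp⟩
  circ {m n k} h i hi F G :=
    ⟨Finsupp.single (Finset.Icc i (i + n - 1)) 1
        + Finsupp.mapDomain (fun S => S.biUnion (blowUp i n)) F.1
        + Finsupp.mapDomain (fun S => S.image (fun j => j + (i - 1))) G.1, by
      classical
      have hG := G.2.1
      refine ⟨by omega, fun S hS => ?_⟩
      rcases Finset.mem_union.1 (Finsupp.support_add hS) with hS | hS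
      · rcases Finset.mem_union.1 (Finsupp.support_add hS) with hS | hS
        · have := Finset.mem_singleton.1 (Finsupp.support_single_subset hS)
          subst this
          refine ⟨⟨i, Finset.mem_Icc.2 (by omega)⟩, fun j hj => ?_⟩
          rw [Finset.mem_Icc] at *
          omega
        · obtain ⟨T, hT, rfl⟩ := Finset.mem_image.1 (Finsupp.mapDomain_support hS)
          obtain ⟨⟨t, ht⟩, hT⟩ := F.2.2 T hT
          refine ⟨?_, fun l hl => ?_⟩
          · rcases lt_trichotomy t i with hti | hti | hti
            · exact ⟨t, Finset.mem_biUnion.2 ⟨t, ht, mem_blowUp.2 (by omega)⟩⟩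
            · exact ⟨t, Finset.mem_biUnion.2 ⟨t, ht, mem_blowUp.2 (by omega)⟩⟩
            · exact ⟨t + n - 1, Finset.mem_biUnion.2 ⟨t, ht, mem_blowUp.2 (by omega)⟩⟩
          · obtain ⟨j, hj, hl⟩ := Finset.mem_biUnion.1 hl
            have := Finset.mem_Icc.1 (hT hj)
            rw [mem_blowUp] at hl
            rw [Finset.mem_Icc]
            omega
      · obtain ⟨T, hT, rfl⟩ := Finset.mem_image.1 (Finsupp.mapDomain_support hS)
        obtain ⟨hne, hT⟩ := G.2.2 T hT
        refine ⟨hne.image _, fun l hl => ?_⟩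
        obtain ⟨j, hj, rfl⟩ := Finset.mem_image.1 hl
        have := Finset.mem_Icc.1 (hT hj)
        rw [Finset.mem_Icc]
        omega⟩

/-- Names of the six binary generators `≺, ≻, ∘, ⊙, ≪, ≫`. -/
inductive Gen6
  | prec | succ | mid | odot | ll | gg
  deriving DecidableEq

/-- The fraction `1 / ∏ [S]`, over the sets `S` in a finite set of sets. -/
noncomputable def invProd (D : Finset (Finset ℕ)) : Finset ℕ →₀ ℤ :=
  ∑ S ∈ D, -Finsupp.single S 1

theorem invProd_support {D : Finset (Finset ℕ)} {S : Finset ℕ}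
    (h : S ∈ (invProd D).support) : S ∈ D := by
  classical
  obtain ⟨T, hT, hS⟩ := Finset.mem_biUnion.1 (Finsupp.support_finsetSum h)
  rw [Finsupp.support_neg] at hS
  rwa [Finset.mem_singleton.1 (Finsupp.support_single_subset hS)]

/-- The monomials in the numerators of the generators: `1` for the first four, `u₂` for `≪`, `u₁` for
`≫`. -/
def genMon : Gen6 → Multiset ℕ
  | .ll => {2}
  | .gg => {1}
  | _ => 0

/-- The symbols in the denominators of the generators. -/
def genDen : Gen6 → Finset (Finset ℕ)
  | .prec => {{2}, {1, 2}}
  | .succ => {{1}, {1, 2}}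
  | .mid => {{1, 2}}
  | .odot => {{1}, {2}}
  | .ll => {{2}, {1, 2}}
  | .gg => {{1}, {1, 2}}

/-- The six generators in `(Mon × FF)(2)`:
`≺ = 1/[2][12]`, `≻ = 1/[1][12]`, `∘ = 1/[12]`, `⊙ = 1/[1][2]`, `≪ = u₂/[2][12]`,
`≫ = u₁/[1][12]`. -/
noncomputable def genFrac (g : Gen6) : (PreOperad.hadamard Mon FF).Op 2 :=
  (⟨genMon g, by cases g <;> simp [genMon]⟩,
   ⟨invProd (genDen g), one_le_two, fun S hS => by
      have h := invProd_support hS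
      clear hS
      revert S
      cases g <;> decide⟩)

/-- The set of the six generators. -/
inductive IsGenFrac : ∀ n : ℕ, (PreOperad.hadamard Mon FF).Op n → Prop
  | mk (g : Gen6) : IsGenFrac 2 (genFrac g)

/-- The operad `FF₆`: the sub-operad of `Mon × FF` generated by the six generators. -/
noncomputable def FF6 : PreOperad :=
  (PreOperad.hadamard Mon FF).generatedBy fun n => {a | IsGenFrac n a}

/-! ### The presented operad -/

/-- Planar binary trees with internal nodes labelled by `G`. -/
inductive BTree (G : Type)
  | leaf : BTree G
  | node : G → BTree G → BTree G → BTree G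

namespace BTree

variable {G : Type}

/-- The number of leaves. -/
def leaves : BTree G → ℕ
  | leaf => 1
  | node _ l r => leaves l + leaves r

/-- `graftAt t i b` replaces the `i`-th leaf of `t` (from left to right, from `1` on) by `b`. -/
def graftAt : BTree G → ℕ → BTree G → BTree G
  | leaf, _, b => b
  | node g l r, i, b =>
      if i ≤ leaves l then node g (graftAt l i b) r else node g l (graftAt r (i - leaves l) b)

theorem leaves_pos (t : BTree G) : 1 ≤ leaves t := by
  induction t with
  | leaf => exact le_refl 1
  | node g l r hl hr => simp only [leaves]; omega

theorem leaves_graftAt (t : BTree G) : ∀ (i : ℕ) (b : BTree G), 1 ≤ i ∧ i ≤ leaves t →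
    leaves (graftAt t i b) + 1 = leaves t + leaves b := by
  induction t with
  | leaf => intro i b _; simp only [graftAt, leaves]; omega
  | node g l r hl hr =>
    intro i b hi
    simp only [leaves] at hi
    simp only [graftAt]
    split_ifs with h
    · have := hl i b (by omega)
      simp only [leaves]; omega
    · have := hr (i - leaves l) b (by omega)
      simp only [leaves]; omega

end BTree

/-- The free operad on a set `G` of binary generators. -/
def freeBinary (G : Type) : PreOperad where
  Op n := {t : BTree G // t.leaves = n}
  arity_pos a := a.2 ▸ BTree.leaves_pos a.1
  one := ⟨.leaf, rfl⟩
  circ h i hi a b := ⟨a.1.graftAt i b.1, by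
    have := BTree.leaves_graftAt a.1 i b.1 (by rw [a.2]; exact hi)
    rw [a.2, b.2] at this
    omega⟩

/-- The generator `g` in the free operad. -/
def freeGen {G : Type} (g : G) : (freeBinary G).Op 2 := ⟨.node g .leaf .leaf, rfl⟩

/-- The sixteen quadruples `(a, b, c, d)` for which the relation `a ∘₁ b = c ∘₂ d` is imposed. -/
def rels16 : List (Gen6 × Gen6 × Gen6 × Gen6) :=
  [(.odot, .odot, .odot, .odot), (.mid, .mid, .mid, .mid),
   (.mid, .prec, .mid, .succ), (.mid, .ll, .mid, .gg),
   (.prec, .prec, .prec, .odot), (.ll, .ll, .ll, .odot),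
   (.succ, .odot, .succ, .succ), (.gg, .odot, .gg, .gg),
   (.prec, .mid, .mid, .prec), (.ll, .mid, .mid, .ll),
   (.mid, .succ, .succ, .mid), (.mid, .gg, .gg, .mid),
   (.prec, .succ, .succ, .prec), (.ll, .succ, .succ, .ll),
   (.prec, .gg, .gg, .prec), (.ll, .gg, .gg, .ll)]

/-- The sixteen relations, in arity `3` of the free operad. -/
inductive Rel16 : ∀ n : ℕ, (freeBinary Gen6).Op n → (freeBinary Gen6).Op n → Prop
  | mk (a b c d : Gen6) : (a, b, c, d) ∈ rels16 →
      Rel16 3 ((freeBinary Gen6).circ (by rfl) 1 (by decide) (freeGen a) (freeGen b))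
        ((freeBinary Gen6).circ (by rfl) 2 (by decide) (freeGen c) (freeGen d))

/-- The operad presented by six binary generators and the sixteen relations. -/
def GR6 : PreOperad := (freeBinary Gen6).quotientBy Rel16

/-- The generator `g` of the presented operad. -/
def gr6Gen (g : Gen6) : GR6.Op 2 := Quotient.mk _ (freeGen g)

/-! ### Dotted red and white trees -/

/-- Planar representatives of rooted trees whose nodes carry a finite set of labels and whose
edges may be dotted: a node has its set of labels, the list of its children through plain edges and
the list of its children through dotted edges. -/
inductive RTree
  | node (labels : Finset ℕ) (plain dotted : List RTree) : RTree

namespace RTree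

/-- The labels of the root. -/
def rootLabels : RTree → Finset ℕ
  | node L _ _ => L

/-- The children of the root through plain edges. -/
def plain : RTree → List RTree
  | node _ p _ => p

/-- The children of the root through dotted edges. -/
def dotted : RTree → List RTree
  | node _ _ d => d

/-- All children of the root. -/
def children (t : RTree) : List RTree := t.plain ++ t.dotted

theorem ind {P : RTree → Prop}
    (h : ∀ L p d, (∀ t ∈ p, P t) → (∀ t ∈ d, P t) → P (node L p d)) : ∀ t, P t :=
  RTree.rec (motive_1 := P) (motive_2 := fun l => ∀ t ∈ l, P t) (fun L p d hp hd => h L p d hp hd)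
    (by simp) (fun t l ht hl => by simpa using ⟨ht, hl⟩)

mutual
/-- The root is red: it has no label and all its children are white, that is, not red. -/
def isRed : RTree → Bool
  | node L p d => decide (L = ∅) && (noneRed p && noneRed d)
/-- No root of the forest is red. -/
def noneRed : List RTree → Bool
  | [] => true
  | t :: ts => !isRed t && noneRed ts
end

mutual
/-- The multiset of all labels in the tree. -/
def allLabels : RTree → Multiset ℕ
  | node L p d => L.val + (forestLabels p + forestLabels d)
/-- The multiset of all labels in the forest. -/
def forestLabels : List RTree → Multiset ℕ
  | [] => 0
  | t :: ts => allLabels t + forestLabels ts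
end

mutual
/-- Replace each label `j` by `f j`. -/
def relabel (f : ℕ → ℕ) : RTree → RTree
  | node L p d => node (L.image f) (relabelForest f p) (relabelForest f d)
/-- Replace each label `j` by `f j` in a forest. -/
def relabelForest (f : ℕ → ℕ) : List RTree → List RTree
  | [] => []
  | t :: ts => relabel f t :: relabelForest f ts
end

/-- The tree is a single node with `x` as its only label. -/
def isLeafOf (x : ℕ) : RTree → Bool
  | node L p d => decide (L = {x}) && (p.isEmpty && d.isEmpty)

/- The composition of a tree `A` at its label `x`, in the node `z`, with a tree `B` (the labels being
already renumbered) is `graft x B A`. If the root of `B` is white, `x` is erased in `z`, and the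
labels and the children of the root of `B` are added to `z`. If the root of `B` is red, then:
* if `A` is the single node labelled `x`, the result is `B`;
* if `z` is a leaf, not the root, and `x` is its only label, `z` is removed, and the children of the
  root of `B` become children of the parent of `z`, by dotted edges if the edge to `z` was
  dotted and by plain edges otherwise;
* else `x` is erased in `z` and `B` is attached to `z` by a plain edge. -/
mutual
/-- The tree `B` inserted in place of the label `x` in a tree. -/
def graft (x : ℕ) (B : RTree) : RTree → RTree
  | node L p d =>
      if x ∈ L then
        if isRed B then
          if isLeafOf x (node L p d) then B
          else node (L.erase x) (B :: p) d
        else node (L.erase x ∪ B.rootLabels) (p ++ B.plain) (d ++ B.dotted)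
      else node L (graftForest x B p) (graftForest x B d)
/-- The tree `B` inserted in place of the label `x` in the trees, all children of the same node and
with edges of the same kind. -/
def graftForest (x : ℕ) (B : RTree) : List RTree → List RTree
  | [] => []
  | t :: ts =>
      (if isLeafOf x t && isRed B then B.children else [graft x B t]) ++ graftForest x B ts
end

/-- `A ∘ₓ B`, where `n` is the number of labels of `B`: the labels `> x` of `A` are shifted by
`n - 1` and those of `B` by `x - 1`. -/
def comp (n x : ℕ) (A B : RTree) : RTree :=
  graft x (relabel (fun j => j + (x - 1)) B) (relabel (fun j => if j ≤ x then j else j + n - 1) A)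

/-- Each node without labels has at least two children, and both ends of each dotted edge are
white. -/
inductive IsRedWhite : RTree → Prop
  | node (L : Finset ℕ) (p d : List RTree) : (L = ∅ → 2 ≤ p.length + d.length) →
      (isRed (node L p d) → d = []) → (∀ t ∈ d, ¬ isRed t) →
      (∀ t ∈ p, IsRedWhite t) → (∀ t ∈ d, IsRedWhite t) → IsRedWhite (node L p d)

/-- For each node, the set of all labels of its descendants, including its own labels, is an
interval. -/
inductive IsRecursive : RTree → Prop
  | node (L : Finset ℕ) (p d : List RTree) :
      (∃ a b : ℕ, (allLabels (node L p d)).toFinset = Finset.Icc a b) →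
      (∀ t ∈ p, IsRecursive t) → (∀ t ∈ d, IsRecursive t) → IsRecursive (node L p d)

/-- Recursively labelled dotted red and white trees with the labels `1, …, n`, each used once. -/
structure IsRWTree (n : ℕ) (t : RTree) : Prop where
  redWhite : IsRedWhite t
  labels : allLabels t = (Finset.Icc 1 n).val
  recursive : IsRecursive t

/-- Equality of trees up to the order of the children at each node. -/
inductive Same : RTree → RTree → Prop
  | refl (t : RTree) : Same t t
  | symm {t t' : RTree} : Same t t' → Same t' t
  | trans {t t' t'' : RTree} : Same t t' → Same t' t'' → Same t t''
  | perm (L : Finset ℕ) {p p' d d' : List RTree} : p.Perm p' → d.Perm d' →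
      Same (node L p d) (node L p' d')
  | plain (L : Finset ℕ) (p d : List RTree) {t t' : RTree} : Same t t' →
      Same (node L (t :: p) d) (node L (t' :: p) d)
  | dotted (L : Finset ℕ) (p d : List RTree) {t t' : RTree} : Same t t' →
      Same (node L p (t :: d)) (node L p (t' :: d))

/-! Forests in terms of lists. -/

theorem noneRed_eq (l : List RTree) : noneRed l = true ↔ ∀ t ∈ l, isRed t = false := by
  induction l with
  | nil => simp [noneRed]
  | cons t l ih => simp [noneRed, ih]

theorem isRed_node (L : Finset ℕ) (p d : List RTree) : isRed (node L p d) = true ↔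
    L = ∅ ∧ (∀ t ∈ p, isRed t = false) ∧ ∀ t ∈ d, isRed t = false := by
  simp [isRed, noneRed_eq]

theorem forestLabels_eq (l : List RTree) : forestLabels l = (l.map allLabels).sum := by
  induction l with
  | nil => simp [forestLabels]
  | cons t l ih => simp [forestLabels, ih]

theorem relabelForest_eq (f : ℕ → ℕ) (l : List RTree) : relabelForest f l = l.map (relabel f) := by
  induction l with
  | nil => simp [relabelForest]
  | cons t l ih => simp [relabelForest, ih]

/-- What replaces a single child `t`. -/
def graftChild (x : ℕ) (B t : RTree) : List RTree :=
  if isLeafOf x t && isRed B then B.children else [graft x B t]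

theorem graftForest_eq (x : ℕ) (B : RTree) (l : List RTree) :
    graftForest x B l = l.flatMap (graftChild x B) := by
  induction l with
  | nil => simp [graftForest]
  | cons t l ih => simp [graftForest, graftChild, ih]

theorem isLeafOf_iff (x : ℕ) (t : RTree) : isLeafOf x t = true ↔ t = node {x} [] [] := by
  obtain ⟨L, p, d⟩ := t
  simp [isLeafOf]

theorem isRed_relabel (f : ℕ → ℕ) (t : RTree) : isRed (relabel f t) = isRed t := by
  induction t using ind with
  | h L p d hp hd =>
    rw [Bool.eq_iff_iff, relabel, isRed_node, isRed_node, relabelForest_eq, relabelForest_eq]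
    simp only [Finset.image_eq_empty, List.forall_mem_map]
    refine and_congr_right fun _ => and_congr ?_ ?_
    · exact forall₂_congr fun t ht => by rw [hp t ht]
    · exact forall₂_congr fun t ht => by rw [hd t ht]

theorem allLabels_node (L : Finset ℕ) (p d : List RTree) : allLabels (node L p d) =
    L.val + ((p.map allLabels).sum + (d.map allLabels).sum) := by
  rw [allLabels, forestLabels_eq, forestLabels_eq]

theorem mem_sum_map {j : ℕ} {l : List RTree} :
    j ∈ (l.map allLabels).sum ↔ ∃ t ∈ l, j ∈ allLabels t := by
  induction l with
  | nil => simp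
  | cons t l ih => simp [ih]

/-! Compatibility with the order of the children. -/

theorem Same.isRed_eq {t t' : RTree} (h : Same t t') : isRed t = isRed t' := by
  induction h with
  | refl t => rfl
  | symm _ ih => exact ih.symm
  | trans _ _ ih ih' => exact ih.trans ih'
  | perm L hp hd =>
    rw [Bool.eq_iff_iff, isRed_node, isRed_node]
    simp [hp.mem_iff, hd.mem_iff]
  | plain L p d _ ih => rw [Bool.eq_iff_iff, isRed_node, isRed_node]; simp [ih]
  | dotted L p d _ ih => rw [Bool.eq_iff_iff, isRed_node, isRed_node]; simp [ih]

theorem Same.isLeafOf_eq (x : ℕ) {t t' : RTree} (h : Same t t') :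
    isLeafOf x t = isLeafOf x t' := by
  induction h with
  | refl t => rfl
  | symm _ ih => exact ih.symm
  | trans _ _ ih ih' => exact ih.trans ih'
  | perm L hp hd =>
    simp only [isLeafOf, hp.isEmpty_eq, hd.isEmpty_eq]
  | plain L p d _ ih => simp [isLeafOf]
  | dotted L p d _ ih => simp [isLeafOf]

theorem Same.relabel (f : ℕ → ℕ) {t t' : RTree} (h : Same t t') :
    Same (relabel f t) (relabel f t') := by
  induction h with
  | refl t => exact .refl _
  | symm _ ih => exact ih.symm
  | trans _ _ ih ih' => exact ih.trans ih'
  | perm L hp hd =>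
    simp only [RTree.relabel, relabelForest_eq]
    exact .perm _ (hp.map _) (hd.map _)
  | plain L p d _ ih =>
    simp only [RTree.relabel, relabelForest]
    exact .plain _ _ _ ih
  | dotted L p d _ ih =>
    simp only [RTree.relabel, relabelForest]
    exact .dotted _ _ _ ih

theorem Same.plain_mid (L : Finset ℕ) (p₁ p₂ d : List RTree) {t t' : RTree} (h : Same t t') :
    Same (node L (p₁ ++ t :: p₂) d) (node L (p₁ ++ t' :: p₂) d) :=
  (Same.perm L List.perm_middle (.refl d)).trans
    ((Same.plain L (p₁ ++ p₂) d h).trans (Same.perm L List.perm_middle.symm (.refl d)))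

theorem Same.dotted_mid (L : Finset ℕ) (p d₁ d₂ : List RTree) {t t' : RTree} (h : Same t t') :
    Same (node L p (d₁ ++ t :: d₂)) (node L p (d₁ ++ t' :: d₂)) :=
  (Same.perm L (.refl p) List.perm_middle).trans
    ((Same.dotted L p (d₁ ++ d₂) h).trans (Same.perm L (.refl p) List.perm_middle.symm))

theorem Same.merge (L : Finset ℕ) (p d : List RTree) {B B' : RTree} (h : Same B B') :
    Same (node (L ∪ B.rootLabels) (p ++ B.plain) (d ++ B.dotted))
      (node (L ∪ B'.rootLabels) (p ++ B'.plain) (d ++ B'.dotted)) := by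
  induction h with
  | refl t => exact .refl _
  | symm _ ih => exact ih.symm
  | trans _ _ ih ih' => exact ih.trans ih'
  | perm L hp hd => exact .perm _ (hp.append_left _) (hd.append_left _)
  | plain L' p' d' h _ => exact .plain_mid _ _ _ _ h
  | dotted L' p' d' h _ => exact .dotted_mid _ _ _ _ h

theorem Same.children_plain (L : Finset ℕ) (p₁ p₂ d : List RTree) {B B' : RTree}
    (h : Same B B') :
    Same (node L (p₁ ++ (B.children ++ p₂)) d) (node L (p₁ ++ (B'.children ++ p₂)) d) := by
  induction h with
  | refl t => exact .refl _
  | symm _ ih => exact ih.symm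
  | trans _ _ ih ih' => exact ih.trans ih'
  | perm _ hp hd =>
    exact .perm _ (((hp.append hd).append_right _).append_left _) (.refl _)
  | plain L' p' d' h _ => exact .plain_mid _ _ _ _ h
  | dotted L' p' d' h _ =>
    have := Same.plain_mid L (p₁ ++ p') (d' ++ p₂) d h
    simpa [children, RTree.plain, RTree.dotted] using this

theorem Same.children_dotted (L : Finset ℕ) (p d₁ d₂ : List RTree) {B B' : RTree}
    (h : Same B B') :
    Same (node L p (d₁ ++ (B.children ++ d₂))) (node L p (d₁ ++ (B'.children ++ d₂))) := by
  induction h with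
  | refl t => exact .refl _
  | symm _ ih => exact ih.symm
  | trans _ _ ih ih' => exact ih.trans ih'
  | perm _ hp hd =>
    exact .perm _ (.refl _) (((hp.append hd).append_right _).append_left _)
  | plain L' p' d' h _ => exact .dotted_mid _ _ _ _ h
  | dotted L' p' d' h _ =>
    have := Same.dotted_mid L p (d₁ ++ p') (d' ++ d₂) h
    simpa [children, RTree.plain, RTree.dotted] using this

theorem Same.graft_left (x : ℕ) (B : RTree) {A A' : RTree} (h : Same A A') :
    Same (graft x B A) (graft x B A') := by
  induction h with
  | refl t => exact .refl _
  | symm _ ih => exact ih.symm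
  | trans _ _ ih ih' => exact ih.trans ih'
  | perm L hp hd =>
    have hl := Same.isLeafOf_eq x (Same.perm L hp hd)
    simp only [graft, hl]
    split_ifs
    · exact .refl _
    · exact .perm _ (hp.cons _) hd
    · exact .perm _ (hp.append_right _) (hd.append_right _)
    · simp only [graftForest_eq]
      exact .perm _ (hp.flatMap_right _) (hd.flatMap_right _)
  | plain L p d h ih =>
    have hl := h.isLeafOf_eq x
    have hl' := Same.isLeafOf_eq x (Same.plain L p d h)
    simp only [graft, hl']
    split_ifs
    · exact .refl _
    · exact .plain_mid _ [B] _ _ h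
    · exact .plain _ _ _ h
    · simp only [graftForest, hl]
      split_ifs
      · exact .refl _
      · exact .plain _ _ _ ih
  | dotted L p d h ih =>
    have hl := h.isLeafOf_eq x
    have hl' := Same.isLeafOf_eq x (Same.dotted L p d h)
    simp only [graft, hl']
    split_ifs
    · exact .refl _
    · exact .dotted _ _ _ h
    · exact .dotted _ _ _ h
    · simp only [graftForest, hl]
      split_ifs
      · exact .refl _
      · exact .dotted _ _ _ ih

theorem Same.forest_plain (x : ℕ) {B B' : RTree} (h : Same B B') (L : Finset ℕ)
    (d : List RTree) : ∀ (p p₁ : List RTree),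
    (∀ t ∈ p, Same (graft x B t) (graft x B' t)) →
    Same (node L (p₁ ++ graftForest x B p) d) (node L (p₁ ++ graftForest x B' p) d) := by
  intro p
  induction p with
  | nil => intro p₁ _; exact .refl _
  | cons t p ih =>
    intro p₁ hp
    have ht := hp t (by simp)
    have hp' := fun s hs => hp s (List.mem_cons_of_mem t hs)
    simp only [graftForest, ← h.isRed_eq]
    split_ifs
    · have := ih (p₁ ++ B.children) hp'
      rw [List.append_assoc, List.append_assoc] at this
      exact this.trans (Same.children_plain L p₁ _ d h)
    · have := ih (p₁ ++ [graft x B t]) hp'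
      rw [List.append_assoc, List.append_assoc] at this
      exact this.trans (Same.plain_mid L p₁ _ d ht)

theorem Same.forest_dotted (x : ℕ) {B B' : RTree} (h : Same B B') (L : Finset ℕ)
    (p : List RTree) : ∀ (d d₁ : List RTree),
    (∀ t ∈ d, Same (graft x B t) (graft x B' t)) →
    Same (node L p (d₁ ++ graftForest x B d)) (node L p (d₁ ++ graftForest x B' d)) := by
  intro d
  induction d with
  | nil => intro d₁ _; exact .refl _
  | cons t d ih =>
    intro d₁ hd
    have ht := hd t (by simp)
    have hd' := fun s hs => hd s (List.mem_cons_of_mem t hs)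
    simp only [graftForest, ← h.isRed_eq]
    split_ifs
    · have := ih (d₁ ++ B.children) hd'
      rw [List.append_assoc, List.append_assoc] at this
      exact this.trans (Same.children_dotted L p d₁ _ h)
    · have := ih (d₁ ++ [graft x B t]) hd'
      rw [List.append_assoc, List.append_assoc] at this
      exact this.trans (Same.dotted_mid L p d₁ _ ht)

theorem Same.graft_right (x : ℕ) {B B' : RTree} (h : Same B B') (A : RTree) :
    Same (graft x B A) (graft x B' A) := by
  induction A using ind with
  | h L p d hp hd =>
    simp only [graft, ← h.isRed_eq]
    split_ifs
    · exact h
    · exact .plain _ _ _ h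
    · exact .merge _ _ _ h
    · exact (Same.forest_plain x h L _ p [] hp).trans (Same.forest_dotted x h L _ d [] hd)

theorem Same.comp (n x : ℕ) {A A' B B' : RTree} (hA : Same A A') (hB : Same B B') :
    Same (comp n x A B) (comp n x A' B') :=
  (Same.graft_left x _ (hA.relabel _)).trans (Same.graft_right x (hB.relabel _) _)

/-! Closure of the set of recursively labelled trees under composition. -/

theorem allLabels_relabel (f : ℕ → ℕ) (t : RTree)
    (hf : ∀ a ∈ allLabels t, ∀ b ∈ allLabels t, f a = f b → a = b) :
    allLabels (relabel f t) = (allLabels t).map f := by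
  induction t using ind with
  | h L p d hp hd =>
    rw [relabel, allLabels_node, relabelForest_eq, relabelForest_eq, List.map_map, List.map_map]
    rw [allLabels_node] at hf ⊢
    have hL : (L.image f).val = L.val.map f := by
      refine Finset.image_val_of_injOn fun a ha b hb => hf a ?_ b ?_
      · exact Multiset.mem_add.2 (.inl ha)
      · exact Multiset.mem_add.2 (.inl hb)
    have key : ∀ l : List RTree, (∀ t ∈ l, allLabels (relabel f t) = (allLabels t).map f) →
        (l.map (allLabels ∘ relabel f)).sum = ((l.map allLabels).sum).map f := by
      intro l hl
      induction l with
      | nil => simp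
      | cons t l ih =>
        simp only [List.map_cons, List.sum_cons, Multiset.map_add, Function.comp]
        rw [hl t (by simp)]
        congr 1
        exact ih fun s hs => hl s (List.mem_cons_of_mem t hs)
    rw [hL, Multiset.map_add, Multiset.map_add, key p, key d]
    · intro t ht
      refine hd t ht fun a ha b hb => hf a ?_ b ?_
      · exact Multiset.mem_add.2 (.inr (Multiset.mem_add.2 (.inr (mem_sum_map.2 ⟨t, ht, ha⟩))))
      · exact Multiset.mem_add.2 (.inr (Multiset.mem_add.2 (.inr (mem_sum_map.2 ⟨t, ht, hb⟩))))
    · intro t ht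
      refine hp t ht fun a ha b hb => hf a ?_ b ?_
      · exact Multiset.mem_add.2 (.inr (Multiset.mem_add.2 (.inl (mem_sum_map.2 ⟨t, ht, ha⟩))))
      · exact Multiset.mem_add.2 (.inr (Multiset.mem_add.2 (.inl (mem_sum_map.2 ⟨t, ht, hb⟩))))

theorem IsRedWhite.relabel (f : ℕ → ℕ) {t : RTree} (h : IsRedWhite t) :
    IsRedWhite (relabel f t) := by
  induction h with
  | node L p d h1 h2 h3 _ _ hp hd =>
    have hr := isRed_relabel f (.node L p d)
    rw [RTree.relabel] at hr ⊢
    rw [relabelForest_eq, relabelForest_eq] at *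
    refine .node _ _ _ ?_ ?_ ?_ ?_ ?_
    · simpa using h1
    · rw [hr]
      intro h
      rw [h2 h]
      rfl
    · simpa [isRed_relabel] using h3
    · simpa using hp
    · simpa using hd

theorem isRed_graft {x : ℕ} {B : RTree} (t : RTree) (h : ¬ (isLeafOf x t ∧ isRed B)) :
    isRed (graft x B t) = isRed t := by
  induction t using ind with
  | h L p d hp hd =>
    have key : ∀ l : List RTree,
        (∀ t ∈ l, ¬ (isLeafOf x t ∧ isRed B) → isRed (graft x B t) = isRed t) →
        ((∀ t ∈ graftForest x B l, isRed t = false) ↔ ∀ t ∈ l, isRed t = false) := by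
      intro l hl
      rw [graftForest_eq]
      simp only [List.mem_flatMap, forall_exists_index, and_imp]
      rw [forall_comm]
      refine forall_congr' fun t => ?_
      rw [forall_comm]
      refine forall_congr' fun ht => ?_
      by_cases hB : isLeafOf x t ∧ isRed B
      · have hc : ∀ s ∈ B.children, isRed s = false := by
          obtain ⟨L', p', d'⟩ := B
          have := (isRed_node _ _ _).1 hB.2
          intro s hs
          rcases List.mem_append.1 hs with hs | hs
          · exact this.2.1 s hs
          · exact this.2.2 s hs
        have ht' : isRed t = false := by
          rw [(isLeafOf_iff x t).1 hB.1]
          simp [isRed]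
        simp only [graftChild, hB.1, hB.2, Bool.and_self, if_true]
        exact ⟨fun _ => ht', fun _ => hc⟩
      · have h' : ¬ ((isLeafOf x t && isRed B) = true) := by simpa using hB
        simp only [graftChild, if_neg h', List.mem_singleton, forall_eq]
        rw [hl t ht hB]
    simp only [graft]
    split_ifs with hx hB hl
    · exact absurd ⟨hl, hB⟩ h
    · have hL : L ≠ ∅ := Finset.ne_empty_of_mem hx
      rw [Bool.eq_iff_iff, isRed_node, isRed_node]
      simp [hB, hL]
    · have hL : L ≠ ∅ := Finset.ne_empty_of_mem hx
      obtain ⟨L', p', d'⟩ := B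
      rw [Bool.eq_iff_iff, isRed_node, isRed_node]
      rw [isRed_node] at hB
      simp only [hL, false_and, iff_false]
      rintro ⟨h1, h2, h3⟩
      refine hB ⟨(Finset.union_eq_empty.1 h1).2, fun t ht => h2 t ?_, fun t ht => h3 t ?_⟩
      · exact List.mem_append_right _ ht
      · exact List.mem_append_right _ ht
    · rw [Bool.eq_iff_iff, isRed_node, isRed_node, key p hp, key d hd]

theorem IsRedWhite.children {t : RTree} (h : IsRedWhite t) : ∀ s ∈ t.children, IsRedWhite s := by
  cases h with
  | node L p d _ _ _ hp hd =>
    intro s hs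
    rcases List.mem_append.1 hs with hs | hs
    · exact hp s hs
    · exact hd s hs

theorem IsRedWhite.two_le {t : RTree} (h : IsRedWhite t) (ht : isRed t) :
    2 ≤ t.children.length := by
  cases h with
  | node L p d h1 _ _ _ _ =>
    rw [isRed_node] at ht
    have := h1 ht.1
    simpa [RTree.children, RTree.plain, RTree.dotted] using this

theorem isRed_children {t : RTree} (ht : isRed t) : ∀ s ∈ t.children, isRed s = false := by
  obtain ⟨L, p, d⟩ := t
  rw [isRed_node] at ht
  intro s hs
  rcases List.mem_append.1 hs with hs | hs
  · exact ht.2.1 s hs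
  · exact ht.2.2 s hs

theorem length_le_graftForest {x : ℕ} {B : RTree} (hB : IsRedWhite B) (l : List RTree) :
    l.length ≤ (graftForest x B l).length := by
  induction l with
  | nil => simp
  | cons t l ih =>
    rw [graftForest, List.length_append, List.length_cons]
    split_ifs with h
    · have := hB.two_le (by simpa using (Bool.and_eq_true_iff.1 h).2)
      omega
    · simp only [List.length_singleton]
      omega

theorem IsRedWhite.graft {x : ℕ} {B t : RTree} (hB : IsRedWhite B) (ht : IsRedWhite t) :
    IsRedWhite (graft x B t) := by
  induction ht with
  | node L p d h1 h2 h3 hp0 hd0 hp hd =>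
    have key : ∀ l : List RTree, (∀ t ∈ l, IsRedWhite (RTree.graft x B t)) →
        ∀ t ∈ graftForest x B l, IsRedWhite t := by
      intro l hl t ht
      rw [graftForest_eq, List.mem_flatMap] at ht
      obtain ⟨s, hs, ht⟩ := ht
      unfold graftChild at ht
      split_ifs at ht with h
      · exact hB.children t ht
      · rw [List.mem_singleton.1 ht]
        exact hl s hs
    by_cases hl : isLeafOf x (.node L p d) ∧ isRed B
    · have hx : x ∈ L := by
        have := (isLeafOf_iff _ _).1 hl.1
        simp only [RTree.node.injEq] at this
        simp [this.1]
      simp only [RTree.graft, if_pos hx, hl.1, hl.2, if_true]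
      exact hB
    · have hr := isRed_graft (.node L p d) hl
      simp only [RTree.graft] at hr ⊢
      split_ifs at hr ⊢ with hx hBr hlf
      · exact hB
      · refine .node _ _ _ ?_ ?_ h3 ?_ hd0
        · intro hL
          have hLx : L = {x} := by
            rw [← Finset.insert_erase hx, hL]
            rfl
          have : ¬ (p = [] ∧ d = []) := fun hpd => hlf (by
            rw [isLeafOf_iff, hLx, hpd.1, hpd.2])
          rcases p with _ | ⟨_, _⟩
          · rcases d with _ | ⟨_, _⟩
            · simp at this
            · simp only [List.length_cons]
              omega
          · simp only [List.length_cons]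
            omega
        · rw [hr]
          exact h2
        · intro t ht
          rcases List.mem_cons.1 ht with rfl | ht
          · exact hB
          · exact hp0 t ht
      · cases hB with
        | node L' p' d' k1 k2 k3 kp kd =>
          simp only [RTree.rootLabels, RTree.plain, RTree.dotted] at hr ⊢
          refine .node _ _ _ ?_ ?_ ?_ ?_ ?_
          · intro hL
            have := k1 (Finset.union_eq_empty.1 hL).2
            simp only [List.length_append]
            omega
          · rw [hr, isRed_node]
            exact fun h => absurd h.1 (Finset.ne_empty_of_mem hx)
          · intro t ht
            rcases List.mem_append.1 ht with ht | ht
            · exact h3 t ht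
            · exact k3 t ht
          · intro t ht
            rcases List.mem_append.1 ht with ht | ht
            · exact hp0 t ht
            · exact kp t ht
          · intro t ht
            rcases List.mem_append.1 ht with ht | ht
            · exact hd0 t ht
            · exact kd t ht
      · refine .node _ _ _ ?_ ?_ ?_ (key p hp) (key d hd)
        · intro hL
          have := length_le_graftForest (x := x) hB p
          have := length_le_graftForest (x := x) hB d
          have := h1 hL
          omega
        · rw [hr]
          intro h
          rw [h2 h]
          rfl
        · intro t ht
          rw [graftForest_eq, List.mem_flatMap] at ht
          obtain ⟨s, hs, ht⟩ := ht
          unfold graftChild at ht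
          split_ifs at ht with h
          · rw [isRed_children (Bool.and_eq_true_iff.1 h).2 t ht]
            simp
          · rw [List.mem_singleton.1 ht, isRed_graft s (by simpa using h)]
            exact h3 s hs

/-- The shift of the labels greater than `x`. -/
theorem shift_injective {n x : ℕ} (hn : 1 ≤ n) :
    Function.Injective (fun j => if j ≤ x then j else j + n - 1) := by
  intro a b h
  simp only at h
  split_ifs at h <;> omega

theorem blowUp_of_ne {n x j : ℕ} (h : j ≠ x) :
    blowUp x n j = {if j ≤ x then j else j + n - 1} := by
  unfold blowUp
  split_ifs <;> first | rfl | omega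

theorem bind_blowUp {n x : ℕ} {s : Multiset ℕ} (h : x ∉ s) :
    s.bind (fun j => (blowUp x n j).val) = s.map (fun j => if j ≤ x then j else j + n - 1) := by
  rw [← Multiset.bind_singleton]
  refine Multiset.bind_congr fun j hj => ?_
  rw [blowUp_of_ne (fun e : j = x => h (e ▸ hj))]
  rfl

theorem allLabels_eq (t : RTree) : allLabels t =
    t.rootLabels.val + (t.children.map allLabels).sum := by
  obtain ⟨L, p, d⟩ := t
  rw [allLabels_node]
  simp [children, plain, dotted, rootLabels]

theorem relabel_isLeafOf {n x : ℕ} (hn : 1 ≤ n) (t : RTree) :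
    isLeafOf x (relabel (fun j => if j ≤ x then j else j + n - 1) t) = isLeafOf x t := by
  obtain ⟨L, p, d⟩ := t
  have hi := Finset.image_injective (shift_injective (x := x) hn)
  have : L.image (fun j => if j ≤ x then j else j + n - 1) = {x} ↔ L = {x} := by
    have h : ({x} : Finset ℕ) = ({x} : Finset ℕ).image
      (fun j => if j ≤ x then j else j + n - 1) := by simp
    rw [h, hi.eq_iff, ← h]
  rw [Bool.eq_iff_iff, relabel, isLeafOf_iff, isLeafOf_iff, relabelForest_eq, relabelForest_eq]
  simp [this]

theorem mem_image_shift {n x : ℕ} (hn : 1 ≤ n) (L : Finset ℕ) :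
    x ∈ L.image (fun j => if j ≤ x then j else j + n - 1) ↔ x ∈ L := by
  rw [Finset.mem_image]
  constructor
  · rintro ⟨j, hj, h⟩
    split_ifs at h
    · exact h ▸ hj
    · omega
  · exact fun h => ⟨x, h, by simp⟩

theorem allLabels_graft {n x : ℕ} (hn : 1 ≤ n) {B : RTree}
    (hB : allLabels B = (Finset.Icc x (x + n - 1)).val) (t : RTree) (ht : (allLabels t).Nodup) :
    allLabels (graft x B (relabel (fun j => if j ≤ x then j else j + n - 1) t)) =
      (allLabels t).bind (fun j => (blowUp x n j).val) := by
  induction t using ind with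
  | h L p d hp hd =>
    set s : ℕ → ℕ := fun j => if j ≤ x then j else j + n - 1 with hs
    have hinj : Function.Injective s := shift_injective hn
    have hlf : isLeafOf x (relabel s (.node L p d)) = isLeafOf x (.node L p d) :=
      relabel_isLeafOf hn _
    have hmem : x ∈ L.image s ↔ x ∈ L := mem_image_shift hn L
    rw [relabel] at hlf ⊢
    simp only [graft, hmem, hlf]
    rw [allLabels_node] at ht
    by_cases hx : x ∈ L
    · rw [if_pos hx]
      obtain ⟨h1, h2, h3⟩ := Multiset.nodup_add.1 ht
      have hxc : x ∉ (p.map allLabels).sum + (d.map allLabels).sum :=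
        Multiset.disjoint_left.1 h3 hx
      have hkids : ((p.map allLabels).sum + (d.map allLabels).sum).bind
          (fun j => (blowUp x n j).val) =
          ((relabelForest s p).map allLabels).sum + ((relabelForest s d).map allLabels).sum := by
        rw [bind_blowUp hxc, relabelForest_eq, relabelForest_eq, Multiset.map_add]
        have key : ∀ l : List RTree, ((l.map allLabels).sum).map s =
            ((l.map (relabel s)).map allLabels).sum := by
          intro l
          induction l with
          | nil => simp
          | cons t l ih =>
            simp only [List.map_cons, List.sum_cons, Multiset.map_add, ih]
            rw [allLabels_relabel s t fun a _ b _ h => hinj h]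
        rw [key p, key d]
      have hroot : L.val.bind (fun j => (blowUp x n j).val) =
          ((L.image s).erase x).val + allLabels B := by
        have hLe : L.val = x ::ₘ (L.erase x).val := by
          rw [Finset.erase_val, Multiset.cons_erase hx]
        have hsx : s x = x := by simp [hs]
        have he : (L.image s).erase x = (L.erase x).image s := by
          conv_lhs => rw [← hsx]
          rw [Finset.image_erase hinj]
        rw [hLe, Multiset.cons_bind, bind_blowUp (by rw [Finset.mem_val]; simp), he, add_comm,
          Finset.image_val_of_injOn hinj.injOn, hB]
        congr 1
        simp [blowUp]
      rw [allLabels_node, Multiset.add_bind, hkids, hroot]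
      split_ifs with hr hl
      · have h := (isLeafOf_iff _ _).1 hl
        simp only [RTree.node.injEq] at h
        obtain ⟨rfl, rfl, rfl⟩ := h
        simp [relabelForest, hs]
      · rw [allLabels_node]
        simp only [List.map_cons, List.sum_cons]
        abel
      · rw [allLabels_node]
        have hdisj : Disjoint ((L.image s).erase x) B.rootLabels := by
          rw [Finset.disjoint_left]
          intro j hj hj'
          have hjB : j ∈ allLabels B := by
            rw [allLabels_eq]
            exact Multiset.mem_add.2 (.inl hj')
          rw [hB, Finset.mem_val, Finset.mem_Icc] at hjB
          obtain ⟨hjx, hj⟩ := Finset.mem_erase.1 hj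
          obtain ⟨i, _, hi⟩ := Finset.mem_image.1 hj
          simp only [hs] at hi
          split_ifs at hi <;> omega
        have hu : ((L.image s).erase x ∪ B.rootLabels).val =
            ((L.image s).erase x).val + B.rootLabels.val := by
          rw [← Finset.disjUnion_eq_union _ _ hdisj]
          rfl
        rw [hu, allLabels_eq B]
        simp only [children, List.map_append, List.sum_append]
        abel
    · rw [if_neg hx]
      have key : ∀ l : List RTree, ((l.map allLabels).sum).Nodup →
          (∀ t ∈ l, (allLabels t).Nodup → allLabels (graft x B (relabel s t)) =
            (allLabels t).bind (fun j => (blowUp x n j).val)) →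
          ((graftForest x B (relabelForest s l)).map allLabels).sum =
            ((l.map allLabels).sum).bind (fun j => (blowUp x n j).val) := by
        intro l hnd hl
        induction l with
        | nil => simp [relabelForest, graftForest]
        | cons t l ih =>
          simp only [List.map_cons, List.sum_cons] at hnd ⊢
          obtain ⟨h1, h2, _⟩ := Multiset.nodup_add.1 hnd
          rw [relabelForest, graftForest, List.map_append, List.sum_append,
            ih h2 fun t ht => hl t (List.mem_cons_of_mem _ ht), Multiset.add_bind]
          congr 1
          split_ifs with h
          · obtain ⟨ha, hb⟩ := Bool.and_eq_true_iff.1 h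
            have hz : isLeafOf x t = true := (relabel_isLeafOf hn t).symm.trans ha
            rw [(isLeafOf_iff x t).1 hz]
            have hBL : B.rootLabels = ∅ := by
              obtain ⟨L', p', d'⟩ := B
              exact ((isRed_node _ _ _).1 hb).1
            have := allLabels_eq B
            rw [hB, hBL] at this
            simp only [Finset.empty_val, zero_add] at this
            rw [← this]
            simp [allLabels_node, blowUp]
          · simp only [List.map_cons, List.map_nil, List.sum_cons, List.sum_nil, add_zero]
            exact hl t (by simp) h1
      obtain ⟨_, h2, _⟩ := Multiset.nodup_add.1 ht
      obtain ⟨h3, h4, _⟩ := Multiset.nodup_add.1 h2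
      rw [allLabels_node, allLabels_node, key p h3 hp, key d h4 hd, Multiset.add_bind,
        Multiset.add_bind, bind_blowUp (s := L.val) hx, Finset.image_val_of_injOn hinj.injOn]

/-- Blowing up a point of an interval gives an interval. -/
theorem biUnion_blowUp_Icc {n x : ℕ} (hn : 1 ≤ n) (a b : ℕ) :
    ∃ a' b' : ℕ, (Finset.Icc a b).biUnion (blowUp x n) = Finset.Icc a' b' := by
  by_cases hab : a ≤ b
  · refine ⟨if a ≤ x then a else a + n - 1, if b < x then b else b + n - 1, ?_⟩
    ext l
    simp only [Finset.mem_biUnion, Finset.mem_Icc, mem_blowUp]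
    constructor
    · rintro ⟨j, hj, h⟩
      split_ifs <;> omega
    · intro h
      by_cases h1 : l < x
      · exact ⟨l, by split_ifs at h <;> omega, by omega⟩
      · by_cases h2 : l ≤ x + n - 1
        · exact ⟨x, by split_ifs at h <;> omega, by omega⟩
        · exact ⟨l + 1 - n, by split_ifs at h <;> omega, by omega⟩
  · exact ⟨1, 0, by simp [Finset.Icc_eq_empty hab]⟩

theorem IsRecursive.relabel {f : ℕ → ℕ} {t : RTree} (h : IsRecursive t)
    (hf : ∀ a ∈ allLabels t, ∀ b ∈ allLabels t, f a = f b → a = b)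
    (hI : ∀ s : Finset ℕ, (∀ j ∈ s, j ∈ allLabels t) → (∃ a b, s = Finset.Icc a b) →
      ∃ a b, s.image f = Finset.Icc a b) : IsRecursive (relabel f t) := by
  induction h with
  | node L p d h1 _ _ hp hd =>
    have hl := allLabels_relabel f _ hf
    rw [RTree.relabel] at hl ⊢
    have hmp : ∀ t ∈ p, ∀ j ∈ allLabels t, j ∈ allLabels (.node L p d) := by
      intro t ht j hj
      rw [allLabels_node]
      exact Multiset.mem_add.2 (.inr (Multiset.mem_add.2 (.inl (mem_sum_map.2 ⟨t, ht, hj⟩))))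
    have hmd : ∀ t ∈ d, ∀ j ∈ allLabels t, j ∈ allLabels (.node L p d) := by
      intro t ht j hj
      rw [allLabels_node]
      exact Multiset.mem_add.2 (.inr (Multiset.mem_add.2 (.inr (mem_sum_map.2 ⟨t, ht, hj⟩))))
    refine .node _ _ _ ?_ ?_ ?_
    · rw [hl, Multiset.toFinset_map]
      exact hI _ (fun j hj => Multiset.mem_toFinset.1 hj) h1
    · rw [relabelForest_eq, List.forall_mem_map]
      exact fun t ht => hp t ht (fun a ha b hb => hf a (hmp t ht a ha) b (hmp t ht b hb))
        (fun s hs => hI s fun j hj => hmp t ht j (hs j hj))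
    · rw [relabelForest_eq, List.forall_mem_map]
      exact fun t ht => hd t ht (fun a ha b hb => hf a (hmd t ht a ha) b (hmd t ht b hb))
        (fun s hs => hI s fun j hj => hmd t ht j (hs j hj))

theorem IsRecursive.children {t : RTree} (h : IsRecursive t) :
    ∀ s ∈ t.children, IsRecursive s := by
  cases h with
  | node L p d _ hp hd =>
    intro s hs
    rcases List.mem_append.1 hs with hs | hs
    · exact hp s hs
    · exact hd s hs

theorem toFinset_bind_blowUp (n x : ℕ) (s : Multiset ℕ) :
    (s.bind (fun j => (blowUp x n j).val)).toFinset = s.toFinset.biUnion (blowUp x n) := by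
  ext l
  simp

theorem IsRecursive.graft {n x : ℕ} (hn : 1 ≤ n) {B t : RTree}
    (hB : allLabels B = (Finset.Icc x (x + n - 1)).val) (hBr : IsRecursive B)
    (ht : IsRecursive t) (hnd : (allLabels t).Nodup) :
    IsRecursive (graft x B (RTree.relabel (fun j => if j ≤ x then j else j + n - 1) t)) := by
  induction ht with
  | node L p d h1 hp0 hd0 hp hd =>
    set s : ℕ → ℕ := fun j => if j ≤ x then j else j + n - 1 with hs
    have hinj : Function.Injective s := shift_injective hn
    have hlab := allLabels_graft hn hB _ hnd
    have hint : ∃ a b : ℕ, (allLabels (RTree.graft x B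
        (RTree.relabel s (.node L p d)))).toFinset = Finset.Icc a b := by
      obtain ⟨a, b, hab⟩ := h1
      rw [hlab, toFinset_bind_blowUp, hab]
      exact biUnion_blowUp_Icc hn a b
    have hmem : x ∈ L.image s ↔ x ∈ L := mem_image_shift hn L
    rw [RTree.relabel] at hint ⊢
    simp only [RTree.graft, hmem] at hint ⊢
    rw [allLabels_node] at hnd
    obtain ⟨_, h2, h3⟩ := Multiset.nodup_add.1 hnd
    obtain ⟨h4, h5, _⟩ := Multiset.nodup_add.1 h2
    by_cases hx : x ∈ L
    · rw [if_pos hx] at hint ⊢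
      have hxc : x ∉ (p.map allLabels).sum + (d.map allLabels).sum :=
        Multiset.disjoint_left.1 h3 hx
      have key : ∀ t : RTree, x ∉ allLabels t → IsRecursive t →
          IsRecursive (RTree.relabel s t) := by
        intro t hxt ht
        refine ht.relabel (fun a _ b _ h => hinj h) ?_
        rintro S hS ⟨a, b, rfl⟩
        obtain ⟨a', b', h⟩ := biUnion_blowUp_Icc (x := x) hn a b
        refine ⟨a', b', h ▸ ?_⟩
        rw [← Finset.biUnion_singleton]
        refine Finset.biUnion_congr rfl fun j hj => ?_
        rw [blowUp_of_ne]
        rintro rfl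
        exact hxt (hS _ hj)
      have hp' : ∀ t ∈ relabelForest s p, IsRecursive t := by
        rw [relabelForest_eq, List.forall_mem_map]
        exact fun t ht => key t (fun h => hxc (Multiset.mem_add.2
          (.inl (mem_sum_map.2 ⟨t, ht, h⟩)))) (hp0 t ht)
      have hd' : ∀ t ∈ relabelForest s d, IsRecursive t := by
        rw [relabelForest_eq, List.forall_mem_map]
        exact fun t ht => key t (fun h => hxc (Multiset.mem_add.2
          (.inr (mem_sum_map.2 ⟨t, ht, h⟩)))) (hd0 t ht)
      split_ifs at hint ⊢
      · exact hBr
      · refine .node _ _ _ hint ?_ hd'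
        intro t ht
        rcases List.mem_cons.1 ht with rfl | ht
        · exact hBr
        · exact hp' t ht
      · refine .node _ _ _ hint ?_ ?_
        · intro t ht
          rcases List.mem_append.1 ht with ht | ht
          · exact hp' t ht
          · exact hBr.children t (List.mem_append_left _ ht)
        · intro t ht
          rcases List.mem_append.1 ht with ht | ht
          · exact hd' t ht
          · exact hBr.children t (List.mem_append_right _ ht)
    · rw [if_neg hx] at hint ⊢
      have key : ∀ l : List RTree, ((l.map allLabels).sum).Nodup →
          (∀ t ∈ l, (allLabels t).Nodup → IsRecursive (RTree.graft x B (RTree.relabel s t))) →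
          ∀ t ∈ graftForest x B (relabelForest s l), IsRecursive t := by
        intro l hndl hl
        induction l with
        | nil => simp [relabelForest, graftForest]
        | cons t l ih =>
          simp only [List.map_cons, List.sum_cons] at hndl
          obtain ⟨k1, k2, _⟩ := Multiset.nodup_add.1 hndl
          rw [relabelForest, graftForest]
          intro u hu
          rcases List.mem_append.1 hu with hu | hu
          · split_ifs at hu
            · exact hBr.children u hu
            · rw [List.mem_singleton.1 hu]
              exact hl t (by simp) k1
          · exact ih k2 (fun t ht => hl t (List.mem_cons_of_mem _ ht)) u hu
      exact .node _ _ _ hint (key p h4 hp) (key d h5 hd)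

theorem IsRWTree.pos {n : ℕ} {t : RTree} (h : IsRWTree n t) : 1 ≤ n := by
  have key : ∀ t : RTree, IsRedWhite t → allLabels t ≠ 0 := by
    intro t ht
    induction ht with
    | node L p d h1 _ _ _ _ hp hd =>
      intro h0
      rw [allLabels_node] at h0
      simp only [add_eq_zero, Finset.val_eq_zero] at h0
      obtain ⟨hL, h2, h3⟩ := h0
      have hlen := h1 hL
      rcases p with _ | ⟨t, p⟩
      · rcases d with _ | ⟨t, d⟩
        · simp at hlen
        · simp only [List.map_cons, List.sum_cons, add_eq_zero] at h3
          exact hd t (by simp) h3.1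
      · simp only [List.map_cons, List.sum_cons, add_eq_zero] at h2
        exact hp t (by simp) h2.1
  rcases Nat.eq_zero_or_pos n with rfl | hn
  · exact absurd (by rw [h.labels]; rfl) (key t h.redWhite)
  · exact hn

theorem IsRWTree.comp {m n k : ℕ} (hk : k + 1 = m + n) {x : ℕ} (hx : 1 ≤ x ∧ x ≤ m)
    {A B : RTree} (hA : IsRWTree m A) (hB : IsRWTree n B) : IsRWTree k (comp n x A B) := by
  have hn := hB.pos
  have hinj : ∀ a ∈ allLabels B, ∀ b ∈ allLabels B, a + (x - 1) = b + (x - 1) → a = b :=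
    fun a _ b _ h => by omega
  have hBl : allLabels (RTree.relabel (fun j => j + (x - 1)) B) =
      (Finset.Icc x (x + n - 1)).val := by
    rw [allLabels_relabel _ _ hinj, hB.labels,
      ← Finset.image_val_of_injOn (fun a _ b _ (h : a + (x - 1) = b + (x - 1)) => by omega)]
    congr 1
    ext l
    simp only [Finset.mem_image, Finset.mem_Icc]
    constructor
    · rintro ⟨j, hj, rfl⟩
      omega
    · exact fun h => ⟨l - (x - 1), by omega, by omega⟩
  have hBr : IsRecursive (RTree.relabel (fun j => j + (x - 1)) B) := by
    refine hB.recursive.relabel hinj ?_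
    rintro s _ ⟨a, b, rfl⟩
    refine ⟨a + (x - 1), b + (x - 1), ?_⟩
    simp
  have hnd : (allLabels A).Nodup := by
    rw [hA.labels]
    exact Finset.nodup _
  have hlab := allLabels_graft hn hBl A hnd
  refine ⟨(hB.redWhite.relabel _).graft (hA.redWhite.relabel _), ?_,
    IsRecursive.graft hn hBl hBr hA.recursive hnd⟩
  refine hlab.trans ?_
  rw [hA.labels]
  have hd : ((Finset.Icc 1 m : Finset ℕ) : Set ℕ).PairwiseDisjoint (blowUp x n) := by
    intro i hi j hj hij
    rw [Function.onFun, Finset.disjoint_left]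
    intro l hl hl'
    rw [mem_blowUp] at hl hl'
    omega
  have : (Finset.Icc 1 m).disjiUnion (blowUp x n) hd = Finset.Icc 1 k := by
    ext l
    simp only [Finset.mem_disjiUnion, Finset.mem_Icc, mem_blowUp]
    constructor
    · rintro ⟨j, hj, h⟩
      omega
    · intro h
      by_cases h1 : l < x
      · exact ⟨l, by omega, by omega⟩
      · by_cases h2 : l ≤ x + n - 1
        · exact ⟨x, by omega, by omega⟩
        · exact ⟨l + 1 - n, by omega, by omega⟩
  rw [← this]
  rfl

/-- Equality up to the order of the children, on recursively labelled trees. -/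
def sameSetoid (n : ℕ) : Setoid {t : RTree // IsRWTree n t} :=
  ⟨fun a b => Same a.1 b.1, fun a => .refl a.1, fun h => .symm h, fun h h' => .trans h h'⟩

theorem isRWTree_one : IsRWTree 1 (node {1} [] []) := by
  refine ⟨.node _ _ _ ?_ ?_ ?_ ?_ ?_, ?_, .node _ _ _ ⟨1, 1, ?_⟩ ?_ ?_⟩ <;>
    simp [isRed, allLabels, forestLabels]

end RTree

/-- The operad of recursively labelled dotted red and white trees, where the children of a node are
not ordered. -/
def RW6 : PreOperad where
  Op n := Quotient (RTree.sameSetoid n)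
  arity_pos a := Quotient.inductionOn a fun t => t.2.pos
  one := Quotient.mk _ ⟨.node {1} [] [], RTree.isRWTree_one⟩
  circ {_ n _} h i hi :=
    Quotient.map₂ (fun A B => ⟨RTree.comp n i A.1 B.1, A.2.comp h hi B.2⟩)
      fun _ _ hA _ _ hB => RTree.Same.comp n i hA hB

/-- The trees with two labels that correspond to the six generators. -/
def genTree : Gen6 → RTree
  | .prec => .node {1} [.node {2} [] []] []
  | .succ => .node {2} [.node {1} [] []] []
  | .mid => .node {1, 2} [] []
  | .odot => .node ∅ [.node {1} [] [], .node {2} [] []] []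
  | .ll => .node {1} [] [.node {2} [] []]
  | .gg => .node {2} [] [.node {1} [] []]

theorem isRWTree_genTree (g : Gen6) : RTree.IsRWTree 2 (genTree g) := by
  have leaf : ∀ j : ℕ, RTree.IsRedWhite (.node {j} [] []) ∧
      RTree.IsRecursive (.node {j} [] []) := by
    intro j
    refine ⟨.node _ _ _ ?_ ?_ ?_ ?_ ?_, .node _ _ _ ⟨j, j, ?_⟩ ?_ ?_⟩ <;>
      simp [RTree.isRed, RTree.allLabels, RTree.forestLabels]
  refine ⟨?_, ?_, ?_⟩
  · cases g <;> refine .node _ _ _ ?_ ?_ ?_ ?_ ?_ <;>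
      simp [RTree.isRed, RTree.noneRed, leaf]
  · cases g <;> decide
  · cases g <;> refine .node _ _ _ ⟨1, 2, ?_⟩ ?_ ?_ <;>
      first | decide | simp [leaf]

/-- The generators of the operad of trees. -/
def rw6Gen (g : Gen6) : RW6.Op 2 := Quotient.mk _ ⟨genTree g, isRWTree_genTree g⟩

-- All three operads embed in the Hadamard product `H` of `Mon` and `FF`, which is an operad by
-- direct verification. Injective morphisms into `H` give the operad axioms for free
-- (`Hom.isOperad`), and two of them with the same image give an isomorphism of their sources
-- (`Hom.exists_iso`). The embeddings are the inclusion for `FF6`, the evaluation of binary trees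
-- for `GR6`, and `valueHom` for `RW6`. The last one sends a tree to a monomial, with one factor
-- `u_j` for each dotted edge and each label `j` above it, and to a fraction, in which the set of
-- labels of the descendants of a node has exponent `-1` if the node is white, `1` if it is red and
-- not the root, and `0` if it is a red root. These exponents are exactly what makes the three cases
-- of grafting agree with the factor `[S]` in the composition of fractions (`nodeSum_graft`,
-- `frac_graft`).
--
-- The three embeddings are compared through planar words `PWord`. Subtrees of a recursively
-- labelled tree carry intervals, so the labels and children of each node are linearly ordered from
-- left to right, and the labels themselves can be forgotten. Five facts carry the proof. (1) Six
-- operations on planar words give a map `ofBTree` from binary trees, with a section `toBTree`, a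
-- normal form (`ofBTree_toBTree`). (2) The sixteen relations suffice to bring every binary tree to
-- the normal form of its planar word (`toBTree_op`), so binary trees with the same planar word are
-- congruent. (3) The value of a binary tree in `H` is that of its planar word (`evalAt_genFrac`).
-- As the relations hold between planar words, they hold in `H`. (4) A planar word can be recovered
-- from its value (`eq_of_sums_eq`). (5) Every recursively labelled tree is a planar word up to the
-- order of the children (`exists_toRTree`). By (2), (3) and (4) the kernel of the evaluation is the
-- congruence; by (4) and (5) `valueHom` is injective; by (1), (3) and (5) the images coincide, and
-- planar words with `n` labels are in bijection with the operations of arity `n`.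
--
-- For the series, let `W`, `R` count white and red trees, `F = W + R`, and let `N` and `C` count
-- the words without and with a core, a core being a label or a red child. A red tree is a white
-- child followed by a non-empty plain word of white children, and such words are counted by `F`; so
-- `R = W F`. Reading the first letter gives `N = 1 + 2 W N` and `C = (x + R)(N + C) + 2 W C`.
-- Finally `C = F`, since a word with a core is a white tree or a single red child. The equation for
-- `F` follows by elimination.

/-! ### Operads: morphisms, transfer of the axioms, evaluation of trees -/

namespace PreOperad

/-- Morphisms of operads. -/
structure Hom (P Q : PreOperad) where
  app : ∀ n : ℕ, P.Op n → Q.Op n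
  map_one : app 1 P.one = Q.one
  map_circ : ∀ {m n k : ℕ} (h : k + 1 = m + n) (i : ℕ) (hi : 1 ≤ i ∧ i ≤ m)
    (a : P.Op m) (b : P.Op n), app k (P.circ h i hi a b) = Q.circ h i hi (app m a) (app n b)

/-- Each axiom is an equality of two composites; a morphism carries it to the same axiom in the
target, and injectivity brings it back. -/
theorem Hom.isOperad {P Q : PreOperad} (f : Hom P Q) (hf : ∀ n, Function.Injective (f.app n))
    (hQ : Q.IsOperad) : P.IsOperad where
  one_circ h hi a := hf _ <| by rw [f.map_circ, f.map_one, hQ.one_circ]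
  circ_one h i hi a := hf _ <| by rw [f.map_circ, f.map_one, hQ.circ_one]
  assoc_seq h₁ h₂ h₃ h₄ i j hi hj hij a b c := hf _ <| by
    simp only [f.map_circ]
    exact hQ.assoc_seq h₁ h₂ h₃ h₄ i j hi hj hij _ _ _
  assoc_par h₁ h₂ h₃ h₄ i j hi hj hl hj' hi' a b c := hf _ <| by
    simp only [f.map_circ]
    exact hQ.assoc_par h₁ h₂ h₃ h₄ i j hi hj hl hj' hi' _ _ _

/-- Two injective morphisms with the same image have isomorphic sources. -/
theorem Hom.exists_iso {P Q H : PreOperad} (f : Hom P H) (g : Hom Q H)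
    (hf : ∀ n, Function.Injective (f.app n)) (hg : ∀ n, Function.Injective (g.app n))
    (hfg : ∀ n a, ∃ b, g.app n b = f.app n a) (hgf : ∀ n b, ∃ a, f.app n a = g.app n b) :
    ∃ e : Iso P Q, ∀ n a, g.app n (e.equiv n a) = f.app n a := by
  choose u hu using hfg
  choose v hv using hgf
  refine ⟨⟨fun n => ⟨u n, v n, fun a => hf n ?_, fun b => hg n ?_⟩, hg 1 ?_, ?_⟩, hu⟩
  · rw [hv, hu]
  · rw [hu, hv]
  · change g.app 1 (u 1 P.one) = _
    rw [hu, f.map_one, g.map_one]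
  · intro m n k h i hi a b
    refine hg k ?_
    change g.app k (u k _) = g.app k (Q.circ h i hi (u m a) (u n b))
    rw [hu, f.map_circ, g.map_circ, hu, hu]

theorem IsOperad.hadamard {P Q : PreOperad} (hP : P.IsOperad) (hQ : Q.IsOperad) :
    (hadamard P Q).IsOperad where
  one_circ h hi a := Prod.ext (hP.one_circ h hi a.1) (hQ.one_circ h hi a.2)
  circ_one h i hi a := Prod.ext (hP.circ_one h i hi a.1) (hQ.circ_one h i hi a.2)
  assoc_seq h₁ h₂ h₃ h₄ i j hi hj hij a b c :=
    Prod.ext (hP.assoc_seq h₁ h₂ h₃ h₄ i j hi hj hij a.1 b.1 c.1)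
      (hQ.assoc_seq h₁ h₂ h₃ h₄ i j hi hj hij a.2 b.2 c.2)
  assoc_par h₁ h₂ h₃ h₄ i j hi hj hl hj' hi' a b c :=
    Prod.ext (hP.assoc_par h₁ h₂ h₃ h₄ i j hi hj hl hj' hi' a.1 b.1 c.1)
      (hQ.assoc_par h₁ h₂ h₃ h₄ i j hi hj hl hj' hi' a.2 b.2 c.2)

/-- The inclusion of a generated sub-operad. -/
def generatedByHom (P : PreOperad) (S : ∀ n : ℕ, Set (P.Op n)) : Hom (P.generatedBy S) P where
  app _ a := a.1
  map_one := rfl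
  map_circ _ _ _ _ _ := rfl

/-- The value of a planar binary tree in an operad, given the values of the generators. -/
def eval (P : PreOperad) {G : Type} (gen : G → P.Op 2) : ∀ t : BTree G, P.Op t.leaves
  | .leaf => P.one
  | .node g l r =>
      -- The right input is filled first, so that the left one keeps the index `1`.
      P.circ (m := r.leaves + 1) (by simp only [BTree.leaves]; omega) 1 (by omega)
        (P.circ (by omega) 2 (by omega) (gen g) (eval P gen r)) (eval P gen l)

/-- The value of a tree with `n` leaves. -/
def evalAt (P : PreOperad) {G : Type} (gen : G → P.Op 2) (n : ℕ) (a : (freeBinary G).Op n) :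
    P.Op n :=
  a.2 ▸ eval P gen a.1

/-- Arities are variables and their proofs are arbitrary, which allows rewriting by it without
casts. -/
theorem evalAt_node (P : PreOperad) {G : Type} (gen : G → P.Op 2) {n m p : ℕ} (g : G)
    (l r : BTree G) (h : (BTree.node g l r).leaves = n) (hl : l.leaves = m) (hr : r.leaves = p)
    (h₁ : n + 1 = (p + 1) + m) (h₂ : p + 1 + 1 = 2 + p) (h₃ : 1 ≤ 1 ∧ 1 ≤ p + 1)
    (h₄ : 1 ≤ 2 ∧ 2 ≤ 2) :
    evalAt P gen n ⟨.node g l r, h⟩ = P.circ h₁ 1 h₃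
      (P.circ h₂ 2 h₄ (gen g) (evalAt P gen p ⟨r, hr⟩)) (evalAt P gen m ⟨l, hl⟩) := by
  subst h hl hr
  rfl

theorem evalAt_congr (P : PreOperad) {G : Type} (gen : G → P.Op 2) {n : ℕ} {t t' : BTree G}
    (e : t = t') (h : t.leaves = n) :
    evalAt P gen n ⟨t, h⟩ = evalAt P gen n ⟨t', e ▸ h⟩ := by
  subst e
  rfl

/-- Grafting into the left subtree is the sequential axiom at input `1`. Grafting into the right
subtree is the sequential axiom at input `2`, followed by the parallel axiom, because the left
subtree has already been inserted. -/
theorem IsOperad.evalAt_graftAt {P : PreOperad} (hP : P.IsOperad) {G : Type} (gen : G → P.Op 2)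
    (t b : BTree G) : ∀ {m n k : ℕ} (h : k + 1 = m + n) (i : ℕ) (hi : 1 ≤ i ∧ i ≤ m)
    (ht : t.leaves = m) (hb : b.leaves = n) (hk : (t.graftAt i b).leaves = k),
    evalAt P gen k ⟨t.graftAt i b, hk⟩ =
      P.circ h i hi (evalAt P gen m ⟨t, ht⟩) (evalAt P gen n ⟨b, hb⟩) := by
  induction t with
  | leaf =>
    intro m n k h i hi ht hb hk
    simp only [BTree.leaves] at ht
    subst ht
    obtain rfl : i = 1 := by omega
    obtain rfl : k = n := by omega
    exact (hP.one_circ h hi _).symm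
  | node g l r ihl ihr =>
    intro m n k h i hi ht hb hk
    have ht' := ht
    have hk' := hk
    simp only [BTree.leaves] at ht'
    have hbp := b.leaves_pos
    have hlp := l.leaves_pos
    have hrp := r.leaves_pos
    have hg := BTree.leaves_graftAt _ i b (ht.symm ▸ hi)
    by_cases hil : i ≤ l.leaves
    · have e : (BTree.node g l r).graftAt i b = .node g (l.graftAt i b) r := by
        simp only [BTree.graftAt, if_pos hil]
      have hgl := BTree.leaves_graftAt l i b ⟨hi.1, hil⟩
      rw [evalAt_congr P gen e, evalAt_node P gen g (l.graftAt i b) r _ rfl rfl (by omega)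
        (by omega) (by omega) (by omega), ihl hgl i ⟨hi.1, hil⟩ rfl rfl rfl,
        evalAt_node P gen g l r ht rfl rfl (by omega)
        (by omega) (by omega) (by omega)]
      subst hb
      have := hP.assoc_seq (r := m) (k := k) (s := (l.graftAt i b).leaves) (m := r.leaves + 1)
        (n := l.leaves) (p := b.leaves) (by omega) (by omega) hgl (by omega) 1 i (by omega)
        ⟨hi.1, hil⟩ (by omega)
        (P.circ (by omega) 2 (by omega) (gen g) (evalAt P gen r.leaves ⟨r, rfl⟩))
        (evalAt P gen l.leaves ⟨l, rfl⟩) (evalAt P gen b.leaves ⟨b, rfl⟩)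
      rw [← this]
      simp only [Nat.add_sub_cancel_left]
    · have e : (BTree.node g l r).graftAt i b = .node g l (r.graftAt (i - l.leaves) b) := by
        simp only [BTree.graftAt, if_neg hil]
      have hir : 1 ≤ i - l.leaves ∧ i - l.leaves ≤ r.leaves := by omega
      have hgr := BTree.leaves_graftAt r (i - l.leaves) b hir
      rw [evalAt_congr P gen e, evalAt_node P gen g l _ _ rfl rfl (by omega)
        (by omega) (by omega) (by omega), ihr hgr _ hir rfl rfl rfl,
        evalAt_node P gen g l r ht rfl rfl (by omega)
        (by omega) (by omega) (by omega)]
      subst hb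
      have h1 := hP.assoc_seq (r := r.leaves + 1) (k := (r.graftAt (i - l.leaves) b).leaves + 1)
        (s := (r.graftAt (i - l.leaves) b).leaves) (m := 2)
        (n := r.leaves) (p := b.leaves) (by omega) (by omega) hgr (by omega) 2 (i - l.leaves)
        (by omega) hir (by omega) (gen g) (evalAt P gen r.leaves ⟨r, rfl⟩)
        (evalAt P gen b.leaves ⟨b, rfl⟩)
      have h2 := hP.assoc_par (r := m) (k := k) (s := (r.graftAt (i - l.leaves) b).leaves + 1)
        (m := r.leaves + 1) (n := l.leaves) (p := b.leaves) (by omega) (by omega) (by omega)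
        (by omega) 1 (2 + (i - l.leaves) - 1) (by omega) (by omega) (by omega) (by omega)
        (by omega)
        (P.circ (by omega) 2 (by omega) (gen g) (evalAt P gen r.leaves ⟨r, rfl⟩))
        (evalAt P gen l.leaves ⟨l, rfl⟩) (evalAt P gen b.leaves ⟨b, rfl⟩)
      rw [← h1, ← h2]
      -- The two axioms produce the index `2 + (i - l.leaves) - 1 + l.leaves - 1`, which is `i`.
      congr 1
      omega

/-- The evaluation of trees, as a morphism. -/
def IsOperad.evalHom {P : PreOperad} (hP : P.IsOperad) {G : Type} (gen : G → P.Op 2) :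
    Hom (freeBinary G) P where
  app := evalAt P gen
  map_one := rfl
  map_circ h i hi a b := hP.evalAt_graftAt gen a.1 b.1 h i hi a.2 b.2 _

theorem IsOperad.evalAt_freeGen {P : PreOperad} (hP : P.IsOperad) {G : Type} (gen : G → P.Op 2)
    (g : G) : evalAt P gen 2 (freeGen g) = gen g := by
  refine (evalAt_node P gen g .leaf .leaf (n := 2) (m := 1) (p := 1) rfl rfl rfl rfl rfl
    (by omega) (by omega)).trans ?_
  exact (hP.circ_one (m := 2) rfl 1 (by omega) _).trans (hP.circ_one (m := 2) rfl 2 (by omega) _)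

/-- The values of trees contain the unit and the generators and are closed under composition by
`evalHom`. With `generated_evalAt`, the generated sub-operad is the image of the evaluation. -/
theorem Generated.exists_evalAt {P : PreOperad} (hP : P.IsOperad) {G : Type} (gen : G → P.Op 2)
    {S : ∀ n : ℕ, Set (P.Op n)} (hS : ∀ n a, a ∈ S n → ∃ t, evalAt P gen n t = a)
    {n : ℕ} {a : P.Op n} (h : Generated P S n a) : ∃ t, evalAt P gen n t = a := by
  induction h with
  | one => exact ⟨(freeBinary G).one, rfl⟩
  | of a ha => exact hS _ a ha
  | circ h i hi a b _ _ iha ihb =>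
    obtain ⟨t, rfl⟩ := iha
    obtain ⟨u, rfl⟩ := ihb
    exact ⟨(freeBinary G).circ h i hi t u, (hP.evalHom gen).map_circ h i hi t u⟩

theorem generated_evalAt {P : PreOperad} {G : Type} (gen : G → P.Op 2)
    {S : ∀ n : ℕ, Set (P.Op n)} (hS : ∀ g, gen g ∈ S 2) {n : ℕ} (t : (freeBinary G).Op n) :
    Generated P S n (evalAt P gen n t) := by
  obtain ⟨t, ht⟩ := t
  subst ht
  induction t with
  | leaf => exact .one
  | node g l r hl hr => exact .circ _ _ _ _ _ (.circ _ _ _ _ _ (.of _ (hS g)) hr) hl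

end PreOperad

/-! ### The operads of monomials and of fractions satisfy the axioms -/

/-- The inverse of `blowUp`: the index whose blow-up contains `l`. -/
def blowDown (i n l : ℕ) : ℕ := if l < i then l else if l ≤ i + n - 1 then i else l + 1 - n

/-- Blow-ups of distinct indices are disjoint and cover everything. Identities between iterated
blow-ups thus become identities between the functions `blowDown`, which are linear arithmetic. -/
theorem mem_blowUp_iff {i n j l : ℕ} (hn : 1 ≤ n) : l ∈ blowUp i n j ↔ j = blowDown i n l := by
  rw [mem_blowUp, blowDown]
  split_ifs <;> omega

theorem mem_biUnion_blowUp {i n l : ℕ} (hn : 1 ≤ n) (S : Finset ℕ) :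
    l ∈ S.biUnion (blowUp i n) ↔ blowDown i n l ∈ S := by
  simp [mem_blowUp_iff hn]

theorem bind_blowUp_val {i n : ℕ} (hn : 1 ≤ n) (S : Finset ℕ) :
    S.val.bind (fun j => (blowUp i n j).val) = (S.biUnion (blowUp i n)).val := by
  have hd : (S : Set ℕ).PairwiseDisjoint (blowUp i n) := by
    intro a _ b _ hab
    rw [Function.onFun, Finset.disjoint_left]
    intro l hl hl'
    rw [mem_blowUp_iff hn] at hl hl'
    exact hab (hl.trans hl'.symm)
  rw [← Finset.disjiUnion_eq_biUnion _ _ hd]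
  rfl

/-- The sequential axiom at the level of indices; `blowUp_comm` is the parallel one. -/
theorem blowUp_blowUp {i j n p s : ℕ} (hi : 1 ≤ i) (hj : 1 ≤ j ∧ j ≤ n) (hp : 1 ≤ p)
    (hs : s + 1 = n + p) (l : ℕ) :
    (blowUp i n l).biUnion (blowUp (i + j - 1) p) = blowUp i s l := by
  ext y
  rw [mem_biUnion_blowUp hp, mem_blowUp_iff (by omega), mem_blowUp_iff (by omega)]
  simp only [blowDown]
  split_ifs <;> omega

theorem blowUp_comm {i j n p : ℕ} (hi : 1 ≤ i) (hij : i < j) (hn : 1 ≤ n) (hp : 1 ≤ p) (l : ℕ) :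
    (blowUp i n l).biUnion (blowUp (j + n - 1) p) = (blowUp j p l).biUnion (blowUp i n) := by
  ext y
  rw [mem_biUnion_blowUp hp, mem_biUnion_blowUp hn, mem_blowUp_iff hn, mem_blowUp_iff hp]
  simp only [blowDown]
  split_ifs <;> omega

theorem blowUp_shift {i j p : ℕ} (hi : 1 ≤ i) (hj : 1 ≤ j) (l : ℕ) :
    blowUp (i + j - 1) p (l + (i - 1)) = (blowUp j p l).image (fun a => a + (i - 1)) := by
  ext y
  simp only [Finset.mem_image, mem_blowUp]
  constructor
  · intro h
    exact ⟨y - (i - 1), by omega, by omega⟩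
  · rintro ⟨z, hz, rfl⟩
    omega

theorem blowUp_shift_lt {i j n p l : ℕ} (hi : 1 ≤ i) (hij : i < j) (hl : l ≤ n) :
    blowUp (j + n - 1) p (l + (i - 1)) = {l + (i - 1)} := by
  unfold blowUp
  rw [if_pos (by omega)]

theorem blowUp_shift_gt {i j n l : ℕ} (hi : 1 ≤ i) (hij : i < j) (hl : 1 ≤ l) :
    blowUp i n (l + (j - 1)) = {l + (j + n - 1 - 1)} := by
  unfold blowUp
  rw [if_neg (by omega), if_neg (by omega)]
  congr 1
  omega

theorem blowUp_one (i l : ℕ) : blowUp i 1 l = {l} := by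
  ext y
  simp only [mem_blowUp, Finset.mem_singleton]
  omega

theorem biUnion_blowUp_Icc_eq {i j n p s : ℕ} (hi : 1 ≤ i) (hj : 1 ≤ j ∧ j ≤ n) (hp : 1 ≤ p)
    (hs : s + 1 = n + p) :
    (Finset.Icc i (i + n - 1)).biUnion (blowUp (i + j - 1) p) = Finset.Icc i (i + s - 1) := by
  have h := blowUp_blowUp hi hj hp hs i
  simpa [blowUp] using h

theorem image_shift_Icc (i a b : ℕ) :
    (Finset.Icc a b).image (fun l => l + (i - 1)) = Finset.Icc (a + (i - 1)) (b + (i - 1)) := by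
  simp

theorem image_shift_val (i : ℕ) (S : Finset ℕ) :
    (S.image (fun l => l + (i - 1))).val = S.val.map (fun l => l + (i - 1)) :=
  Finset.image_val_of_injOn fun a _ b _ (h : a + (i - 1) = b + (i - 1)) => by omega

/-- Both sides of an associativity axiom have one factor from each of `a`, `b`, `c`, and the factors
agree separately. -/
theorem Mon_isOperad : Mon.IsOperad where
  one_circ _ _ a := Subtype.ext (by simp [Mon])
  circ_one h i hi a := Subtype.ext (by
    simp only [Mon, blowUp_one, Multiset.map_zero, add_zero]
    exact (Multiset.bind_singleton a.1 id).trans (Multiset.map_id _))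
  assoc_seq {m n p r s k} h₁ h₂ h₃ h₄ i j hi hj hij a b c := Subtype.ext (by
    have hp := Mon.arity_pos c
    simp only [Mon, Multiset.add_bind, Multiset.bind_assoc, Multiset.bind_map, Multiset.map_add,
      Multiset.map_bind, Multiset.map_map]
    rw [add_assoc]
    congr 1
    · refine Multiset.bind_congr fun l _ => ?_
      rw [bind_blowUp_val hp, blowUp_blowUp hi.1 hj hp h₃]
    · congr 1
      · refine Multiset.bind_congr fun l _ => ?_
        rw [blowUp_shift hi.1 hj.1, image_shift_val]
      · refine Multiset.map_congr rfl fun l _ => ?_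
        simp only [Function.comp]
        omega)
  assoc_par {m n p r s k} h₁ h₂ h₃ h₄ i j hi hj hl hj' hi' a b c := Subtype.ext (by
    have hp := Mon.arity_pos c
    have hn := Mon.arity_pos b
    simp only [Mon, Multiset.add_bind, Multiset.bind_assoc, Multiset.bind_map]
    rw [add_assoc, add_assoc]
    congr 1
    · refine Multiset.bind_congr fun l _ => ?_
      rw [bind_blowUp_val hp, bind_blowUp_val hn, blowUp_comm hi.1 hl hn hp]
    · rw [add_comm]
      congr 1
      · rw [← Multiset.bind_singleton]
        refine Multiset.bind_congr fun l h => ?_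
        rw [blowUp_shift_gt hi.1 hl (c.2.2 l h).1]
        rfl
      · rw [← Multiset.bind_singleton]
        refine Multiset.bind_congr fun l h => ?_
        rw [blowUp_shift_lt hi.1 hl (b.2.2 l h).2]
        rfl)

theorem mapDomain_id_of {f : Finset ℕ → Finset ℕ} (hf : ∀ S, f S = S) (v : Finset ℕ →₀ ℤ) :
    Finsupp.mapDomain f v = v := by
  rw [show f = id from funext hf, Finsupp.mapDomain_id]

/-- Besides the factors from `a`, `b`, `c`, the two symbols introduced by the two compositions have
to match: in the sequential case the inner interval is blown up or shifted into the right one, and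
in the parallel case one interval stays fixed and the other is translated. -/
theorem FF_isOperad : FF.IsOperad where
  one_circ {n} h hi a := Subtype.ext (by
    simp only [FF]
    rw [← Finsupp.single_neg, Finsupp.mapDomain_single, mapDomain_id_of (by simp)]
    simp [blowUp])
  circ_one {m} h i hi a := Subtype.ext (by
    simp only [FF]
    rw [← Finsupp.single_neg, Finsupp.mapDomain_single,
      mapDomain_id_of (f := fun S : Finset ℕ => S.biUnion (blowUp i 1)) (fun S => by
        rw [show blowUp i 1 = singleton from funext (blowUp_one i), Finset.biUnion_singleton_eq_self]),
      Finset.image_singleton,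
      show 1 + (i - 1) = i by omega, Nat.add_sub_cancel, Finset.Icc_self, Finsupp.single_neg]
    abel)
  assoc_seq {m n p r s k} h₁ h₂ h₃ h₄ i j hi hj hij a b c := Subtype.ext (by
    have hp := FF.arity_pos c
    simp only [FF, Finsupp.mapDomain_add, ← Finsupp.mapDomain_comp, Finsupp.mapDomain_single]
    have e1 : (fun S : Finset ℕ => S.biUnion (blowUp (i + j - 1) p)) ∘
        (fun S : Finset ℕ => S.biUnion (blowUp i n)) = fun S : Finset ℕ => S.biUnion (blowUp i s) := by
      funext S
      simp only [Function.comp, Finset.biUnion_biUnion, blowUp_blowUp hi.1 hj hp h₃]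
    have e2 : (fun S : Finset ℕ => S.biUnion (blowUp (i + j - 1) p)) ∘
        (fun S : Finset ℕ => S.image fun l => l + (i - 1)) =
        (fun S => S.image fun l => l + (i - 1)) ∘ fun S : Finset ℕ => S.biUnion (blowUp j p) := by
      funext S
      simp only [Function.comp, Finset.image_biUnion, Finset.biUnion_image, blowUp_shift hi.1 hj.1]
    have e3 : (fun S : Finset ℕ => S.image fun l => l + (i - 1)) ∘
        (fun S : Finset ℕ => S.image fun l => l + (j - 1)) = fun S : Finset ℕ => S.image fun l => l + (i + j - 1 - 1) := by
      funext S
      simp only [Function.comp, Finset.image_image]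
      congr 1
      funext l
      simp only [Function.comp]
      omega
    rw [e1, e2, e3, biUnion_blowUp_Icc_eq hi.1 hj hp h₃, image_shift_Icc,
      show j + (i - 1) = i + j - 1 by omega,
      show j + p - 1 + (i - 1) = i + j - 1 + p - 1 by omega]
    abel)
  assoc_par {m n p r s k} h₁ h₂ h₃ h₄ i j hi hj hl hj' hi' a b c := Subtype.ext (by
    have hp := FF.arity_pos c
    have hn := FF.arity_pos b
    simp only [FF, Finsupp.mapDomain_add, ← Finsupp.mapDomain_comp, Finsupp.mapDomain_single]
    have e1 : (fun S : Finset ℕ => S.biUnion (blowUp (j + n - 1) p)) ∘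
        (fun S : Finset ℕ => S.biUnion (blowUp i n)) = (fun S : Finset ℕ => S.biUnion (blowUp i n)) ∘
        (fun S : Finset ℕ => S.biUnion (blowUp j p)) := by
      funext S
      simp only [Function.comp, Finset.biUnion_biUnion, blowUp_comm hi.1 hl hn hp]
    have e2 : Finsupp.mapDomain ((fun S : Finset ℕ => S.biUnion (blowUp (j + n - 1) p)) ∘
        (fun S : Finset ℕ => S.image fun l => l + (i - 1))) b.1 =
        Finsupp.mapDomain (fun S : Finset ℕ => S.image fun l => l + (i - 1)) b.1 := by
      refine Finsupp.mapDomain_congr fun S hS => ?_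
      simp only [Function.comp]
      rw [Finset.image_biUnion, ← Finset.biUnion_singleton]
      refine Finset.biUnion_congr rfl fun l h => ?_
      rw [blowUp_shift_lt hi.1 hl (Finset.mem_Icc.1 ((b.2.2 S hS).2 h)).2]
    have e3 : Finsupp.mapDomain ((fun S : Finset ℕ => S.biUnion (blowUp i n)) ∘
        (fun S : Finset ℕ => S.image fun l => l + (j - 1))) c.1 =
        Finsupp.mapDomain (fun S : Finset ℕ => S.image fun l => l + (j + n - 1 - 1)) c.1 := by
      refine Finsupp.mapDomain_congr fun S hS => ?_
      simp only [Function.comp]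
      rw [Finset.image_biUnion, ← Finset.biUnion_singleton]
      refine Finset.biUnion_congr rfl fun l h => ?_
      rw [blowUp_shift_gt hi.1 hl (Finset.mem_Icc.1 ((c.2.2 S hS).2 h)).1]
    have e4 : (Finset.Icc i (i + n - 1)).biUnion (blowUp (j + n - 1) p) =
        Finset.Icc i (i + n - 1) := by
      ext y
      rw [mem_biUnion_blowUp hp]
      simp only [Finset.mem_Icc, blowDown]
      split_ifs <;> omega
    have e5 : (Finset.Icc j (j + p - 1)).biUnion (blowUp i n) =
        Finset.Icc (j + n - 1) (j + n - 1 + p - 1) := by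
      ext y
      rw [mem_biUnion_blowUp hn]
      simp only [Finset.mem_Icc, blowDown]
      split_ifs <;> omega
    rw [e1, e2, e3, e4, e5]
    abel)

theorem hadamard_isOperad : (PreOperad.hadamard Mon FF).IsOperad :=
  Mon_isOperad.hadamard FF_isOperad

/-! ### Planar trees -/

/-- The planar version of a dotted red and white tree on consecutive labels: a node is the word of
its labels and children, read from left to right. -/
inductive PWord
  | nil : PWord
  | lab (w : PWord) : PWord
  | sub (dot : Bool) (c w : PWord) : PWord
  deriving DecidableEq

namespace PWord

/-- The number of labels. -/
def size : PWord → ℕ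
  | nil => 0
  | lab w => size w + 1
  | sub _ c w => size c + size w

/-- There is no label and no red child. -/
def isRed : PWord → Bool
  | nil => true
  | lab _ => false
  | sub _ c w => !isRed c && isRed w

/-- There is no dotted edge to a child. -/
def noDot : PWord → Bool
  | nil => true
  | lab w => noDot w
  | sub b _ w => !b && noDot w

/-- Concatenation. -/
def append : PWord → PWord → PWord
  | nil, v => v
  | lab w, v => lab (append w v)
  | sub b c w, v => sub b c (append w v)

instance : Append PWord := ⟨append⟩

@[simp] theorem nil_append (v : PWord) : nil ++ v = v := rfl
@[simp] theorem lab_append (w v : PWord) : lab w ++ v = lab (w ++ v) := rfl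
@[simp] theorem sub_append (b : Bool) (c w v : PWord) : sub b c w ++ v = sub b c (w ++ v) := rfl

theorem append_assoc (u v w : PWord) : u ++ v ++ w = u ++ (v ++ w) := by
  induction u <;> simp_all

@[simp] theorem append_nil (u : PWord) : u ++ nil = u := by
  induction u <;> simp_all

@[simp] theorem size_append (u v : PWord) : (u ++ v).size = u.size + v.size := by
  induction u <;> simp_all [size] <;> omega

@[simp] theorem isRed_append (u v : PWord) : (u ++ v).isRed = (u.isRed && v.isRed) := by
  induction u <;> simp_all [isRed, Bool.and_assoc]

@[simp] theorem noDot_append (u v : PWord) : (u ++ v).noDot = (u.noDot && v.noDot) := by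
  induction u <;> simp_all [noDot, Bool.and_assoc]

/-- The same word with all edges to the children dotted, or all plain. -/
def setDot (b : Bool) : PWord → PWord
  | nil => nil
  | lab w => lab (setDot b w)
  | sub _ c w => sub b c (setDot b w)

@[simp] theorem size_setDot (b : Bool) (w : PWord) : (setDot b w).size = w.size := by
  induction w <;> simp_all [size, setDot]

@[simp] theorem isRed_setDot (b : Bool) (w : PWord) : (setDot b w).isRed = w.isRed := by
  induction w <;> simp_all [isRed, setDot]

@[simp] theorem setDot_setDot (b b' : Bool) (w : PWord) : setDot b (setDot b' w) = setDot b w := by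
  induction w <;> simp_all [setDot]

theorem noDot_setDot (w : PWord) : (setDot false w).noDot = true := by
  induction w <;> simp_all [noDot, setDot]

theorem setDot_of_noDot {w : PWord} (h : w.noDot = true) : setDot false w = w := by
  induction w <;> simp_all [noDot, setDot]

theorem setDot_eq_nil {b : Bool} {w : PWord} : setDot b w = nil ↔ w = nil := by
  cases w <;> simp [setDot]

theorem append_eq_nil {u v : PWord} : u ++ v = nil ↔ u = nil ∧ v = nil := by
  cases u <;> simp

/-- A white tree is its own word; a red tree gives the word of a single child. -/
def asWord (w : PWord) : PWord := if w.isRed then sub false w nil else w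

/-- A white tree gives a single child, a red tree its children. -/
def flat (b : Bool) (w : PWord) : PWord := if w.isRed then setDot b w else sub b w nil

@[simp] theorem size_asWord (w : PWord) : (asWord w).size = w.size := by
  unfold asWord; split_ifs <;> simp [size]

@[simp] theorem size_flat (b : Bool) (w : PWord) : (flat b w).size = w.size := by
  unfold flat; split_ifs <;> simp [size]

@[simp] theorem isRed_asWord (w : PWord) : (asWord w).isRed = false := by
  unfold asWord; split_ifs <;> simp_all [isRed]

@[simp] theorem isRed_flat (b : Bool) (w : PWord) : (flat b w).isRed = true := by
  unfold flat; split_ifs <;> simp_all [isRed]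

theorem setDot_flat (b b' : Bool) (w : PWord) : setDot b (flat b' w) = flat b w := by
  unfold flat; split_ifs <;> simp [setDot]

theorem noDot_flat (w : PWord) : (flat false w).noDot = true := by
  rw [← setDot_flat false false]; exact noDot_setDot _

theorem asWord_of_not_red {w : PWord} (h : w.isRed = false) : asWord w = w := by
  simp [asWord, h]

theorem ne_nil_of_not_red {w : PWord} (h : w.isRed = false) : w ≠ nil := by
  rintro rfl; simp [isRed] at h

theorem flat_ne_nil {b : Bool} {w : PWord} (h : w ≠ nil) : flat b w ≠ nil := by
  unfold flat; split_ifs <;> simp [setDot_eq_nil, h]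

/-- The condition on the items of a node that makes it a node: it is not empty, it is not a single
child, and edges from a red node are plain. -/
structure Shape (w : PWord) : Prop where
  ne_nil : w ≠ nil
  ne_single : ∀ b c, w ≠ sub b c nil
  noDot : w.isRed = true → w.noDot = true

/-- All children are trees, and all dotted children are white. -/
def Ok : PWord → Prop
  | nil => True
  | lab w => Ok w
  | sub b c w => (Ok c ∧ Shape c ∧ (b = true → c.isRed = false)) ∧ Ok w

/-- Planar dotted red and white trees. -/
def IsTree (w : PWord) : Prop := Ok w ∧ Shape w

@[simp] theorem ok_append {u v : PWord} : Ok (u ++ v) ↔ Ok u ∧ Ok v := by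
  induction u <;> simp_all [Ok, and_assoc]

theorem Ok.asWord {w : PWord} (h : IsTree w) : Ok (asWord w) := by
  unfold PWord.asWord
  split_ifs
  · exact ⟨⟨h.1, h.2, by simp⟩, trivial⟩
  · exact h.1

/-- The children of a red word are all white, so their edges may be dotted. -/
theorem Ok.setDot {w : PWord} (h : Ok w) (hr : w.isRed = true) (b : Bool) :
    Ok (setDot b w) := by
  induction w with
  | nil => trivial
  | lab w ih => simp [isRed] at hr
  | sub b' c w _ ih =>
    simp only [isRed, Bool.and_eq_true, Bool.not_eq_true'] at hr
    exact ⟨⟨h.1.1, h.1.2.1, fun _ => hr.1⟩, ih h.2 hr.2⟩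

theorem Ok.flat {w : PWord} (h : IsTree w) (b : Bool) : Ok (flat b w) := by
  unfold PWord.flat
  split_ifs with hr
  · exact h.1.setDot hr b
  · exact ⟨⟨h.1, h.2, fun _ => by simpa using hr⟩, trivial⟩

theorem asWord_ne_nil (w : PWord) : asWord w ≠ nil := ne_nil_of_not_red (isRed_asWord w)

/-- Two non-empty words make at least two letters, so only the condition on dotted edges is left to
check. -/
theorem isTree_append {u v : PWord} (hu : Ok u) (hv : Ok v) (hu' : u ≠ nil) (hv' : v ≠ nil)
    (h : (u ++ v).isRed = true → (u ++ v).noDot = true) : IsTree (u ++ v) := by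
  refine ⟨ok_append.2 ⟨hu, hv⟩, fun h => hu' (append_eq_nil.1 h).1, fun b c h => ?_, h⟩
  cases u with
  | nil => exact hu' rfl
  | lab w => simp at h
  | sub b' c' w =>
    simp only [sub_append, sub.injEq] at h
    exact hv' (append_eq_nil.1 h.2.2).2

/-- The six operations on planar trees. -/
def op : Gen6 → PWord → PWord → PWord
  | .prec, u, v => asWord u ++ flat false v
  | .succ, u, v => flat false u ++ asWord v
  | .mid, u, v => asWord u ++ asWord v
  | .odot, u, v => flat false u ++ flat false v
  | .ll, u, v => asWord u ++ flat true v
  | .gg, u, v => flat true u ++ asWord v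

@[simp] theorem size_op (g : Gen6) (u v : PWord) : (op g u v).size = u.size + v.size := by
  cases g <;> simp [op]

/-- Except for `⊙`, one factor is an `asWord`, so the result is white and its edges are not
constrained. For `⊙` both factors have plain edges. -/
theorem IsTree.op {u v : PWord} (hu : IsTree u) (hv : IsTree v) (g : Gen6) :
    IsTree (op g u v) := by
  cases g <;> refine isTree_append ?_ ?_ ?_ ?_ ?_ <;>
    first
    | exact Ok.asWord ‹_›
    | exact Ok.flat ‹_› _
    | exact asWord_ne_nil _
    | exact flat_ne_nil hu.2.ne_nil
    | exact flat_ne_nil hv.2.ne_nil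
    | simp [noDot_flat]

/-- The planar tree of a binary tree. -/
def ofBTree : BTree Gen6 → PWord
  | .leaf => lab nil
  | .node g l r => op g (ofBTree l) (ofBTree r)

theorem isTree_ofBTree (t : BTree Gen6) : IsTree (ofBTree t) := by
  induction t with
  | leaf => exact ⟨trivial, by simp [ofBTree], by simp [ofBTree], by simp [ofBTree, isRed]⟩
  | node g l r hl hr => exact hl.op hr g

theorem size_ofBTree (t : BTree Gen6) : (ofBTree t).size = t.leaves := by
  induction t with
  | leaf => rfl
  | node g l r hl hr => simp [ofBTree, hl, hr, BTree.leaves]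

end PWord

/-! ### From planar trees to the presented operad -/

/-- `≻` or `≫`. -/
def opL (b : Bool) : Gen6 := if b then .gg else .succ

/-- `≺` or `≪`. -/
def opR (b : Bool) : Gen6 := if b then .ll else .prec

namespace PWord

-- The normal form. White children at the beginning of a word are peeled off on the left, by `≻`,
-- `≫`, or by `⊙` if only white children follow. The first label or red child starts an accumulator,
-- to which `act` attaches all later letters on the right, by `∘`, `≺`, `≪`.
open BTree in
mutual
/-- A binary tree with a given planar tree. -/
def toBTree : PWord → BTree Gen6
  | nil => leaf
  | lab w => act leaf w
  | sub b c w =>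
      if c.isRed then act (toBTree c) w
      else if w.isRed then
        if w = nil then toBTree c else node .odot (toBTree c) (toBTree w)
      else node (opL b) (toBTree c) (toBTree w)
/-- The binary tree for a planar tree followed by further items. -/
def act (x : BTree Gen6) : PWord → BTree Gen6
  | nil => x
  | lab w => act (node .mid x leaf) w
  | sub b c w =>
      if c.isRed then act (node .mid x (toBTree c)) w
      else act (node (opR b) x (toBTree c)) w
end

theorem op_opL (b : Bool) (u v : PWord) : op (opL b) u v = flat b u ++ asWord v := by
  cases b <;> rfl

theorem op_opR (b : Bool) (u v : PWord) : op (opR b) u v = asWord u ++ flat b v := by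
  cases b <;> rfl

/-- The induction runs over words, since the tail of a tree may be a single child. The normal form
of such a tail is that of the child itself, and `asWord` or `flat` restores the edge. The last
clause says that `act` writes further letters behind the accumulator. -/
theorem ofBTree_toBTree_aux (w : PWord) (hw : Ok w) :
    ((w.isRed = false → asWord (ofBTree (toBTree w)) = w) ∧
    (w.isRed = true → w.noDot = true → w ≠ nil → flat false (ofBTree (toBTree w)) = w)) ∧
    ∀ x, asWord (ofBTree (act x w)) = asWord (ofBTree x) ++ w := by
  induction w with
  | nil => simp [isRed, act]
  | lab w ih =>
    obtain ⟨-, h3⟩ := ih hw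
    refine ⟨⟨fun _ => ?_, by simp [isRed]⟩, fun x => ?_⟩
    · rw [toBTree, h3]
      rfl
    · rw [act, h3, ofBTree, op, asWord_of_not_red (by simp), append_assoc]
      rfl
  | sub b c w ihc ihw =>
    obtain ⟨⟨hc, hs, hb⟩, hw⟩ := hw
    have hcc : ofBTree (toBTree c) = c := by
      obtain ⟨⟨h1, h2⟩, -⟩ := ihc hc
      cases hr : c.isRed with
      | false =>
        have := h1 hr
        -- If the tree obtained had the wrong colour, `c` would be a single child, which its shape
        -- forbids. The same argument serves for `flat` in the red case.
        unfold asWord at this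
        split_ifs at this
        · exact absurd this.symm (hs.ne_single _ _)
        · exact this
      | true =>
        have := h2 hr (hs.noDot hr) hs.ne_nil
        unfold flat at this
        split_ifs at this with h
        · rwa [setDot_of_noDot ((isTree_ofBTree _).2.noDot h)] at this
        · exact absurd this.symm (hs.ne_single _ _)
    obtain ⟨⟨h1, h2⟩, h3⟩ := ihw hw
    refine ⟨⟨fun h => ?_, fun h hd hn => ?_⟩, fun x => ?_⟩
    · cases hr : c.isRed with
      | true =>
        -- A dotted child is white, so the edge to a red child is plain.
        have hb' : b = false := by
          cases b
          · rfl
          · simp [hr] at hb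
        rw [toBTree, if_pos hr, h3, hcc, asWord, if_pos hr, hb']
        rfl
      | false =>
        have hwr : w.isRed = false := by simpa [isRed, hr] using h
        rw [toBTree, if_neg (by simp [hr]), if_neg (by simp [hwr]), ofBTree, op_opL,
          asWord_of_not_red (by simp), hcc, h1 hwr, flat, if_neg (by simp [hr])]
        rfl
    · simp only [isRed, Bool.and_eq_true, Bool.not_eq_true'] at h
      simp only [noDot, Bool.and_eq_true, Bool.not_eq_true'] at hd
      rw [toBTree, if_neg (by simp [h]), if_pos h.2]
      split_ifs with hwn
      · rw [hcc, flat, if_neg (by simp [h]), hwn, hd.1]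
      · rw [ofBTree, op, h2 h.2 hd.2 hwn, hcc, flat, if_pos (by simp [h.2]), flat,
          if_neg (by simp [h]), setDot_of_noDot (by simp [noDot, hd.2]), hd.1]
        rfl
    · cases hr : c.isRed with
      | true =>
        have hb' : b = false := by
          cases b
          · rfl
          · simp [hr] at hb
        rw [act, if_pos hr, h3, ofBTree, op, asWord_of_not_red (by simp), hcc, append_assoc,
          asWord.eq_1 c, if_pos hr, hb']
        rfl
      | false =>
        rw [act, if_neg (by simp [hr]), h3, ofBTree, op_opR, asWord_of_not_red (by simp), hcc,
          append_assoc, flat, if_neg (by simp [hr])]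
        rfl

theorem asWord_ofBTree_toBTree {w : PWord} (hw : Ok w) (h : w.isRed = false) :
    asWord (ofBTree (toBTree w)) = w :=
  (ofBTree_toBTree_aux w hw).1.1 h

theorem ofBTree_toBTree {w : PWord} (hw : IsTree w) : ofBTree (toBTree w) = w := by
  cases hr : w.isRed with
  | false =>
    have := asWord_ofBTree_toBTree hw.1 hr
    unfold asWord at this
    split_ifs at this
    · exact absurd this.symm (hw.2.ne_single _ _)
    · exact this
  | true =>
    have := (ofBTree_toBTree_aux w hw.1).1.2 hr (hw.2.noDot hr) hw.2.ne_nil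
    unfold flat at this
    split_ifs at this with h
    · rwa [setDot_of_noDot ((isTree_ofBTree _).2.noDot h)] at this
    · exact absurd this.symm (hw.2.ne_single _ _)

end PWord

-- Calculus of the congruence on binary trees.

/-- Equality of binary trees in the presented operad. -/
def CongTree (t u : BTree Gen6) : Prop :=
  ∃ (n : ℕ) (h : t.leaves = n) (h' : u.leaves = n),
    PreOperad.Cong (freeBinary Gen6) Rel16 n ⟨t, h⟩ ⟨u, h'⟩

namespace CongTree

theorem refl (t : BTree Gen6) : CongTree t t := ⟨_, rfl, rfl, .refl _⟩

theorem symm {t u : BTree Gen6} : CongTree t u → CongTree u t :=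
  fun ⟨n, h, h', c⟩ => ⟨n, h', h, c.symm⟩

theorem trans {t u v : BTree Gen6} : CongTree t u → CongTree u v → CongTree t v := by
  rintro ⟨n, h, h', c⟩ ⟨m, k, k', d⟩
  obtain rfl : n = m := h'.symm.trans k
  exact ⟨n, h, k', c.trans d⟩

theorem graftAt {t t' u u' : BTree Gen6} (ht : CongTree t t') (hu : CongTree u u') (i : ℕ)
    (hi : 1 ≤ i ∧ i ≤ t.leaves) : CongTree (t.graftAt i u) (t'.graftAt i u') := by
  obtain ⟨m, rfl, h', c⟩ := ht
  obtain ⟨n, rfl, k', d⟩ := hu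
  exact ⟨_, _, _, .circ (BTree.leaves_graftAt t i u hi) i hi c d⟩

/-- A node is two graftings on a generator, the right one first so that indices do not move. -/
theorem node (g : Gen6) {l l' r r' : BTree Gen6} (hl : CongTree l l') (hr : CongTree r r') :
    CongTree (.node g l r) (.node g l' r') := by
  have h1 := graftAt (refl (.node g .leaf .leaf)) hr 2 (by simp [BTree.leaves])
  have h2 := graftAt h1 hl 1 (by
    have := r.leaves_pos
    simp [BTree.graftAt, BTree.leaves])
  simpa [BTree.graftAt, BTree.leaves] using h2

/-- The relation is imposed on trees with three leaves; arbitrary trees are grafted on these leaves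
from right to left. -/
theorem rel {a b c d : Gen6} (h : (a, b, c, d) ∈ rels16) (x y z : BTree Gen6) :
    CongTree (.node a (.node b x y) z) (.node c x (.node d y z)) := by
  have h0 : CongTree (.node a (.node b .leaf .leaf) .leaf) (.node c .leaf (.node d .leaf .leaf)) :=
    ⟨3, rfl, rfl, .of (.mk a b c d h)⟩
  have h1 := graftAt h0 (refl z) 3 (by simp [BTree.leaves])
  have h2 := graftAt h1 (refl y) 2 (by simp [BTree.leaves, BTree.graftAt])
  have h3 := graftAt h2 (refl x) 1 (by simp [BTree.leaves, BTree.graftAt]; omega)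
  simpa [BTree.graftAt, BTree.leaves] using h3

/-- From here on the sixteen relations are grouped into eight families, with a Boolean for the
choice between plain and dotted. In `opR_opL` the two choices are independent. -/
theorem odot_odot (x y z : BTree Gen6) :
    CongTree (.node .odot (.node .odot x y) z) (.node .odot x (.node .odot y z)) :=
  rel (by simp [rels16]) x y z

theorem mid_mid (x y z : BTree Gen6) :
    CongTree (.node .mid (.node .mid x y) z) (.node .mid x (.node .mid y z)) :=
  rel (by simp [rels16]) x y z

theorem mid_opR (b : Bool) (x y z : BTree Gen6) :
    CongTree (.node .mid (.node (opR b) x y) z) (.node .mid x (.node (opL b) y z)) :=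
  rel (by cases b <;> simp [rels16, opL, opR]) x y z

theorem opR_opR (b : Bool) (x y z : BTree Gen6) :
    CongTree (.node (opR b) (.node (opR b) x y) z) (.node (opR b) x (.node .odot y z)) :=
  rel (by cases b <;> simp [rels16, opR]) x y z

theorem opL_odot (b : Bool) (x y z : BTree Gen6) :
    CongTree (.node (opL b) (.node .odot x y) z) (.node (opL b) x (.node (opL b) y z)) :=
  rel (by cases b <;> simp [rels16, opL]) x y z

theorem opR_mid (b : Bool) (x y z : BTree Gen6) :
    CongTree (.node (opR b) (.node .mid x y) z) (.node .mid x (.node (opR b) y z)) :=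
  rel (by cases b <;> simp [rels16, opR]) x y z

theorem mid_opL (b : Bool) (x y z : BTree Gen6) :
    CongTree (.node .mid (.node (opL b) x y) z) (.node (opL b) x (.node .mid y z)) :=
  rel (by cases b <;> simp [rels16, opL]) x y z

theorem opR_opL (b b' : Bool) (x y z : BTree Gen6) :
    CongTree (.node (opR b) (.node (opL b') x y) z) (.node (opL b') x (.node (opR b) y z)) :=
  rel (by cases b <;> cases b' <;> simp [rels16, opL, opR]) x y z

end CongTree

-- Reduction to normal form modulo the sixteen relations.

namespace PWord

open CongTree

theorem act_append (x : BTree Gen6) (u v : PWord) : act x (u ++ v) = act (act x u) v := by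
  induction u generalizing x with
  | nil => rfl
  | lab w ih => simp [act, ih]
  | sub b c w _ ih =>
    simp only [sub_append, act]
    split_ifs <;> exact ih _

theorem act_congr {x y : BTree Gen6} (h : CongTree x y) (u : PWord) :
    CongTree (act x u) (act y u) := by
  induction u generalizing x y with
  | nil => exact h
  | lab w ih => exact ih (node _ h (refl _))
  | sub b c w _ ih =>
    simp only [act]
    split_ifs
    · exact ih (node _ h (refl _))
    · exact ih (node _ h (refl _))

/-- `act` attaches letters on the outside, whereas `toBTree` nests to the right. The relations
`mid_mid` and `opR_mid` move each attachment into the second argument; `mid_opL` and `opR_opL` do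
the same in `act_opL`. -/
theorem act_mid (x y : BTree Gen6) (u : PWord) :
    CongTree (act (.node .mid x y) u) (.node .mid x (act y u)) := by
  induction u generalizing y with
  | nil => exact refl _
  | lab w ih => exact (act_congr (mid_mid _ _ _) w).trans (ih _)
  | sub b c w _ ih =>
    simp only [act]
    split_ifs
    · exact (act_congr (mid_mid _ _ _) w).trans (ih _)
    · exact (act_congr (opR_mid _ _ _ _) w).trans (ih _)

theorem act_opL (b : Bool) (x y : BTree Gen6) (u : PWord) :
    CongTree (act (.node (opL b) x y) u) (.node (opL b) x (act y u)) := by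
  induction u generalizing y with
  | nil => exact refl _
  | lab w ih => exact (act_congr (mid_opL _ _ _ _) w).trans (ih _)
  | sub b' c w _ ih =>
    simp only [act]
    split_ifs
    · exact (act_congr (mid_opL _ _ _ _) w).trans (ih _)
    · exact (act_congr (opR_opL _ _ _ _ _) w).trans (ih _)

/-- Appending a word with a label or a red child. -/
theorem act_not_red (x : BTree Gen6) (u : PWord) (hu : u.isRed = false) :
    CongTree (act x u) (.node .mid x (toBTree u)) := by
  induction u generalizing x with
  | nil => simp [isRed] at hu
  | lab w _ => exact act_mid _ _ _
  | sub b c w _ ih =>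
    rw [act, toBTree]
    split_ifs with hc hw
    · exact act_mid _ _ _
    · simp [isRed, hc, hw] at hu
    · simp [isRed, hc, hw] at hu
    · exact (ih _ (by simpa using hw)).trans (mid_opR _ _ _ _)

/-- Appending white children through edges of the same kind. -/
theorem act_setDot (x : BTree Gen6) (b : Bool) (u : PWord) (hu : u.isRed = true) (hn : u ≠ nil) :
    CongTree (act x (setDot b u)) (.node (opR b) x (toBTree u)) := by
  induction u generalizing x with
  | nil => exact absurd rfl hn
  | lab w _ => simp [isRed] at hu
  | sub b' c w _ ih =>
    simp only [isRed, Bool.and_eq_true, Bool.not_eq_true'] at hu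
    rw [setDot, act, toBTree, if_neg (by simp [hu]), if_neg (by simp [hu]), if_pos hu.2]
    split_ifs with hw
    · subst hw
      exact refl _
    · exact (ih _ hu.2 hw).trans (opR_opR _ _ _ _)

/-- Leading white children are outermost in a normal form, so the new letters must pass below them,
by `act_opL`. From the first label or red child on, both sides are the same accumulation. -/
theorem toBTree_append {u : PWord} (hu : u.isRed = false) (v : PWord) :
    CongTree (toBTree (u ++ v)) (act (toBTree u) v) := by
  induction u with
  | nil => simp [isRed] at hu
  | lab w _ =>
    rw [lab_append, toBTree, toBTree, act_append]
    exact refl _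
  | sub b c w _ ih =>
    rw [sub_append, toBTree, toBTree]
    by_cases hc : c.isRed
    · rw [if_pos hc, if_pos hc, act_append]
      exact refl _
    · have hw : w.isRed = false := by simpa [isRed, hc] using hu
      rw [if_neg hc, if_neg hc, if_neg (by simp [hw]), if_neg (by simp [hw])]
      exact (node _ (refl _) (ih hw)).trans (act_opL b (toBTree c) (toBTree w) v).symm

/-- By `opL_odot`, attaching white children one after the other on the left amounts to attaching
their `⊙`-product at once. -/
theorem toBTree_setDot_append (b : Bool) {u v : PWord} (hu : u.isRed = true) (hn : u ≠ nil)
    (hv : v.isRed = false) :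
    CongTree (toBTree (setDot b u ++ v)) (.node (opL b) (toBTree u) (toBTree v)) := by
  induction u with
  | nil => exact absurd rfl hn
  | lab w _ => simp [isRed] at hu
  | sub b' c w _ ih =>
    simp only [isRed, Bool.and_eq_true, Bool.not_eq_true'] at hu
    rw [setDot, sub_append, toBTree, toBTree, if_neg (by simp [hu]), if_neg (by simp [hv]),
      if_neg (by simp [hu]), if_pos hu.2]
    split_ifs with hw
    · subst hw
      exact refl _
    · exact (node _ (refl _) (ih hu.2 hw)).trans (opL_odot _ _ _ _).symm

/-- Associativity of `⊙` nests the product to the right. -/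
theorem toBTree_red_append {u v : PWord} (hu : u.isRed = true) (hn : u ≠ nil)
    (hv : v.isRed = true) (hn' : v ≠ nil) :
    CongTree (toBTree (u ++ v)) (.node .odot (toBTree u) (toBTree v)) := by
  induction u with
  | nil => exact absurd rfl hn
  | lab w _ => simp [isRed] at hu
  | sub b' c w _ ih =>
    simp only [isRed, Bool.and_eq_true, Bool.not_eq_true'] at hu
    have hwv : w ++ v ≠ nil := fun h => hn' (append_eq_nil.1 h).2
    rw [sub_append, toBTree, toBTree, if_neg (by simp [hu]), if_pos (by simp [hv, hu]),
      if_neg hwv, if_neg (by simp [hu]), if_pos hu.2]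
    split_ifs with hw
    · subst hw
      exact refl _
    · exact (node _ (refl _) (ih hu.2 hw)).trans (odot_odot _ _ _).symm

theorem toBTree_asWord (u : PWord) : toBTree (asWord u) = toBTree u := by
  unfold asWord
  split_ifs with h
  · simp [toBTree, h, act]
  · rfl

theorem toBTree_flat {u : PWord} (hu : IsTree u) : toBTree (flat false u) = toBTree u := by
  unfold flat
  split_ifs with h
  · rw [setDot_of_noDot (hu.2.noDot h)]
  · simp [toBTree, h, isRed]

/-- This is where the relations are shown to be sufficient: normal forms are compatible with all six
operations modulo the congruence. -/
theorem toBTree_op {u v : PWord} (hu : IsTree u) (hv : IsTree v) (g : Gen6) :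
    CongTree (toBTree (op g u v)) (.node g (toBTree u) (toBTree v)) := by
  have hR : ∀ b, CongTree (toBTree (op (opR b) u v)) (.node (opR b) (toBTree u) (toBTree v)) := by
    intro b
    rw [op_opR]
    refine (toBTree_append (isRed_asWord u) _).trans ?_
    rw [toBTree_asWord, ← setDot_flat b false, ← toBTree_flat hv]
    exact act_setDot _ b _ (isRed_flat _ _) (flat_ne_nil hv.2.ne_nil)
  have hL : ∀ b, CongTree (toBTree (op (opL b) u v)) (.node (opL b) (toBTree u) (toBTree v)) := by
    intro b
    rw [op_opL, ← setDot_flat b false, ← toBTree_flat hu, ← toBTree_asWord v]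
    exact toBTree_setDot_append b (isRed_flat _ _) (flat_ne_nil hu.2.ne_nil) (isRed_asWord _)
  cases g with
  | prec => exact hR false
  | ll => exact hR true
  | succ => exact hL false
  | gg => exact hL true
  | mid =>
    refine (toBTree_append (isRed_asWord u) _).trans ?_
    rw [toBTree_asWord, ← toBTree_asWord v]
    exact act_not_red _ _ (isRed_asWord v)
  | odot =>
    rw [← toBTree_flat hu, ← toBTree_flat hv]
    exact toBTree_red_append (isRed_flat _ _) (flat_ne_nil hu.2.ne_nil) (isRed_flat _ _)
      (flat_ne_nil hv.2.ne_nil)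

theorem toBTree_ofBTree (t : BTree Gen6) : CongTree (toBTree (ofBTree t)) t := by
  induction t with
  | leaf => exact refl _
  | node g l r hl hr =>
    exact (toBTree_op (isTree_ofBTree l) (isTree_ofBTree r) g).trans (CongTree.node g hl hr)

end PWord

theorem CongTree.of_ofBTree_eq {t u : BTree Gen6} (h : PWord.ofBTree t = PWord.ofBTree u) :
    CongTree t u :=
  (PWord.toBTree_ofBTree t).symm.trans (h ▸ PWord.toBTree_ofBTree u)

/-- Soundness of the relations needs to be tested only on planar words with three labels, because
values in `Mon × FF` depend on the planar word alone. -/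
theorem ofBTree_rel {a b c d : Gen6} (h : (a, b, c, d) ∈ rels16) :
    PWord.ofBTree (.node a (.node b .leaf .leaf) .leaf) =
      PWord.ofBTree (.node c .leaf (.node d .leaf .leaf)) := by
  revert a b c d
  -- Quantifying over the members of the list makes the statement decidable: sixteen equalities of
  -- explicit words.
  suffices ∀ q ∈ rels16, PWord.ofBTree (.node q.1 (.node q.2.1 .leaf .leaf) .leaf) =
      PWord.ofBTree (.node q.2.2.1 .leaf (.node q.2.2.2 .leaf .leaf)) from
    fun {a b c d} h => this (a, b, c, d) h
  decide

/-! ### The fraction of a tree -/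

namespace RTree

/-- The set of labels of the tree. -/
def desc (t : RTree) : Finset ℕ := (allLabels t).toFinset

/-- The exponent of the symbol of a node other than the root. -/
def sgn (t : RTree) : ℤ := if isRed t then 1 else -1

mutual
/-- The product of the symbols of the nodes other than the root. -/
noncomputable def nodeSum : RTree → Finset ℕ →₀ ℤ
  | node _ p d => forestSum p + forestSum d
/-- The product of the symbols of all nodes of a forest. -/
noncomputable def forestSum : List RTree → Finset ℕ →₀ ℤ
  | [] => 0
  | t :: ts => nodeSum t + Finsupp.single (desc t) (sgn t) + forestSum ts
end

mutual
/-- The product over the dotted edges of the labels above the edge. -/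
def dotSum : RTree → Multiset ℕ
  | node _ p d => dotForest p + (dotForest d + forestLabels d)
/-- The product over the dotted edges in a forest. -/
def dotForest : List RTree → Multiset ℕ
  | [] => 0
  | t :: ts => dotSum t + dotForest ts
end

/-- The fraction of a tree. -/
noncomputable def frac (t : RTree) : Finset ℕ →₀ ℤ :=
  nodeSum t - if isRed t then 0 else Finsupp.single (desc t) 1

@[simp] theorem forestSum_append (l l' : List RTree) :
    forestSum (l ++ l') = forestSum l + forestSum l' := by
  induction l with
  | nil => simp [forestSum]
  | cons t l ih => simp [forestSum, ih, add_assoc]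

@[simp] theorem dotForest_append (l l' : List RTree) :
    dotForest (l ++ l') = dotForest l + dotForest l' := by
  induction l with
  | nil => simp [dotForest]
  | cons t l ih => simp [dotForest, ih, add_assoc]

@[simp] theorem forestLabels_append (l l' : List RTree) :
    forestLabels (l ++ l') = forestLabels l + forestLabels l' := by
  simp [forestLabels_eq]

theorem forestSum_children (t : RTree) : forestSum t.children = nodeSum t := by
  obtain ⟨L, p, d⟩ := t
  simp [children, plain, dotted, nodeSum]

theorem forestSum_perm {l l' : List RTree} (h : l.Perm l') : forestSum l = forestSum l' := by
  induction h with
  | nil => rfl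
  | cons t _ ih => simp only [forestSum, ih]
  | swap t u l => simp only [forestSum]; abel
  | trans _ _ h h' => exact h.trans h'

theorem dotForest_perm {l l' : List RTree} (h : l.Perm l') : dotForest l = dotForest l' := by
  induction h with
  | nil => rfl
  | cons t _ ih => simp only [dotForest, ih]
  | swap t u l => simp only [dotForest]; abel
  | trans _ _ h h' => exact h.trans h'

theorem forestLabels_perm {l l' : List RTree} (h : l.Perm l') :
    forestLabels l = forestLabels l' := by
  rw [forestLabels_eq, forestLabels_eq]
  exact (h.map _).sum_eq

theorem Same.allLabels_eq {t t' : RTree} (h : Same t t') : allLabels t = allLabels t' := by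
  induction h with
  | refl t => rfl
  | symm _ ih => exact ih.symm
  | trans _ _ ih ih' => exact ih.trans ih'
  | perm L hp hd => simp only [allLabels, forestLabels_perm hp, forestLabels_perm hd]
  | plain L p d _ ih => simp only [allLabels, forestLabels, ih]
  | dotted L p d _ ih => simp only [allLabels, forestLabels, ih]

theorem Same.nodeSum_eq {t t' : RTree} (h : Same t t') : nodeSum t = nodeSum t' := by
  induction h with
  | refl t => rfl
  | symm _ ih => exact ih.symm
  | trans _ _ ih ih' => exact ih.trans ih'
  | perm L hp hd => simp only [nodeSum, forestSum_perm hp, forestSum_perm hd]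
  | plain L p d h ih => simp only [nodeSum, forestSum, ih, desc, h.allLabels_eq, sgn, h.isRed_eq]
  | dotted L p d h ih => simp only [nodeSum, forestSum, ih, desc, h.allLabels_eq, sgn, h.isRed_eq]

theorem Same.dotSum_eq {t t' : RTree} (h : Same t t') : dotSum t = dotSum t' := by
  induction h with
  | refl t => rfl
  | symm _ ih => exact ih.symm
  | trans _ _ ih ih' => exact ih.trans ih'
  | perm L hp hd =>
    simp only [dotSum, dotForest_perm hp, dotForest_perm hd, forestLabels_perm hd]
  | plain L p d h ih => simp only [dotSum, dotForest, ih]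
  | dotted L p d h ih => simp only [dotSum, dotForest, forestLabels, ih, h.allLabels_eq]

theorem Same.frac_eq {t t' : RTree} (h : Same t t') : frac t = frac t' := by
  simp only [frac, desc, h.nodeSum_eq, h.isRed_eq, h.allLabels_eq]

theorem mem_forestLabels {j : ℕ} {l : List RTree} :
    j ∈ forestLabels l ↔ ∃ t ∈ l, j ∈ allLabels t := by
  rw [forestLabels_eq, mem_sum_map]

theorem desc_subset_of_mem {L : Finset ℕ} {p d : List RTree} {t : RTree} (ht : t ∈ p ∨ t ∈ d) :
    desc t ⊆ desc (node L p d) := by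
  intro j hj
  simp only [desc, Multiset.mem_toFinset, allLabels, Multiset.mem_add, mem_forestLabels] at hj ⊢
  rcases ht with ht | ht
  · exact .inr (.inl ⟨t, ht, hj⟩)
  · exact .inr (.inr ⟨t, ht, hj⟩)

theorem forestSum_support {P : Finset ℕ → Prop} {l : List RTree}
    (h : ∀ t ∈ l, P (desc t) ∧ ∀ S ∈ (nodeSum t).support, P S) :
    ∀ S ∈ (forestSum l).support, P S := by
  classical
  induction l with
  | nil => simp [forestSum]
  | cons t l ih =>
    intro S hS
    rw [forestSum] at hS
    rcases Finset.mem_union.1 (Finsupp.support_add hS) with hS | hS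
    · rcases Finset.mem_union.1 (Finsupp.support_add hS) with hS | hS
      · exact (h t (by simp)).2 S hS
      · rw [Finset.mem_singleton.1 (Finsupp.support_single_subset hS)]
        exact (h t (by simp)).1
    · exact ih (fun u hu => h u (List.mem_cons_of_mem _ hu)) S hS

theorem nodeSum_support (t : RTree) : ∀ S ∈ (nodeSum t).support, S ⊆ desc t := by
  classical
  induction t using ind with
  | h L p d hp hd =>
    intro S hS
    rw [nodeSum] at hS
    rcases Finset.mem_union.1 (Finsupp.support_add hS) with hS | hS
    · exact forestSum_support (P := fun S => S ⊆ desc (node L p d)) (fun t ht =>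
        ⟨desc_subset_of_mem (.inl ht),
          fun S hS => (hp t ht S hS).trans (desc_subset_of_mem (.inl ht))⟩) S hS
    · exact forestSum_support (P := fun S => S ⊆ desc (node L p d)) (fun t ht =>
        ⟨desc_subset_of_mem (.inr ht),
          fun S hS => (hd t ht S hS).trans (desc_subset_of_mem (.inr ht))⟩) S hS

theorem IsRedWhite.allLabels_ne_zero {t : RTree} (ht : IsRedWhite t) : allLabels t ≠ 0 := by
  induction ht with
  | node L p d h1 _ _ _ _ hp hd =>
    intro h0
    rw [allLabels] at h0
    simp only [add_eq_zero, Finset.val_eq_zero] at h0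
    obtain ⟨hL, h2, h3⟩ := h0
    have hlen := h1 hL
    rcases p with _ | ⟨t, p⟩
    · rcases d with _ | ⟨t, d⟩
      · simp at hlen
      · simp only [forestLabels, add_eq_zero] at h3
        exact hd t (by simp) h3.1
    · simp only [forestLabels, add_eq_zero] at h2
      exact hp t (by simp) h2.1

theorem IsRedWhite.desc_nonempty {t : RTree} (ht : IsRedWhite t) : (desc t).Nonempty := by
  obtain ⟨j, hj⟩ := Multiset.exists_mem_of_ne_zero ht.allLabels_ne_zero
  exact ⟨j, Multiset.mem_toFinset.2 hj⟩

theorem IsRedWhite.nodeSum_support {t : RTree} (ht : IsRedWhite t) :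
    ∀ S ∈ (nodeSum t).support, S.Nonempty := by
  classical
  induction ht with
  | node L p d _ _ _ hp hd ihp ihd =>
    intro S hS
    rw [nodeSum] at hS
    rcases Finset.mem_union.1 (Finsupp.support_add hS) with hS | hS
    · exact forestSum_support (fun t h => ⟨(hp t h).desc_nonempty, ihp t h⟩) S hS
    · exact forestSum_support (fun t h => ⟨(hd t h).desc_nonempty, ihd t h⟩) S hS

theorem mem_allLabels_of_mem_dotSum {j : ℕ} (t : RTree) : j ∈ dotSum t → j ∈ allLabels t := by
  induction t using ind with
  | h L p d hp hd =>
    have key : ∀ l : List RTree, (∀ t ∈ l, j ∈ dotSum t → j ∈ allLabels t) →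
        j ∈ dotForest l → j ∈ forestLabels l := by
      intro l hl
      induction l with
      | nil => simp [dotForest]
      | cons t l ih =>
        simp only [dotForest, forestLabels, Multiset.mem_add]
        exact Or.imp (hl t (by simp)) (ih fun u hu => hl u (List.mem_cons_of_mem _ hu))
    simp only [dotSum, allLabels, Multiset.mem_add]
    rintro (h | h | h)
    · exact .inr (.inl (key p hp h))
    · exact .inr (.inr (key d hd h))
    · exact .inr (.inr h)

/-! Relabelling. -/

theorem desc_relabel {f : ℕ → ℕ} (hf : Function.Injective f) (t : RTree) :
    desc (relabel f t) = (desc t).image f := by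
  rw [desc, allLabels_relabel f t fun _ _ _ _ h => hf h, Multiset.toFinset_map]
  rfl

theorem forestSum_relabel_of {f : ℕ → ℕ} (hf : Function.Injective f) {l : List RTree}
    (h : ∀ t ∈ l, nodeSum (relabel f t) = Finsupp.mapDomain (fun S => S.image f) (nodeSum t)) :
    forestSum (relabelForest f l) = Finsupp.mapDomain (fun S => S.image f) (forestSum l) := by
  induction l with
  | nil => simp [relabelForest, forestSum]
  | cons t l ih =>
    rw [relabelForest, forestSum, forestSum, h t (by simp),
      ih fun u hu => h u (List.mem_cons_of_mem _ hu), desc_relabel hf, sgn, isRed_relabel,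
      Finsupp.mapDomain_add, Finsupp.mapDomain_add, Finsupp.mapDomain_single]
    rfl

theorem nodeSum_relabel {f : ℕ → ℕ} (hf : Function.Injective f) (t : RTree) :
    nodeSum (relabel f t) = Finsupp.mapDomain (fun S => S.image f) (nodeSum t) := by
  induction t using ind with
  | h L p d hp hd =>
    rw [relabel, nodeSum, nodeSum, forestSum_relabel_of hf hp, forestSum_relabel_of hf hd,
      Finsupp.mapDomain_add]

theorem forestSum_relabel {f : ℕ → ℕ} (hf : Function.Injective f) (l : List RTree) :
    forestSum (relabelForest f l) = Finsupp.mapDomain (fun S => S.image f) (forestSum l) :=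
  forestSum_relabel_of hf fun t _ => nodeSum_relabel hf t

theorem frac_relabel {f : ℕ → ℕ} (hf : Function.Injective f) (t : RTree) :
    frac (relabel f t) = Finsupp.mapDomain (fun S => S.image f) (frac t) := by
  rw [frac, frac, nodeSum_relabel hf, isRed_relabel, desc_relabel hf, sub_eq_add_neg,
    sub_eq_add_neg, Finsupp.mapDomain_add]
  split_ifs
  · simp
  · rw [← Finsupp.single_neg, ← Finsupp.single_neg, Finsupp.mapDomain_single]

theorem forestLabels_relabel {f : ℕ → ℕ} (hf : Function.Injective f) (l : List RTree) :
    forestLabels (relabelForest f l) = (forestLabels l).map f := by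
  induction l with
  | nil => rfl
  | cons t l ih =>
    rw [relabelForest, forestLabels, forestLabels, ih, allLabels_relabel f t fun _ _ _ _ h => hf h,
      Multiset.map_add]

theorem dotForest_relabel_of {f : ℕ → ℕ} {l : List RTree}
    (h : ∀ t ∈ l, dotSum (relabel f t) = (dotSum t).map f) :
    dotForest (relabelForest f l) = (dotForest l).map f := by
  induction l with
  | nil => rfl
  | cons t l ih =>
    rw [relabelForest, dotForest, dotForest, h t (by simp),
      ih fun u hu => h u (List.mem_cons_of_mem _ hu), Multiset.map_add]

theorem dotSum_relabel {f : ℕ → ℕ} (hf : Function.Injective f) (t : RTree) :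
    dotSum (relabel f t) = (dotSum t).map f := by
  induction t using ind with
  | h L p d hp hd =>
    rw [relabel, dotSum, dotSum, dotForest_relabel_of hp, dotForest_relabel_of hd,
      forestLabels_relabel hf, Multiset.map_add, Multiset.map_add]

theorem dotForest_relabel {f : ℕ → ℕ} (hf : Function.Injective f) (l : List RTree) :
    dotForest (relabelForest f l) = (dotForest l).map f :=
  dotForest_relabel_of fun t _ => dotSum_relabel hf t

/-! Grafting. -/

/-- The shift of the labels of a tree in which the label `x` is replaced by `n` labels. -/
def shift (n x j : ℕ) : ℕ := if j ≤ x then j else j + n - 1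

theorem shift_inj {n x : ℕ} (hn : 1 ≤ n) : Function.Injective (shift n x) := shift_injective hn

theorem biUnion_blowUp_of_notMem {n x : ℕ} {S : Finset ℕ} (h : x ∉ S) :
    S.image (shift n x) = S.biUnion (blowUp x n) := by
  rw [← Finset.biUnion_singleton]
  refine Finset.biUnion_congr rfl fun j hj => ?_
  rw [blowUp_of_ne (fun e : j = x => h (e ▸ hj))]
  rfl

/-- On sets that avoid `x`, blowing up `x` is a mere renumbering, and all symbols of the forest
avoid `x`. -/
theorem forestSum_relabel_shift {n x : ℕ} (hn : 1 ≤ n) {l : List RTree}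
    (h : x ∉ forestLabels l) : forestSum (relabelForest (shift n x) l) =
      Finsupp.mapDomain (fun S => S.biUnion (blowUp x n)) (forestSum l) := by
  rw [forestSum_relabel (shift_inj hn)]
  refine Finsupp.mapDomain_congr fun S hS => biUnion_blowUp_of_notMem ?_
  refine forestSum_support (P := fun S => x ∉ S) (fun t ht => ?_) S hS
  have hx : x ∉ desc t := fun hx => h (mem_forestLabels.2 ⟨t, ht, Multiset.mem_toFinset.1 hx⟩)
  exact ⟨hx, fun S hS hxS => hx (nodeSum_support t S hS hxS)⟩

theorem mem_forestLabels_of_mem_dotForest {j : ℕ} {l : List RTree} (h : j ∈ dotForest l) :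
    j ∈ forestLabels l := by
  have := mem_allLabels_of_mem_dotSum (j := j) (node ∅ l [])
  simpa [dotSum, allLabels, dotForest, forestLabels] using this (by simp [dotSum, h])

theorem map_shift {n x : ℕ} {s : Multiset ℕ} (h : x ∉ s) :
    s.map (shift n x) = s.bind fun j => (blowUp x n j).val :=
  (bind_blowUp h).symm

section graft

variable {n x : ℕ} {B : RTree}

theorem forestLabels_graftForest (hn : 1 ≤ n) (hB : allLabels B = (Finset.Icc x (x + n - 1)).val)
    {l : List RTree} (hl : (forestLabels l).Nodup) :
    forestLabels (graftForest x B (relabelForest (shift n x) l)) =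
      (forestLabels l).bind fun j => (blowUp x n j).val := by
  -- The forest is hung on an auxiliary root without labels, where grafting passes directly to the
  -- children.
  have : allLabels (graft x B (relabel (shift n x) (node ∅ l []))) =
      (allLabels (node ∅ l [])).bind fun j => (blowUp x n j).val :=
    allLabels_graft hn hB (node ∅ l []) (by simpa [allLabels, forestLabels] using hl)
  simpa [relabel, graft, allLabels, forestLabels, relabelForest, graftForest] using this

theorem desc_graft (hn : 1 ≤ n) (hB : allLabels B = (Finset.Icc x (x + n - 1)).val)
    {t : RTree} (ht : (allLabels t).Nodup) :
    desc (graft x B (relabel (shift n x) t)) = (desc t).biUnion (blowUp x n) := by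
  have : allLabels (graft x B (relabel (shift n x) t)) = _ := allLabels_graft hn hB t ht
  rw [desc, this, toFinset_bind_blowUp]
  rfl

theorem isRed_graft_relabel (hn : 1 ≤ n) {t : RTree} (h : ¬ (isLeafOf x t ∧ isRed B)) :
    isRed (graft x B (relabel (shift n x) t)) = isRed t := by
  have hl : isLeafOf x (relabel (shift n x) t) = isLeafOf x t := relabel_isLeafOf hn t
  rw [isRed_graft _ (by rwa [hl]), isRed_relabel]

/-- The only change apart from the blow-up occurs at the node containing `x`. A white `B` merges
into it and contributes its own non-root nodes; a red `B` becomes a new child and contributes also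
its root; if the node is a leaf replaced by the children of a red `B`, the symbol of the leaf
disappears. Each time the contribution is `[desc B]` times the fraction of `B`. The multiplicity of
`x`, which is `0` or `1`, lets the same formula cover the subtrees without `x` in the induction. The
excluded case replaces the whole tree and is treated by whoever sees its parent. -/
theorem nodeSum_graft (hn : 1 ≤ n) (hB : allLabels B = (Finset.Icc x (x + n - 1)).val)
    (t : RTree) (ht : (allLabels t).Nodup) (h : ¬ (isLeafOf x t ∧ isRed B)) :
    nodeSum (graft x B (relabel (shift n x) t)) =
      Finsupp.mapDomain (fun S => S.biUnion (blowUp x n)) (nodeSum t) +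
        (allLabels t).count x • (Finsupp.single (desc B) 1 + frac B) := by
  -- A red root has exponent `0` in the fraction, so the factor `[desc B]` makes it a red child with
  -- exponent `1`. A white root has exponent `-1`, and the factor cancels it.
  have hgr : isRed B = true → Finsupp.single (desc B) 1 + frac B =
      nodeSum B + Finsupp.single (desc B) (sgn B) := by
    intro hr
    rw [frac, if_pos hr, sgn, if_pos hr]
    abel
  have hgw : isRed B = false → Finsupp.single (desc B) 1 + frac B = nodeSum B := by
    intro hr
    rw [frac, if_neg (by simp [hr])]
    abel
  induction t using ind with
  | h L p d hp hd =>
    have hmem : x ∈ L.image (shift n x) ↔ x ∈ L := mem_image_shift hn L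
    have hlf : isLeafOf x (relabel (shift n x) (node L p d)) = isLeafOf x (node L p d) :=
      relabel_isLeafOf hn _
    rw [relabel] at hlf ⊢
    rw [allLabels] at ht ⊢
    obtain ⟨h1, h2, h3⟩ := Multiset.nodup_add.1 ht
    obtain ⟨h4, h5, _⟩ := Multiset.nodup_add.1 h2
    simp only [graft, hmem, hlf]
    by_cases hx : x ∈ L
    · have hxc : x ∉ forestLabels p + forestLabels d := Multiset.disjoint_left.1 h3 hx
      rw [Multiset.mem_add, not_or] at hxc
      rw [if_pos hx, Multiset.count_add, Multiset.count_eq_one_of_mem h1 hx, Multiset.count_add,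
        Multiset.count_eq_zero_of_notMem hxc.1, Multiset.count_eq_zero_of_notMem hxc.2, add_zero,
        add_zero, one_smul]
      split_ifs with hr hl
      · exact absurd ⟨hl, hr⟩ h
      · rw [nodeSum, nodeSum, forestSum, forestSum_relabel_shift hn hxc.1,
          forestSum_relabel_shift hn hxc.2, Finsupp.mapDomain_add, hgr hr]
        abel
      · rw [nodeSum, nodeSum, forestSum_append, forestSum_append,
          forestSum_relabel_shift hn hxc.1, forestSum_relabel_shift hn hxc.2,
          Finsupp.mapDomain_add, hgw (by simpa using hr), ← forestSum_children B, children,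
          forestSum_append]
        abel
    · have key : ∀ l : List RTree, (forestLabels l).Nodup →
          (∀ t ∈ l, (allLabels t).Nodup → ¬ (isLeafOf x t ∧ isRed B) →
            nodeSum (graft x B (relabel (shift n x) t)) =
              Finsupp.mapDomain (fun S => S.biUnion (blowUp x n)) (nodeSum t) +
                (allLabels t).count x • (Finsupp.single (desc B) 1 + frac B)) →
          forestSum (graftForest x B (relabelForest (shift n x) l)) =
            Finsupp.mapDomain (fun S => S.biUnion (blowUp x n)) (forestSum l) +
              (forestLabels l).count x • (Finsupp.single (desc B) 1 + frac B) := by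
        intro l hnd hl
        induction l with
        | nil => simp [relabelForest, graftForest, forestSum, forestLabels]
        | cons t l ih =>
          rw [forestLabels] at hnd ⊢
          obtain ⟨k1, k2, _⟩ := Multiset.nodup_add.1 hnd
          have hlt : isLeafOf x (relabel (shift n x) t) = isLeafOf x t := relabel_isLeafOf hn t
          rw [relabelForest, graftForest, forestSum_append, hlt,
            ih k2 fun t ht => hl t (List.mem_cons_of_mem _ ht), Multiset.count_add, add_smul,
            forestSum, Finsupp.mapDomain_add, Finsupp.mapDomain_add, Finsupp.mapDomain_single]
          split_ifs with hc
          · obtain ⟨ha, hb⟩ := Bool.and_eq_true_iff.1 hc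
            -- The leaf had exponent `-1`. Its blown-up symbol is `[desc B]`, which cancels the root
            -- of `B`, and only the children of `B` remain.
            rw [forestSum_children, (isLeafOf_iff x t).1 ha, hgr hb]
            have hd : (desc (node {x} [] [])).biUnion (blowUp x n) = desc B := by
              simp [desc, allLabels, forestLabels, blowUp, hB]
            rw [hd, sgn, sgn, if_pos hb, if_neg (by simp [isRed])]
            simp only [nodeSum, forestSum, allLabels, forestLabels, Finset.singleton_val,
              add_zero, Multiset.count_singleton_self, one_smul, Finsupp.mapDomain_zero,
              Finsupp.single_neg]
            abel
          · have hc' : ¬ (isLeafOf x t ∧ isRed B) := by simpa using hc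
            rw [forestSum, forestSum, add_zero, hl t (by simp) k1 hc', desc_graft hn hB k1, sgn,
              isRed_graft_relabel hn hc', ← sgn]
            abel
      rw [if_neg hx, nodeSum, nodeSum, key p h4 hp, key d h5 hd, Finsupp.mapDomain_add,
        Multiset.count_add, Multiset.count_eq_zero_of_notMem (s := L.val) hx, Multiset.count_add,
        zero_add, add_smul]
      abel

theorem dotSum_eq_of_red (hd : B.dotted = []) : dotForest B.children = dotSum B := by
  obtain ⟨L, p, d⟩ := B
  simp only [dotted] at hd
  subst hd
  simp [children, plain, dotted, dotSum, dotForest, forestLabels]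

/-- Replacing a dotted edge to a leaf by dotted edges to the children of a red `B` preserves the
labels above, as the root of `B` carries none. The hypothesis `hBd` ensures that no factor is lost
when the edges out of that root are redrawn. -/
theorem dotSum_graft (hn : 1 ≤ n) (hB : allLabels B = (Finset.Icc x (x + n - 1)).val)
    (hBd : isRed B = true → B.dotted = []) (t : RTree) (ht : (allLabels t).Nodup) :
    dotSum (graft x B (relabel (shift n x) t)) =
      (dotSum t).bind (fun j => (blowUp x n j).val) + (allLabels t).count x • dotSum B := by
  induction t using ind with
  | h L p d hp hd =>
    have hmem : x ∈ L.image (shift n x) ↔ x ∈ L := mem_image_shift hn L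
    have hlf : isLeafOf x (relabel (shift n x) (node L p d)) = isLeafOf x (node L p d) :=
      relabel_isLeafOf hn _
    rw [relabel] at hlf ⊢
    rw [allLabels] at ht ⊢
    obtain ⟨h1, h2, h3⟩ := Multiset.nodup_add.1 ht
    obtain ⟨h4, h5, _⟩ := Multiset.nodup_add.1 h2
    simp only [graft, hmem, hlf]
    by_cases hx : x ∈ L
    · have hxc : x ∉ forestLabels p + forestLabels d := Multiset.disjoint_left.1 h3 hx
      rw [Multiset.mem_add, not_or] at hxc
      have hxp := fun h => hxc.1 (mem_forestLabels_of_mem_dotForest h)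
      have hxd := fun h => hxc.2 (mem_forestLabels_of_mem_dotForest h)
      rw [if_pos hx, Multiset.count_add, Multiset.count_eq_one_of_mem h1 hx, Multiset.count_add,
        Multiset.count_eq_zero_of_notMem hxc.1, Multiset.count_eq_zero_of_notMem hxc.2, add_zero,
        add_zero, one_smul]
      split_ifs with hr hl
      · have := (isLeafOf_iff _ _).1 hl
        simp only [RTree.node.injEq] at this
        obtain ⟨-, rfl, rfl⟩ := this
        simp [dotSum, dotForest, forestLabels]
      · simp only [dotSum, dotForest, dotForest_relabel (shift_inj hn),
          forestLabels_relabel (shift_inj hn), map_shift hxp, map_shift hxd, map_shift hxc.2,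
          Multiset.add_bind]
        abel
      · obtain ⟨L', p', d'⟩ := B
        simp only [dotSum, plain, dotted, dotForest_append, forestLabels_append,
          dotForest_relabel (shift_inj hn),
          forestLabels_relabel (shift_inj hn), map_shift hxp, map_shift hxd, map_shift hxc.2,
          Multiset.add_bind]
        abel
    · have key : ∀ l : List RTree, (forestLabels l).Nodup →
          (∀ t ∈ l, (allLabels t).Nodup →
            dotSum (graft x B (relabel (shift n x) t)) =
              (dotSum t).bind (fun j => (blowUp x n j).val) +
                (allLabels t).count x • dotSum B) →
          dotForest (graftForest x B (relabelForest (shift n x) l)) =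
            (dotForest l).bind (fun j => (blowUp x n j).val) +
              (forestLabels l).count x • dotSum B := by
        intro l hnd hl
        induction l with
        | nil => simp [relabelForest, graftForest, dotForest, forestLabels]
        | cons t l ih =>
          rw [forestLabels] at hnd ⊢
          obtain ⟨k1, k2, _⟩ := Multiset.nodup_add.1 hnd
          have hlt : isLeafOf x (relabel (shift n x) t) = isLeafOf x t := relabel_isLeafOf hn t
          rw [relabelForest, graftForest, dotForest_append, hlt,
            ih k2 fun t ht => hl t (List.mem_cons_of_mem _ ht), Multiset.count_add, add_smul,
            dotForest, Multiset.add_bind]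
          split_ifs with hc
          · obtain ⟨ha, hb⟩ := Bool.and_eq_true_iff.1 hc
            rw [dotSum_eq_of_red (hBd hb), (isLeafOf_iff x t).1 ha]
            simp only [dotSum, dotForest, allLabels, forestLabels, Finset.singleton_val,
              add_zero, Multiset.count_singleton_self, one_smul, Multiset.zero_bind]
            abel
          · rw [dotForest, dotForest, add_zero, hl t (by simp) k1]
            abel
      rw [if_neg hx, dotSum, dotSum, key p h4 hp, key d h5 hd,
        forestLabels_graftForest hn hB h5, Multiset.add_bind, Multiset.add_bind,
        Multiset.count_add, Multiset.count_eq_zero_of_notMem (s := L.val) hx, Multiset.count_add,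
        zero_add, add_smul]
      abel

/-- Here the tree is whole, so the case excluded in `nodeSum_graft` means that it is the single node
`x`: its symbol cancels against `[desc B]` and `B` is left. Otherwise the colour of the root does
not change. -/
theorem frac_graft (hn : 1 ≤ n) (hB : allLabels B = (Finset.Icc x (x + n - 1)).val)
    {t : RTree} (ht : (allLabels t).Nodup) (hx : x ∈ allLabels t) :
    frac (graft x B (relabel (shift n x) t)) =
      Finsupp.mapDomain (fun S => S.biUnion (blowUp x n)) (frac t) +
        (Finsupp.single (desc B) 1 + frac B) := by
  by_cases h : isLeafOf x t ∧ isRed B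
  · have hd : (desc (node {x} [] [])).biUnion (blowUp x n) = desc B := by
      simp [desc, allLabels, forestLabels, blowUp, hB]
    have hlf : isLeafOf x (relabel (shift n x) t) = isLeafOf x t := relabel_isLeafOf hn _
    have e : graft x B (relabel (shift n x) t) = B := by
      have := (isLeafOf_iff _ _).1 (hlf.trans h.1)
      rw [this]
      simp [graft, h.2, isLeafOf]
    rw [e, (isLeafOf_iff _ _).1 h.1, frac.eq_1 (node _ _ _), if_neg (by simp [isRed])]
    simp only [nodeSum, forestSum, add_zero, zero_sub]
    rw [← Finsupp.single_neg, Finsupp.mapDomain_single, hd, Finsupp.single_neg]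
    abel
  · rw [frac, nodeSum_graft hn hB t ht h, Multiset.count_eq_one_of_mem ht hx, one_smul,
      isRed_graft_relabel hn h, desc_graft hn hB ht, frac.eq_1 t, sub_eq_add_neg (nodeSum t),
      Finsupp.mapDomain_add]
    split_ifs
    · simp
    · rw [← Finsupp.single_neg, Finsupp.mapDomain_single, Finsupp.single_neg]
      abel

end graft

/-! The morphism from trees to fractions. -/

theorem IsRWTree.desc_eq {n : ℕ} {t : RTree} (h : IsRWTree n t) : desc t = Finset.Icc 1 n := by
  rw [desc, h.labels, Finset.val_toFinset]

/-- The monomial and the fraction of a tree. -/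
noncomputable def value {n : ℕ} (t : {t : RTree // IsRWTree n t}) :
    (PreOperad.hadamard Mon FF).Op n :=
  (⟨dotSum t.1, t.2.pos, fun j hj => by
      have := mem_allLabels_of_mem_dotSum t.1 hj
      rwa [t.2.labels, Finset.mem_val, Finset.mem_Icc] at this⟩,
   ⟨frac t.1, t.2.pos, fun S hS => by
      classical
      rw [← t.2.desc_eq]
      rw [frac, sub_eq_add_neg] at hS
      rcases Finset.mem_union.1 (Finsupp.support_add hS) with hS | hS
      · exact ⟨t.2.redWhite.nodeSum_support S hS, nodeSum_support t.1 S hS⟩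
      · rw [Finsupp.support_neg] at hS
        split_ifs at hS
        · simp at hS
        · rw [Finset.mem_singleton.1 (Finsupp.support_single_subset hS)]
          exact ⟨t.2.redWhite.desc_nonempty, subset_rfl⟩⟩)

theorem value_ext {n : ℕ} {t t' : {t : RTree // IsRWTree n t}} (h : dotSum t.1 = dotSum t'.1)
    (h' : frac t.1 = frac t'.1) : value t = value t' :=
  Prod.ext (Subtype.ext h) (Subtype.ext h')

theorem IsRedWhite.dotted_eq_nil {t : RTree} (h : IsRedWhite t) (hr : isRed t = true) :
    t.dotted = [] := by
  cases h with
  | node L p d _ h2 _ _ _ => exact h2 hr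

theorem value_comp {m n k : ℕ} (hk : k + 1 = m + n) (x : ℕ) (hx : 1 ≤ x ∧ x ≤ m)
    (A : {t : RTree // IsRWTree m t}) (B : {t : RTree // IsRWTree n t}) :
    value ⟨comp n x A.1 B.1, A.2.comp hk hx B.2⟩ =
      (PreOperad.hadamard Mon FF).circ hk x hx (value A) (value B) := by
  have hn := B.2.pos
  have hinj : Function.Injective fun j => j + (x - 1) := fun a b h => by
    simpa using h
  have hdB : desc (relabel (fun j => j + (x - 1)) B.1) = Finset.Icc x (x + n - 1) := by
    rw [desc_relabel hinj, B.2.desc_eq, image_shift_Icc]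
    congr 1 <;> omega
  have hBl : allLabels (relabel (fun j => j + (x - 1)) B.1) = (Finset.Icc x (x + n - 1)).val := by
    rw [allLabels_relabel _ _ fun _ _ _ _ h => hinj h, B.2.labels, ← image_shift_val,
      image_shift_Icc]
    congr 2 <;> omega
  have hnd : (allLabels A.1).Nodup := by
    rw [A.2.labels]
    exact Finset.nodup _
  have hxA : x ∈ allLabels A.1 := by
    rw [A.2.labels, Finset.mem_val, Finset.mem_Icc]
    exact hx
  refine Prod.ext (Subtype.ext ?_) (Subtype.ext ?_)
  · refine (dotSum_graft hn hBl ?_ A.1 hnd).trans ?_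
    · exact fun h => (B.2.redWhite.relabel _).dotted_eq_nil h
    · rw [Multiset.count_eq_one_of_mem hnd hxA, one_smul, dotSum_relabel hinj]
      rfl
  · refine (frac_graft hn hBl hnd hxA).trans ?_
    rw [hdB, frac_relabel hinj]
    simp only [PreOperad.hadamard, FF, value]
    abel

/-- The morphism from trees to fractions. -/
noncomputable def valueHom : PreOperad.Hom RW6 (PreOperad.hadamard Mon FF) where
  app _ := Quotient.lift value fun _ _ h => value_ext (Same.dotSum_eq h) (Same.frac_eq h)
  map_one := by
    refine Prod.ext (Subtype.ext ?_) (Subtype.ext ?_)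
    · rfl
    · change frac (node {1} [] []) = -Finsupp.single {1} 1
      simp [frac, nodeSum, forestSum, isRed, noneRed, desc, allLabels, forestLabels]
  map_circ h i hi a b := by
    induction a, b using Quotient.inductionOn₂ with
    | _ A B => exact value_comp h i hi A B

theorem value_genTree (g : Gen6) : value ⟨genTree g, isRWTree_genTree g⟩ = genFrac g := by
  refine Prod.ext (Subtype.ext ?_) (Subtype.ext ?_)
  · cases g <;> rfl
  · have h12 : ({2} : Finset ℕ) ≠ {1, 2} := by decide
    have h12' : ({1} : Finset ℕ) ≠ {1, 2} := by decide
    cases g <;>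
      simp [value, genFrac, genTree, genDen, invProd, frac, nodeSum, forestSum, isRed, noneRed,
        desc, allLabels, forestLabels, sgn, h12, h12', sub_eq_add_neg, add_comm]

end RTree

/-! ### From planar trees to trees -/

namespace PWord

open RTree

/-- The tree of a planar tree, with labels from `a` on. -/
def toRTree (a : ℕ) : PWord → RTree
  | nil => .node ∅ [] []
  | lab w =>
      .node (insert a (toRTree (a + 1) w).rootLabels) (toRTree (a + 1) w).plain
        (toRTree (a + 1) w).dotted
  | sub false c w =>
      .node (toRTree (a + c.size) w).rootLabels (toRTree a c :: (toRTree (a + c.size) w).plain)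
        (toRTree (a + c.size) w).dotted
  | sub true c w =>
      .node (toRTree (a + c.size) w).rootLabels (toRTree (a + c.size) w).plain
        (toRTree a c :: (toRTree (a + c.size) w).dotted)

theorem node_eta (t : RTree) : .node t.rootLabels t.plain t.dotted = t := by
  cases t; rfl

@[simp] theorem isRed_toRTree (a : ℕ) (w : PWord) : (toRTree a w).isRed = w.isRed := by
  induction w generalizing a with
  | nil => rfl
  | lab w _ => simp [toRTree, RTree.isRed, isRed]
  | sub b c w ihc ihw =>
    rw [isRed, ← ihc a, ← ihw (a + c.size), ← node_eta (toRTree (a + c.size) w)]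
    cases b <;> simp only [toRTree, RTree.isRed, noneRed, rootLabels, plain, dotted] <;>
      ac_rfl

theorem allLabels_toRTree (a : ℕ) (w : PWord) :
    allLabels (toRTree a w) = (Finset.Ico a (a + w.size)).val := by
  induction w generalizing a with
  | nil => simp [toRTree, allLabels, forestLabels, size]
  | lab w ih =>
    have h := ih (a + 1)
    have e : Finset.Ico a (a + (w.size + 1)) = insert a (Finset.Ico (a + 1) (a + 1 + w.size)) := by
      ext j
      simp only [Finset.mem_Ico, Finset.mem_insert]
      omega
    rw [← node_eta (toRTree (a + 1) w)] at h
    have ha : a ∉ (toRTree (a + 1) w).rootLabels := by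
      intro ha
      have : a ∈ (Finset.Ico (a + 1) (a + 1 + w.size)).val := by
        rw [← h, allLabels]
        exact Multiset.mem_add.2 (.inl ha)
      simp at this
    rw [toRTree, size, e, Finset.insert_val_of_notMem (by simp), ← h, allLabels, allLabels,
      Finset.insert_val_of_notMem ha, Multiset.cons_add]
  | sub b c w ihc ihw =>
    have h := ihw (a + c.size)
    rw [← node_eta (toRTree (a + c.size) w)] at h
    have e : (Finset.Ico a (a + (c.size + w.size))).val =
        (Finset.Ico a (a + c.size)).val + (Finset.Ico (a + c.size) (a + c.size + w.size)).val := by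
      rw [← add_assoc]
      exact (Multiset.Ico_add_Ico_eq_Ico (by omega) (by omega)).symm
    rw [size, e, ← h, ← ihc]
    cases b <;> simp only [toRTree, allLabels, forestLabels] <;> abel

theorem desc_toRTree (a : ℕ) (w : PWord) : desc (toRTree a w) = Finset.Ico a (a + w.size) := by
  rw [desc, allLabels_toRTree, Finset.val_toFinset]

theorem nodeSum_lab (a : ℕ) (w : PWord) :
    nodeSum (toRTree a (lab w)) = nodeSum (toRTree (a + 1) w) := by
  rw [← node_eta (toRTree (a + 1) w)]
  rfl

/-- The exponent of the symbol of a node other than the root. -/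
def sgn (w : PWord) : ℤ := if w.isRed then 1 else -1

theorem sgn_ne_zero (w : PWord) : sgn w ≠ 0 := by
  unfold sgn
  split_ifs <;> simp

theorem nodeSum_sub (a : ℕ) (b : Bool) (c w : PWord) :
    nodeSum (toRTree a (sub b c w)) = nodeSum (toRTree a c) +
      Finsupp.single (Finset.Ico a (a + c.size)) (sgn c) + nodeSum (toRTree (a + c.size) w) := by
  rw [← desc_toRTree, sgn, ← isRed_toRTree a c, ← node_eta (toRTree (a + c.size) w)]
  cases b <;> simp only [toRTree, nodeSum, forestSum, RTree.sgn, plain, dotted] <;> abel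

theorem dotSum_lab (a : ℕ) (w : PWord) :
    dotSum (toRTree a (lab w)) = dotSum (toRTree (a + 1) w) := by
  rw [← node_eta (toRTree (a + 1) w)]
  rfl

theorem dotSum_sub (a : ℕ) (b : Bool) (c w : PWord) :
    dotSum (toRTree a (sub b c w)) = dotSum (toRTree a c) +
      (if b then (Finset.Ico a (a + c.size)).val else 0) + dotSum (toRTree (a + c.size) w) := by
  rw [← allLabels_toRTree, ← node_eta (toRTree (a + c.size) w)]
  cases b <;>
    simp only [toRTree, dotSum, dotForest, forestLabels, plain, dotted, if_true, Bool.false_eq_true,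
      if_false] <;> abel

/-! The trees are recursively labelled dotted red and white trees. -/

theorem isRecursive_toRTree (a : ℕ) (w : PWord) : IsRecursive (toRTree a w) := by
  have key : ∀ (a : ℕ) (w : PWord), ∃ u v, (allLabels (toRTree a w)).toFinset = Finset.Icc u v := by
    intro a w
    rw [allLabels_toRTree, Finset.val_toFinset]
    rcases Nat.eq_zero_or_pos w.size with h | h
    · exact ⟨1, 0, by simp [h]⟩
    · exact ⟨a, a + w.size - 1, by ext j; simp only [Finset.mem_Ico, Finset.mem_Icc]; omega⟩
  have sub_plain : ∀ {t : RTree}, IsRecursive t → ∀ s ∈ t.plain, IsRecursive s :=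
    fun h s hs => h.children s (List.mem_append_left _ hs)
  have sub_dotted : ∀ {t : RTree}, IsRecursive t → ∀ s ∈ t.dotted, IsRecursive s :=
    fun h s hs => h.children s (List.mem_append_right _ hs)
  induction w generalizing a with
  | nil => exact .node _ _ _ (key a nil) (by simp) (by simp)
  | lab w ih =>
    exact .node _ _ _ (key a (lab w)) (sub_plain (ih _)) (sub_dotted (ih _))
  | sub b c w ihc ihw =>
    cases b with
    | false =>
      exact .node _ _ _ (key a (sub false c w))
        (List.forall_mem_cons.2 ⟨ihc _, sub_plain (ihw _)⟩) (sub_dotted (ihw _))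
    | true =>
      exact .node _ _ _ (key a (sub true c w)) (sub_plain (ihw _))
        (List.forall_mem_cons.2 ⟨ihc _, sub_dotted (ihw _)⟩)

theorem two_le_of_shape {a : ℕ} {w : PWord} (h : Shape w) (hL : (toRTree a w).rootLabels = ∅) :
    2 ≤ (toRTree a w).plain.length + (toRTree a w).dotted.length := by
  rcases w with _ | w | ⟨b, c, w⟩
  · exact absurd rfl h.ne_nil
  · simp [toRTree, rootLabels] at hL
  · rcases w with _ | w | ⟨b', c', w⟩
    · exact absurd rfl (h.ne_single b c)
    · cases b <;> simp [toRTree, rootLabels] at hL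
    · cases b <;> cases b' <;> simp [toRTree, plain, dotted] <;> omega

theorem dotted_eq_nil {a : ℕ} {w : PWord} (h : w.noDot = true) : (toRTree a w).dotted = [] := by
  induction w generalizing a with
  | nil => rfl
  | lab w ih => exact ih h
  | sub b c w _ ih =>
    simp only [noDot, Bool.and_eq_true, Bool.not_eq_true'] at h
    rw [h.1]
    exact ih h.2

/-- Stated for words, because the tail of a tree need not have the shape of a tree. -/
theorem isRedWhite_children (a : ℕ) {w : PWord} (h : Ok w) :
    (∀ t ∈ (toRTree a w).plain, IsRedWhite t) ∧
      ∀ t ∈ (toRTree a w).dotted, IsRedWhite t ∧ ¬ t.isRed = true := by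
  induction w generalizing a with
  | nil => simp [toRTree, plain, dotted]
  | lab w ih => exact ih (a + 1) h
  | sub b c w ihc ihw =>
    obtain ⟨⟨hc, hs, hb⟩, hw⟩ := h
    obtain ⟨h1, h2⟩ := ihw (a + c.size) hw
    have hct : IsRedWhite (toRTree a c) := by
      obtain ⟨k1, k2⟩ := ihc a hc
      rw [← node_eta (toRTree a c)]
      refine .node _ _ _ (two_le_of_shape hs) (fun hr => ?_) (fun t ht => (k2 t ht).2) k1
        fun t ht => (k2 t ht).1
      rw [node_eta, isRed_toRTree] at hr
      exact dotted_eq_nil (hs.noDot hr)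
    cases b with
    | false => exact ⟨List.forall_mem_cons.2 ⟨hct, h1⟩, h2⟩
    | true =>
      refine ⟨h1, List.forall_mem_cons.2 ⟨⟨hct, ?_⟩, h2⟩⟩
      rw [isRed_toRTree, hb rfl]
      simp

theorem isRedWhite_toRTree (a : ℕ) {w : PWord} (h : IsTree w) : IsRedWhite (toRTree a w) := by
  obtain ⟨k1, k2⟩ := isRedWhite_children a h.1
  rw [← node_eta (toRTree a w)]
  refine .node _ _ _ (two_le_of_shape h.2) (fun hr => ?_) (fun t ht => (k2 t ht).2) k1
    fun t ht => (k2 t ht).1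
  rw [node_eta, isRed_toRTree] at hr
  exact dotted_eq_nil (h.2.noDot hr)

theorem isRWTree_toRTree {w : PWord} (h : IsTree w) : IsRWTree w.size (toRTree 1 w) where
  redWhite := isRedWhite_toRTree 1 h
  labels := by
    rw [allLabels_toRTree]
    congr 1
    ext j
    simp only [Finset.mem_Ico, Finset.mem_Icc]
    omega
  recursive := isRecursive_toRTree 1 w

/-! The planar tree is determined by its monomial and its fraction. -/

theorem Ok.size_pos {w : PWord} (h : Ok w) (hn : w ≠ nil) : 0 < w.size := by
  induction w with
  | nil => exact absurd rfl hn
  | lab w _ => simp [size]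
  | sub b c w ih _ =>
    have := ih h.1.1 h.1.2.1.ne_nil
    simp only [size]
    omega

theorem Ico_eq_Ico {u v u' v' : ℕ} (h : u < v) (e : Finset.Ico u v = Finset.Ico u' v') :
    u = u' ∧ v = v' := by
  have h1 := (Finset.ext_iff.1 e u)
  have h2 := (Finset.ext_iff.1 e (v - 1))
  have h3 := (Finset.ext_iff.1 e u')
  have h4 := (Finset.ext_iff.1 e (v' - 1))
  simp only [Finset.mem_Ico] at h1 h2 h3 h4
  omega

theorem nodeSum_toRTree_support {a : ℕ} {w : PWord} (h : Ok w) :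
    ∀ S ∈ (nodeSum (toRTree a w)).support,
      ∃ u v, a ≤ u ∧ u < v ∧ v ≤ a + w.size ∧ S = Finset.Ico u v := by
  classical
  induction w generalizing a with
  | nil => simp [toRTree, nodeSum, forestSum]
  | lab w ih =>
    intro S hS
    rw [nodeSum_lab] at hS
    obtain ⟨u, v, h1, h2, h3, h4⟩ := ih h S hS
    exact ⟨u, v, by omega, h2, by simp only [size]; omega, h4⟩
  | sub b c w ihc ihw =>
    obtain ⟨⟨hc, hs, hb⟩, hw⟩ := h
    have hpos := hc.size_pos hs.ne_nil
    intro S hS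
    rw [nodeSum_sub] at hS
    rw [size]
    rcases Finset.mem_union.1 (Finsupp.support_add hS) with hS | hS
    · rcases Finset.mem_union.1 (Finsupp.support_add hS) with hS | hS
      · obtain ⟨u, v, h1, h2, h3, h4⟩ := ihc hc S hS
        exact ⟨u, v, by omega, h2, by omega, h4⟩
      · rw [Finset.mem_singleton.1 (Finsupp.support_single_subset hS)]
        exact ⟨a, a + c.size, le_rfl, by omega, by omega, rfl⟩
    · obtain ⟨u, v, h1, h2, h3, h4⟩ := ihw hw S hS
      exact ⟨u, v, by omega, h2, by omega, h4⟩

theorem nodeSum_apply_of_lt {a u v : ℕ} {w : PWord} (h : Ok w) (huv : u < v)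
    (hn : u < a ∨ a + w.size < v) : nodeSum (toRTree a w) (Finset.Ico u v) = 0 := by
  by_contra h0
  obtain ⟨u', v', h1, h2, h3, h4⟩ := nodeSum_toRTree_support h _ (Finsupp.mem_support_iff.2 h0)
  have := Ico_eq_Ico huv h4
  omega

/-- Intervals that start at `a` come only from the first child and its descendants. With
`nodeSum_sub_apply_self`, the first child is therefore the longest interval starting at `a` with a
non-zero exponent, and its exponent gives its colour. -/
theorem nodeSum_sub_apply {a : ℕ} {b : Bool} {c w : PWord} (h : Ok (sub b c w)) {v : ℕ}
    (hv : a + c.size < v) : nodeSum (toRTree a (sub b c w)) (Finset.Ico a v) = 0 := by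
  have hpos := h.1.1.size_pos h.1.2.1.ne_nil
  rw [nodeSum_sub, Finsupp.add_apply, Finsupp.add_apply,
    nodeSum_apply_of_lt h.1.1 (by omega) (.inr hv),
    nodeSum_apply_of_lt h.2 (by omega) (.inl (by omega)), Finsupp.single_apply, if_neg]
  · simp
  · intro e
    have := Ico_eq_Ico (by omega) e
    omega

/-- A tree is not a single child, so no node but the root carries all labels. Hence the exponent of
the full interval depends only on the root. -/
theorem IsTree.nodeSum_apply {a : ℕ} {w : PWord} (h : IsTree w) :
    nodeSum (toRTree a w) (Finset.Ico a (a + w.size)) = 0 := by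
  have hpos := h.1.size_pos h.2.ne_nil
  rcases w with _ | w | ⟨b, c, w⟩
  · exact absurd rfl h.2.ne_nil
  · rw [nodeSum_lab]
    exact nodeSum_apply_of_lt h.1 (by omega) (.inl (by omega))
  · have hw : w ≠ nil := by
      rintro rfl
      exact h.2.ne_single _ _ rfl
    have := Ok.size_pos h.1.2 hw
    exact nodeSum_sub_apply h.1 (by simp only [size]; omega)

theorem nodeSum_sub_apply_self {a : ℕ} {b : Bool} {c w : PWord} (h : Ok (sub b c w)) :
    nodeSum (toRTree a (sub b c w)) (Finset.Ico a (a + c.size)) = sgn c := by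
  have hpos := h.1.1.size_pos h.1.2.1.ne_nil
  rw [nodeSum_sub, Finsupp.add_apply, Finsupp.add_apply,
    IsTree.nodeSum_apply ⟨h.1.1, h.1.2.1⟩,
    nodeSum_apply_of_lt h.2 (by omega) (.inl (by omega)), Finsupp.single_eq_same]
  simp

theorem mem_dotSum_toRTree {a j : ℕ} {w : PWord} (h : j ∈ dotSum (toRTree a w)) :
    a ≤ j ∧ j < a + w.size := by
  have := mem_allLabels_of_mem_dotSum _ h
  rwa [allLabels_toRTree, Finset.mem_val, Finset.mem_Ico] at this

/-- Some label lies above no dotted edge. An initial label of the root is such a label. A first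
child through a plain edge contains one by induction. A first child through a dotted edge is white
and is skipped; the remaining word then still has a label or a red child. -/
theorem exists_notMem_dotSum {a : ℕ} {w : PWord} (h : Ok w)
    (hw : w.isRed = false ∨ w.noDot = true ∧ w ≠ nil) :
    ∃ j, a ≤ j ∧ j < a + w.size ∧ j ∉ dotSum (toRTree a w) := by
  induction w generalizing a with
  | nil => simp [isRed] at hw
  | lab w _ =>
    refine ⟨a, le_rfl, by simp [size], fun h => ?_⟩
    rw [dotSum_lab] at h
    have := mem_dotSum_toRTree h
    omega
  | sub b c w ihc ihw =>
    obtain ⟨⟨hc, hs, hb⟩, hok⟩ := h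
    simp only [dotSum_sub, Multiset.mem_add, size]
    cases b with
    | false =>
      have hc' : c.isRed = false ∨ c.noDot = true ∧ c ≠ nil := by
        cases hr : c.isRed
        · exact .inl rfl
        · exact .inr ⟨hs.noDot hr, hs.ne_nil⟩
      obtain ⟨j, h1, h2, h3⟩ := ihc (a := a) hc hc'
      refine ⟨j, h1, by omega, ?_⟩
      rintro ((h | h) | h)
      · exact h3 h
      · simp at h
      · have := mem_dotSum_toRTree h
        omega
    | true =>
      have hw' : w.isRed = false := by
        rcases hw with hw | hw
        · simpa [isRed, hb rfl] using hw
        · simp [noDot] at hw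
      obtain ⟨j, h1, h2, h3⟩ := ihw (a := a + c.size) hok (.inl hw')
      refine ⟨j, by omega, by omega, ?_⟩
      rintro ((h | h) | h)
      · have := mem_dotSum_toRTree h
        omega
      · simp only [if_true, Finset.mem_val, Finset.mem_Ico] at h
        omega
      · exact h3 h

theorem add_val_eq {a s : ℕ} {m₁ m₂ m₁' m₂' : Multiset ℕ} (h₁ : ∀ j ∈ m₁, j < a + s)
    (h₁' : ∀ j ∈ m₁', j < a + s) (h₂ : ∀ j ∈ m₂, a + s ≤ j) (h₂' : ∀ j ∈ m₂', a + s ≤ j)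
    (h : m₁ + m₂ = m₁' + m₂') : m₁ = m₁' := by
  have := congrArg (Multiset.filter (· < a + s)) h
  rwa [Multiset.filter_add, Multiset.filter_add, Multiset.filter_eq_self.2 h₁,
    Multiset.filter_eq_self.2 h₁', Multiset.filter_eq_nil.2 fun j hj => not_lt.2 (h₂ j hj),
    Multiset.filter_eq_nil.2 fun j hj => not_lt.2 (h₂' j hj), add_zero, add_zero] at this

/-- A dotted edge to `c` would put all its labels into the monomial of `c'`, against
`exists_notMem_dotSum`. This is how the monomial detects dotted edges. -/
theorem dot_eq_of_eq {a : ℕ} {b : Bool} {c c' : PWord} (hs : c.size = c'.size)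
    (hc' : IsTree c')
    (h : dotSum (toRTree a c) + (if b then (Finset.Ico a (a + c.size)).val else 0) =
      dotSum (toRTree a c') + 0) : b = false := by
  cases b with
  | false => rfl
  | true =>
    have hc'' : c'.isRed = false ∨ c'.noDot = true ∧ c' ≠ nil := by
      cases hr : c'.isRed
      · exact .inl rfl
      · exact .inr ⟨hc'.2.noDot hr, hc'.2.ne_nil⟩
    obtain ⟨j, h1, h2, h3⟩ := exists_notMem_dotSum (a := a) hc'.1 hc''
    rw [add_zero] at h
    refine absurd ?_ h3
    rw [← h, if_pos rfl]
    have : j ∈ Finset.Ico a (a + c.size) := Finset.mem_Ico.2 ⟨h1, by omega⟩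
    exact Multiset.mem_add.2 (.inr this)

/-- After an initial label `a` all intervals start further right, whereas an initial child occurs as
an interval starting at `a`. -/
theorem nodeSum_lab_ne_sub {a : ℕ} {b : Bool} {u c v : PWord} (hu : Ok u) (hv : Ok (sub b c v)) :
    nodeSum (toRTree a (lab u)) ≠ nodeSum (toRTree a (sub b c v)) := by
  intro e
  have hpos := hv.1.1.size_pos hv.1.2.1.ne_nil
  have := nodeSum_sub_apply_self (a := a) hv
  rw [← e, nodeSum_lab, nodeSum_apply_of_lt (w := u) hu (by omega) (.inl (by omega))] at this
  exact sgn_ne_zero c this.symm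

/-- The word is recovered from left to right. The exponents of the intervals starting at `a` tell
whether the first letter is a label or a child, and the size and colour of the child. Then symbols
and monomials split between the child and the rest according to position, and the induction applies
to both. -/
theorem eq_of_sums_eq {a : ℕ} {w w' : PWord} (h : Ok w) (h' : Ok w') (hs : w.size = w'.size)
    (hK : nodeSum (toRTree a w) = nodeSum (toRTree a w'))
    (hD : dotSum (toRTree a w) = dotSum (toRTree a w')) : w = w' := by
  induction w generalizing w' a with
  | nil =>
    by_contra hne
    have := h'.size_pos (Ne.symm hne)
    simp only [size] at hs
    omega
  | lab w ih =>
    rcases w' with _ | w' | ⟨b', c', w'⟩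
    · simp [size] at hs
    · rw [nodeSum_lab, nodeSum_lab] at hK
      rw [dotSum_lab, dotSum_lab] at hD
      rw [ih (a := a + 1) (w' := w') h h' (by simpa [size] using hs) hK hD]
    · exact absurd hK (nodeSum_lab_ne_sub h h')
  | sub b c w ihc ihw =>
    rcases w' with _ | w' | ⟨b', c', w'⟩
    · have := h.size_pos (by simp)
      rw [hs] at this
      simp [size] at this
    · exact absurd hK.symm (nodeSum_lab_ne_sub h' h)
    · have hcs : c.size = c'.size := by
        rcases lt_trichotomy c.size c'.size with hlt | he | hlt
        · have := nodeSum_sub_apply_self (a := a) h'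
          rw [← hK, nodeSum_sub_apply h (by omega)] at this
          exact absurd this.symm (sgn_ne_zero _)
        · exact he
        · have := nodeSum_sub_apply_self (a := a) h
          rw [hK, nodeSum_sub_apply h' (by omega)] at this
          exact absurd this.symm (sgn_ne_zero _)
      have hsgn : sgn c = sgn c' := by
        have := nodeSum_sub_apply_self (a := a) h
        rwa [hK, hcs, nodeSum_sub_apply_self h', eq_comm] at this
      rw [nodeSum_sub, nodeSum_sub, hsgn, add_right_comm, hcs, add_right_comm _ _ (nodeSum _),
        add_left_inj] at hK
      obtain ⟨⟨hc, hsh, hb⟩, hw⟩ := h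
      obtain ⟨⟨hc', hsh', hb'⟩, hw'⟩ := h'
      -- The symbols of the first child are the intervals whose left end is below `a + c'.size`;
      -- those of the rest start at that number or later.
      have hKc : nodeSum (toRTree a c) = nodeSum (toRTree a c') := by
        ext S
        by_cases hS : ∃ u v, u < v ∧ u < a + c'.size ∧ S = Finset.Ico u v
        · obtain ⟨u, v, huv, hu, rfl⟩ := hS
          have := DFunLike.congr_fun hK (Finset.Ico u v)
          rwa [Finsupp.add_apply, Finsupp.add_apply, nodeSum_apply_of_lt hw huv (.inl hu),
            nodeSum_apply_of_lt hw' huv (.inl hu), add_zero, add_zero] at this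
        · rw [Finsupp.notMem_support_iff.1 fun hm => hS ?_,
            Finsupp.notMem_support_iff.1 fun hm => hS ?_]
          · obtain ⟨u, v, h1, h2, h3, h4⟩ := nodeSum_toRTree_support hc' _ hm
            exact ⟨u, v, h2, by omega, h4⟩
          · obtain ⟨u, v, h1, h2, h3, h4⟩ := nodeSum_toRTree_support hc _ hm
            exact ⟨u, v, h2, by omega, h4⟩
      have hKw := hK
      rw [hKc, add_right_inj] at hKw
      rw [dotSum_sub, dotSum_sub] at hD
      have hlt : ∀ (b : Bool) (c : PWord), ∀ j ∈ dotSum (toRTree a c) +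
          (if b then (Finset.Ico a (a + c.size)).val else 0), j < a + c.size := by
        intro b c j hj
        rcases Multiset.mem_add.1 hj with hj | hj
        · exact (mem_dotSum_toRTree hj).2
        · split_ifs at hj
          · exact (Finset.mem_Ico.1 hj).2
          · simp at hj
      have hDc := add_val_eq (s := c.size) (hlt b c) (hcs ▸ hlt b' c')
        (fun j hj => (mem_dotSum_toRTree hj).1)
        (fun j hj => hcs ▸ (mem_dotSum_toRTree hj).1) hD
      have hDw := hD
      rw [hDc, add_right_inj, hcs] at hDw
      -- If only one of the two edges were dotted, `dot_eq_of_eq` would give a contradiction.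
      have hbb : b = b' := by
        cases b with
        | false =>
          exact (dot_eq_of_eq hcs.symm ⟨hc, hsh⟩ (by simpa using hDc.symm)).symm
        | true =>
          cases b' with
          | false => exact dot_eq_of_eq hcs ⟨hc', hsh'⟩ (by simpa using hDc)
          | true => rfl
      subst hbb
      rw [hcs, add_left_inj] at hDc
      rw [ihc hc hc' hcs hKc hDc, ihw hw hw' (by simp only [size] at hs; omega) hKw hDw]

end PWord

/-! ### The value of a binary tree is that of its planar tree -/

namespace RTree

theorem rootLabels_relabel (f : ℕ → ℕ) (t : RTree) :
    (relabel f t).rootLabels = t.rootLabels.image f := by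
  cases t; rfl

theorem plain_relabel (f : ℕ → ℕ) (t : RTree) :
    (relabel f t).plain = relabelForest f t.plain := by
  cases t; rfl

theorem dotted_relabel (f : ℕ → ℕ) (t : RTree) :
    (relabel f t).dotted = relabelForest f t.dotted := by
  cases t; rfl

end RTree

namespace PWord

open RTree

theorem toRTree_add (a k : ℕ) (w : PWord) :
    toRTree (a + k) w = relabel (fun j => j + k) (toRTree a w) := by
  induction w generalizing a with
  | nil => rfl
  | lab w ih =>
    rw [toRTree, toRTree, relabel, add_right_comm, ih, rootLabels_relabel, plain_relabel,
      dotted_relabel, Finset.image_insert]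
  | sub b c w ihc ihw =>
    cases b <;>
      rw [toRTree, toRTree, relabel, add_right_comm, ihc, ihw, rootLabels_relabel, plain_relabel,
        dotted_relabel] <;> rfl

theorem nodeSum_append (a : ℕ) (u v : PWord) : nodeSum (toRTree a (u ++ v)) =
    nodeSum (toRTree a u) + nodeSum (toRTree (a + u.size) v) := by
  induction u generalizing a with
  | nil => simp [toRTree, nodeSum, forestSum, size]
  | lab w ih =>
    rw [lab_append, nodeSum_lab, nodeSum_lab, ih, size, add_assoc a 1, add_comm 1]
  | sub b c w _ ih =>
    rw [sub_append, nodeSum_sub, nodeSum_sub, ih, size, ← add_assoc a, ← add_assoc]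

theorem dotSum_append (a : ℕ) (u v : PWord) : dotSum (toRTree a (u ++ v)) =
    dotSum (toRTree a u) + dotSum (toRTree (a + u.size) v) := by
  induction u generalizing a with
  | nil => simp [toRTree, dotSum, dotForest, forestLabels, size]
  | lab w ih =>
    rw [lab_append, dotSum_lab, dotSum_lab, ih, size, add_assoc a 1, add_comm 1]
  | sub b c w _ ih =>
    rw [sub_append, dotSum_sub, dotSum_sub, ih, size, ← add_assoc a, ← add_assoc]

theorem nodeSum_setDot (a : ℕ) (b : Bool) (w : PWord) :
    nodeSum (toRTree a (setDot b w)) = nodeSum (toRTree a w) := by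
  induction w generalizing a with
  | nil => rfl
  | lab w ih => rw [setDot, nodeSum_lab, nodeSum_lab, ih]
  | sub b' c w _ ih => rw [setDot, nodeSum_sub, nodeSum_sub, ih]

/-- A red word has no label of its own, so dotting the edges to all its children puts each label
once more above a dotted edge, exactly as one dotted edge to the whole would. -/
theorem dotSum_setDot (a : ℕ) (b : Bool) {w : PWord} (hr : w.isRed = true)
    (hd : w.noDot = true) : dotSum (toRTree a (setDot b w)) =
      dotSum (toRTree a w) + if b then (Finset.Ico a (a + w.size)).val else 0 := by
  induction w generalizing a with
  | nil => simp [setDot, size]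
  | lab w _ => simp [isRed] at hr
  | sub b' c w _ ih =>
    simp only [isRed, Bool.and_eq_true, Bool.not_eq_true'] at hr
    simp only [noDot, Bool.and_eq_true, Bool.not_eq_true'] at hd
    rw [setDot, dotSum_sub, dotSum_sub, ih _ hr.2 hd.2, hd.1]
    cases b with
    | false => simp
    | true =>
      have e : (Finset.Ico a (a + (c.size + w.size))).val = (Finset.Ico a (a + c.size)).val +
          (Finset.Ico (a + c.size) (a + c.size + w.size)).val := by
        rw [← add_assoc]
        exact (Multiset.Ico_add_Ico_eq_Ico (by omega) (by omega)).symm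
      simp only [if_true, Bool.false_eq_true, if_false, size, e]
      abel

theorem dotSum_asWord (a : ℕ) (w : PWord) :
    dotSum (toRTree a (asWord w)) = dotSum (toRTree a w) := by
  unfold asWord
  split_ifs
  · rw [dotSum_sub]
    simp [toRTree, dotSum, dotForest, forestLabels]
  · rfl

theorem dotSum_flat (a : ℕ) (b : Bool) {w : PWord} (h : IsTree w) :
    dotSum (toRTree a (flat b w)) =
      dotSum (toRTree a w) + if b then (Finset.Ico a (a + w.size)).val else 0 := by
  unfold flat
  split_ifs with hr hb hb
  · simpa [hb] using dotSum_setDot a b hr (h.2.noDot hr)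
  · simpa [hb] using dotSum_setDot a b hr (h.2.noDot hr)
  · rw [dotSum_sub]
    simp [toRTree, dotSum, dotForest, forestLabels, hb]
  · rw [dotSum_sub]
    simp [toRTree, dotSum, dotForest, forestLabels, hb]

/-- A white root dissolves in the new node and loses its exponent `-1`; a red root becomes a red
child and goes from exponent `0` to `1`. In both cases the exponent grows by one. -/
theorem nodeSum_asWord (a : ℕ) (w : PWord) : nodeSum (toRTree a (asWord w)) =
    frac (toRTree a w) + Finsupp.single (Finset.Ico a (a + w.size)) 1 := by
  rw [frac, isRed_toRTree, desc_toRTree]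
  unfold asWord
  split_ifs with h
  · rw [nodeSum_sub, sgn, if_pos h]
    simp [toRTree, nodeSum, forestSum]
  · abel

/-- A white root becomes a white child and keeps the exponent `-1`; a red root dissolves and keeps
the exponent `0`. -/
theorem nodeSum_flat (a : ℕ) (b : Bool) (w : PWord) : nodeSum (toRTree a (flat b w)) =
    frac (toRTree a w) := by
  rw [frac, isRed_toRTree, desc_toRTree]
  unfold flat
  split_ifs with h
  · rw [nodeSum_setDot, sub_zero]
  · rw [nodeSum_sub, sgn, if_neg h]
    simp [toRTree, nodeSum, forestSum, sub_eq_add_neg]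

-- Values of the six operations.

/-- The symbol of the labels from `a` to `b - 1`. -/
noncomputable def sym (a b : ℕ) : Finset ℕ →₀ ℤ := Finsupp.single (Finset.Ico a b) 1

/-- The numerator coming from a generator applied to operations of arities `a` and `b`. -/
def opMon (g : Gen6) (a b : ℕ) : Multiset ℕ :=
  match g with
  | .ll => (Finset.Ico (1 + a) (1 + a + b)).val
  | .gg => (Finset.Ico 1 (1 + a)).val
  | _ => 0

/-- The denominator coming from a generator applied to operations of arities `a` and `b`. -/
noncomputable def opFrac (g : Gen6) (a b : ℕ) : Finset ℕ →₀ ℤ :=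
  match g with
  | .prec => -sym (1 + a) (1 + a + b) - sym 1 (1 + a + b)
  | .succ => -sym 1 (1 + a) - sym 1 (1 + a + b)
  | .mid => -sym 1 (1 + a + b)
  | .odot => -sym 1 (1 + a) - sym (1 + a) (1 + a + b)
  | .ll => -sym (1 + a) (1 + a + b) - sym 1 (1 + a + b)
  | .gg => -sym 1 (1 + a) - sym 1 (1 + a + b)

theorem dotSum_op (g : Gen6) {u v : PWord} (hu : IsTree u) (hv : IsTree v) :
    dotSum (toRTree 1 (op g u v)) =
      opMon g u.size v.size + dotSum (toRTree (1 + u.size) v) + dotSum (toRTree 1 u) := by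
  cases g <;> simp [op, dotSum_append, dotSum_flat _ _ hu, dotSum_flat _ _ hv, dotSum_asWord,
    opMon] <;> abel

theorem frac_op (g : Gen6) (u v : PWord) : frac (toRTree 1 (op g u v)) =
    sym 1 (1 + u.size) + (sym (1 + u.size) (1 + u.size + v.size) + opFrac g u.size v.size +
      frac (toRTree (1 + u.size) v)) + frac (toRTree 1 u) := by
  rw [frac, isRed_toRTree, desc_toRTree]
  cases g <;> simp [op, nodeSum_append, nodeSum_flat, nodeSum_asWord,
    opFrac, sym, add_assoc] <;> abel

/-- The right factor enters at place `2`, which shifts it by `1`; the left factor of arity `a` then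
enters at place `1` and shifts it by `a - 1` more. -/
theorem biUnion_blowUp_of_le {a : ℕ} (ha : 1 ≤ a) {S : Finset ℕ} (hS : ∀ j ∈ S, 1 ≤ j) :
    (S.image fun j => j + (2 - 1)).biUnion (blowUp 1 a) = S.image fun j => j + a := by
  ext l
  rw [mem_biUnion_blowUp ha]
  simp only [Finset.mem_image, blowDown]
  constructor
  · rintro ⟨j, hj, h⟩
    have := hS j hj
    exact ⟨j, hj, by split_ifs at h <;> omega⟩
  · rintro ⟨j, hj, rfl⟩
    have := hS j hj
    exact ⟨j, hj, by split_ifs <;> omega⟩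

theorem bind_blowUp_of_le {a : ℕ} {m : Multiset ℕ} (hm : ∀ j ∈ m, 1 ≤ j) :
    (m.map fun j => j + (2 - 1)).bind (fun j => (blowUp 1 a j).val) = m.map fun j => j + a := by
  rw [Multiset.bind_map, ← Multiset.bind_singleton]
  refine Multiset.bind_congr fun j hj => ?_
  have := hm j hj
  rw [blowUp_of_ne (by omega), if_neg (by omega), show j + (2 - 1) + a - 1 = j + a by omega]
  rfl

theorem blowUp_gen {a b : ℕ} (ha : 1 ≤ a) (hb : 1 ≤ b) :
    (({1} : Finset ℕ).biUnion (blowUp 2 b)).biUnion (blowUp 1 a) = Finset.Ico 1 (1 + a) ∧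
    (({2} : Finset ℕ).biUnion (blowUp 2 b)).biUnion (blowUp 1 a) =
      Finset.Ico (1 + a) (1 + a + b) ∧
    (({1, 2} : Finset ℕ).biUnion (blowUp 2 b)).biUnion (blowUp 1 a) =
      Finset.Ico 1 (1 + a + b) := by
  refine ⟨?_, ?_, ?_⟩ <;>
  · ext l
    rw [mem_biUnion_blowUp ha, mem_biUnion_blowUp hb]
    simp only [Finset.mem_insert, Finset.mem_singleton, Finset.mem_Ico, blowDown]
    split_ifs <;> omega

theorem genMon_blowUp (g : Gen6) {a b : ℕ} (ha : 1 ≤ a) (hb : 1 ≤ b) :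
    ((genMon g).bind fun j => (blowUp 2 b j).val).bind (fun j => (blowUp 1 a j).val) =
      opMon g a b := by
  have key : ∀ S : Finset ℕ, (S.val.bind fun j => (blowUp 2 b j).val).bind
      (fun j => (blowUp 1 a j).val) = ((S.biUnion (blowUp 2 b)).biUnion (blowUp 1 a)).val := by
    intro S
    rw [bind_blowUp_val hb, bind_blowUp_val ha]
  obtain ⟨h1, h2, -⟩ := blowUp_gen ha hb
  cases g with
  | ll => exact (key {2}).trans (congrArg _ h2)
  | gg => exact (key {1}).trans (congrArg _ h1)
  | _ => rfl

theorem invProd_pair {S T : Finset ℕ} (h : S ≠ T) :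
    invProd {S, T} = Finsupp.single S (-1) + Finsupp.single T (-1) := by
  rw [invProd, Finset.sum_pair h, Finsupp.single_neg, Finsupp.single_neg]

theorem genDen_blowUp (g : Gen6) {a b : ℕ} (ha : 1 ≤ a) (hb : 1 ≤ b) :
    Finsupp.mapDomain (fun S => S.biUnion (blowUp 1 a))
      (Finsupp.mapDomain (fun S => S.biUnion (blowUp 2 b)) (invProd (genDen g))) =
      opFrac g a b := by
  obtain ⟨h1, h2, h3⟩ := blowUp_gen ha hb
  have e1 : invProd {{2}, {1, 2}} =
    Finsupp.single {2} (-1) + Finsupp.single {1, 2} (-1) := invProd_pair (by decide)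
  have e2 : invProd {{1}, {1, 2}} =
    Finsupp.single {1} (-1) + Finsupp.single {1, 2} (-1) := invProd_pair (by decide)
  have e3 : invProd {{1}, {2}} =
    Finsupp.single {1} (-1) + Finsupp.single {2} (-1) := invProd_pair (by decide)
  have e4 : invProd {{1, 2}} = Finsupp.single {1, 2} (-1) := by
    rw [invProd, Finset.sum_singleton, Finsupp.single_neg]
  cases g <;> simp only [genDen, e1, e2, e3, e4, Finsupp.mapDomain_add, Finsupp.mapDomain_single,
    h1, h2, h3] <;> simp only [opFrac, sym, Finsupp.single_neg] <;> abel

/-- The value of a binary tree is the monomial and the fraction of its planar tree. -/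
theorem evalAt_genFrac (t : BTree Gen6) : ∀ (n : ℕ) (h : t.leaves = n),
    ((PreOperad.hadamard Mon FF).evalAt genFrac n ⟨t, h⟩).1.1 =
      dotSum (toRTree 1 (ofBTree t)) ∧
    ((PreOperad.hadamard Mon FF).evalAt genFrac n ⟨t, h⟩).2.1 =
      frac (toRTree 1 (ofBTree t)) := by
  induction t with
  | leaf =>
    intro n h
    simp only [BTree.leaves] at h
    subst h
    refine ⟨rfl, ?_⟩
    change -Finsupp.single {1} 1 = frac (.node {1} [] [])
    simp [frac, nodeSum, forestSum, RTree.isRed, noneRed, desc, allLabels, forestLabels]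
  | node g l r ihl ihr =>
    intro n h
    have ha := l.leaves_pos
    have hb := r.leaves_pos
    have h' := h
    simp only [BTree.leaves] at h'
    obtain ⟨l1, l2⟩ := ihl _ rfl
    obtain ⟨r1, r2⟩ := ihr _ rfl
    -- The bounds on the indices of the right factor are kept, since the double insertion is a
    -- translation only on positive indices.
    have hr1 := ((PreOperad.hadamard Mon FF).evalAt genFrac r.leaves ⟨r, rfl⟩).1.2.2
    have hr2 := ((PreOperad.hadamard Mon FF).evalAt genFrac r.leaves ⟨r, rfl⟩).2.2.2
    rw [r1] at hr1
    rw [r2] at hr2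
    have hinj : Function.Injective fun j => j + l.leaves := fun a b h => by simpa using h
    rw [PreOperad.evalAt_node _ genFrac g l r h rfl rfl (by omega) (by omega) (by omega)
      (by omega)]
    constructor
    · rw [ofBTree, dotSum_op g (isTree_ofBTree l) (isTree_ofBTree r), size_ofBTree, size_ofBTree,
        toRTree_add, dotSum_relabel hinj, ← bind_blowUp_of_le fun j hj => (hr1 j hj).1,
        ← genMon_blowUp g ha hb, ← Multiset.add_bind, ← l1, ← r1]
      simp only [PreOperad.hadamard, Mon, genFrac, Nat.sub_self, add_zero, Multiset.map_id']
    · rw [ofBTree, frac_op, size_ofBTree, size_ofBTree, toRTree_add, frac_relabel hinj]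
      have e1 : Finsupp.mapDomain (fun S => S.image fun j => j + l.leaves)
          (frac (toRTree 1 (ofBTree r))) = Finsupp.mapDomain (fun S => S.biUnion (blowUp 1 l.leaves))
          (Finsupp.mapDomain (fun S => S.image fun j => j + (2 - 1))
            (frac (toRTree 1 (ofBTree r)))) := by
        rw [← Finsupp.mapDomain_comp]
        refine Finsupp.mapDomain_congr fun S hS => (biUnion_blowUp_of_le ha fun j hj => ?_).symm
        exact (Finset.mem_Icc.1 ((hr2 S hS).2 hj)).1
      have e2 : sym 1 (1 + l.leaves) = Finsupp.single (Finset.Icc 1 (1 + l.leaves - 1)) 1 := by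
        rw [sym]
        congr 1
      have e3 : sym (1 + l.leaves) (1 + l.leaves + r.leaves) =
          Finsupp.mapDomain (fun S => S.biUnion (blowUp 1 l.leaves))
            (Finsupp.single (Finset.Icc 2 (2 + r.leaves - 1)) 1) := by
        rw [sym, Finsupp.mapDomain_single]
        congr 1
        ext j
        rw [mem_biUnion_blowUp ha]
        simp only [Finset.mem_Ico, Finset.mem_Icc, blowDown]
        split_ifs <;> omega
      rw [e1, e2, e3, ← genDen_blowUp g ha hb, ← Finsupp.mapDomain_add, ← Finsupp.mapDomain_add,
        ← l2, ← r2]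
      simp only [PreOperad.hadamard, FF, genFrac, Nat.sub_self, add_zero]
      rw [mapDomain_id_of (f := fun S : Finset ℕ => S.image fun j => j) fun S => Finset.image_id']

theorem evalAt_eq_of_ofBTree_eq {n : ℕ} {t u : (freeBinary Gen6).Op n}
    (h : ofBTree t.1 = ofBTree u.1) : (PreOperad.hadamard Mon FF).evalAt genFrac n t =
      (PreOperad.hadamard Mon FF).evalAt genFrac n u := by
  obtain ⟨h1, h2⟩ := evalAt_genFrac t.1 n t.2
  obtain ⟨k1, k2⟩ := evalAt_genFrac u.1 n u.2
  rw [h] at h1 h2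
  exact Prod.ext (Subtype.ext (h1.trans k1.symm)) (Subtype.ext (h2.trans k2.symm))

/-- The exponent of the full interval is `-1` or `0` according to the colour of the root. Once the
colours agree, the root can be removed from both fractions. -/
theorem IsTree.eq_of_frac_eq {w w' : PWord} (h : IsTree w) (h' : IsTree w')
    (hs : w.size = w'.size) (hD : dotSum (toRTree 1 w) = dotSum (toRTree 1 w'))
    (hF : frac (toRTree 1 w) = frac (toRTree 1 w')) : w = w' := by
  rw [frac, frac, isRed_toRTree, isRed_toRTree, desc_toRTree, desc_toRTree, hs] at hF
  have key := DFunLike.congr_fun hF (Finset.Ico 1 (1 + w'.size))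
  rw [Finsupp.sub_apply, Finsupp.sub_apply, h'.nodeSum_apply, ← hs, h.nodeSum_apply] at key
  have hr : w.isRed = w'.isRed := by
    cases h1 : w.isRed <;> cases h2 : w'.isRed <;> simp [h1, h2] at key ⊢
  rw [hr, sub_left_inj] at hF
  exact eq_of_sums_eq h.1 h'.1 hs hF hD

/-- The value determines the planar word, and the relations identify all binary trees with the same
planar word. -/
theorem evalAt_injective {n : ℕ} {t u : (freeBinary Gen6).Op n}
    (h : (PreOperad.hadamard Mon FF).evalAt genFrac n t =
      (PreOperad.hadamard Mon FF).evalAt genFrac n u) :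
    PreOperad.Cong (freeBinary Gen6) Rel16 n t u := by
  obtain ⟨h1, h2⟩ := evalAt_genFrac t.1 n t.2
  obtain ⟨k1, k2⟩ := evalAt_genFrac u.1 n u.2
  have e : ofBTree t.1 = ofBTree u.1 :=
    (isTree_ofBTree t.1).eq_of_frac_eq (isTree_ofBTree u.1)
      (by rw [size_ofBTree, size_ofBTree, t.2, u.2])
      (by rw [← h1, ← k1]; exact congrArg (fun z => z.1.1) h)
      (by rw [← h2, ← k2]; exact congrArg (fun z => z.2.1) h)
  obtain ⟨m, h3, h4, c⟩ := CongTree.of_ofBTree_eq e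
  obtain rfl : n = m := t.2.symm.trans h3
  exact c

theorem evalAt_eq_of_cong {n : ℕ} {t u : (freeBinary Gen6).Op n}
    (h : PreOperad.Cong (freeBinary Gen6) Rel16 n t u) :
    (PreOperad.hadamard Mon FF).evalAt genFrac n t =
      (PreOperad.hadamard Mon FF).evalAt genFrac n u := by
  induction h with
  | of h =>
    obtain ⟨a, b, c, d, h⟩ := h
    exact evalAt_eq_of_ofBTree_eq (ofBTree_rel h)
  | refl => rfl
  | symm _ ih => exact ih.symm
  | trans _ _ ih ih' => exact ih.trans ih'
  | circ h i hi _ _ iha ihb =>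
    have := (hadamard_isOperad.evalHom genFrac).map_circ h i hi
    exact (this _ _).trans (Eq.trans (congrArg₂ _ iha ihb) (this _ _).symm)

end PWord

/-- The morphism from the presented operad to fractions. -/
noncomputable def GR6.evalHom : PreOperad.Hom GR6 (PreOperad.hadamard Mon FF) where
  app n := Quotient.lift ((PreOperad.hadamard Mon FF).evalAt genFrac n)
    fun _ _ h => PWord.evalAt_eq_of_cong h
  map_one := rfl
  map_circ h i hi a b := by
    induction a, b using Quotient.inductionOn₂ with
    | _ t u => exact (hadamard_isOperad.evalHom genFrac).map_circ h i hi t u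

theorem GR6.evalHom_injective (n : ℕ) : Function.Injective (GR6.evalHom.app n) := by
  intro a b h
  induction a, b using Quotient.inductionOn₂ with
  | _ t u => exact Quotient.sound (PWord.evalAt_injective h)

theorem GR6.evalHom_gen (g : Gen6) : GR6.evalHom.app 2 (gr6Gen g) = genFrac g :=
  hadamard_isOperad.evalAt_freeGen genFrac g

/-! ### Every recursively labelled tree is planar up to the order of the children -/

namespace RTree

theorem Same.shape {t t' : RTree} (h : Same t t') : t.rootLabels = t'.rootLabels ∧
    t.plain.length = t'.plain.length ∧ t.dotted.length = t'.dotted.length := by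
  induction h with
  | refl t => exact ⟨rfl, rfl, rfl⟩
  | symm _ ih => exact ⟨ih.1.symm, ih.2.1.symm, ih.2.2.symm⟩
  | trans _ _ ih ih' =>
    exact ⟨ih.1.trans ih'.1, ih.2.1.trans ih'.2.1, ih.2.2.trans ih'.2.2⟩
  | perm L hp hd => exact ⟨rfl, hp.length_eq, hd.length_eq⟩
  | plain L p d _ _ => simp [rootLabels, RTree.plain, RTree.dotted]
  | dotted L p d _ _ => simp [rootLabels, RTree.plain, RTree.dotted]

theorem Same.insert (x : ℕ) {t t' : RTree} (h : Same t t') :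
    Same (node (insert x t.rootLabels) t.plain t.dotted)
      (node (Insert.insert x t'.rootLabels) t'.plain t'.dotted) :=
  Same.merge {x} [] [] h

theorem Same.cons_plain {s s' t t' : RTree} (hs : Same s s') (h : Same t t') :
    Same (node t.rootLabels (s :: t.plain) t.dotted)
      (node t'.rootLabels (s' :: t'.plain) t'.dotted) := by
  have := Same.merge ∅ [s] [] h
  simp only [Finset.empty_union, List.singleton_append, List.nil_append] at this
  exact this.trans (.plain _ _ _ hs)

theorem Same.cons_dotted {s s' t t' : RTree} (hs : Same s s') (h : Same t t') :
    Same (node t.rootLabels t.plain (s :: t.dotted))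
      (node t'.rootLabels t'.plain (s' :: t'.dotted)) := by
  have := Same.merge ∅ [] [s] h
  simp only [Finset.empty_union, List.singleton_append, List.nil_append] at this
  exact this.trans (.dotted _ _ _ hs)

end RTree

namespace PWord

open RTree

theorem noDot_of_dotted_eq_nil {a : ℕ} {w : PWord} (h : (toRTree a w).dotted = []) :
    w.noDot = true := by
  induction w generalizing a with
  | nil => rfl
  | lab w ih => exact ih (a := a + 1) h
  | sub b c w _ ih =>
    cases b with
    | false => exact ih (a := a + c.size) h
    | true => simp [toRTree, dotted] at h

/-- A tree on an interval of labels is a planar tree. -/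
def IsPlanar (t : RTree) : Prop :=
  ∀ a n, allLabels t = Multiset.Ico a (a + n) →
    ∃ w, IsTree w ∧ w.size = n ∧ Same t (toRTree a w)

/-- The first child of a node: its labels form an initial interval. -/
theorem allLabels_eq_Ico {t : RTree} (h : IsRecursive t) {a n : ℕ} {m : Multiset ℕ}
    (hm : allLabels t + m = Multiset.Ico a (a + n)) (ha : a ∈ allLabels t) :
    ∃ s, 0 < s ∧ s ≤ n ∧ allLabels t = Multiset.Ico a (a + s) ∧
      m = Multiset.Ico (a + s) (a + s + (n - s)) := by
  have hnd : (allLabels t).Nodup := by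
    have : (allLabels t + m).Nodup := hm ▸ Multiset.nodup_Ico
    exact (Multiset.nodup_add.1 this).1
  have hint : ∃ u v, (allLabels t).toFinset = Finset.Icc u v := by
    cases h with
    | node L p d h _ _ => exact h
  obtain ⟨u, v, huv⟩ := hint
  have hmem : ∀ j, j ∈ allLabels t ↔ u ≤ j ∧ j ≤ v := by
    intro j
    rw [← Multiset.mem_toFinset, huv, Finset.mem_Icc]
  have hle : ∀ j, j ∈ allLabels t → a ≤ j ∧ j < a + n := by
    intro j hj
    have : j ∈ allLabels t + m := Multiset.mem_add.2 (.inl hj)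
    rwa [hm, Multiset.mem_Ico] at this
  have ha' := (hmem a).1 ha
  have hu := hle u ((hmem u).2 ⟨le_rfl, by omega⟩)
  have hv := hle v ((hmem v).2 ⟨by omega, le_rfl⟩)
  have ht : allLabels t = Multiset.Ico a (a + (v + 1 - a)) := by
    refine (Multiset.Nodup.ext hnd Multiset.nodup_Ico).2 fun j => ?_
    rw [hmem, Multiset.mem_Ico]
    omega
  refine ⟨v + 1 - a, by omega, by omega, ht, ?_⟩
  rw [ht, show a + n = a + (v + 1 - a) + (n - (v + 1 - a)) by omega,
    ← Multiset.Ico_add_Ico_eq_Ico (b := a + (v + 1 - a))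
      (c := a + (v + 1 - a) + (n - (v + 1 - a))) (by omega) (by omega)] at hm
  exact add_left_cancel hm

/-- Induction on the number of labels. The smallest label `a` belongs either to the node or to one
child, whose labels form an interval starting at `a`; that item is the first letter of the word, and
it is removed. The conditions on the node itself are left out because they do not survive the
removal. -/
theorem exists_toRTree_same (n : ℕ) : ∀ (a : ℕ) (L : Finset ℕ) (p d : List RTree),
    (∀ t ∈ p, (IsRedWhite t ∧ IsRecursive t) ∧ IsPlanar t) →
    (∀ t ∈ d, ((IsRedWhite t ∧ IsRecursive t) ∧ IsPlanar t) ∧ ¬ t.isRed = true) →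
    allLabels (.node L p d) = Multiset.Ico a (a + n) →
    ∃ w, Ok w ∧ w.size = n ∧ Same (.node L p d) (toRTree a w) := by
  induction n using Nat.strong_induction_on with
  | _ n ih =>
    intro a L p d hp hd hl
    rcases Nat.eq_zero_or_pos n with rfl | hn
    -- Every child contains a label, so without labels there are no children either.
    · have hl0 : allLabels (.node L p d) = 0 := by simpa using hl
      have hL : L = ∅ := by
        rw [allLabels, add_eq_zero, Finset.val_eq_zero] at hl0
        exact hl0.1
      have hnone : ∀ t, t ∈ p ∨ t ∈ d → ¬ IsRedWhite t := by
        intro t ht hrw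
        obtain ⟨j, hj⟩ := hrw.desc_nonempty
        have := desc_subset_of_mem (L := L) ht hj
        rw [desc, hl0] at this
        simp at this
      have hp0 : p = [] := List.eq_nil_iff_forall_not_mem.2 fun t ht =>
        hnone t (.inl ht) (hp t ht).1.1
      have hd0 : d = [] := List.eq_nil_iff_forall_not_mem.2 fun t ht =>
        hnone t (.inr ht) (hd t ht).1.1.1
      subst hL hp0 hd0
      exact ⟨nil, trivial, rfl, .refl _⟩
    · have ha : a ∈ allLabels (.node L p d) := by
        rw [hl, Multiset.mem_Ico]
        omega
      rw [allLabels, Multiset.mem_add, Multiset.mem_add, mem_forestLabels, mem_forestLabels] at ha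
      rcases ha with ha | ⟨t, ht, ha⟩ | ⟨t, ht, ha⟩
      · have ha' : a ∈ L := ha
        have e : allLabels (.node (L.erase a) p d) = Multiset.Ico (a + 1) (a + 1 + (n - 1)) := by
          have h1 : ({a} : Multiset ℕ) + allLabels (.node (L.erase a) p d) =
              allLabels (.node L p d) := by
            rw [allLabels, allLabels, Finset.erase_val, ← add_assoc, Multiset.singleton_add,
              Multiset.cons_erase ha]
          have h2 : ({a} : Multiset ℕ) = Multiset.Ico a (a + 1) :=
            congrArg Finset.val (show {a} = Finset.Ico a (a + 1) by
              ext j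
              simp only [Finset.mem_singleton, Finset.mem_Ico]
              omega)
          rw [hl, h2, show a + n = a + 1 + (n - 1) by omega,
            ← Multiset.Ico_add_Ico_eq_Ico (b := a + 1) (c := a + 1 + (n - 1)) (by omega)
              (by omega)] at h1
          exact add_left_cancel h1
        obtain ⟨w, hw, hs, hS⟩ := ih (n - 1) (by omega) _ _ p d hp hd e
        refine ⟨lab w, hw, by simp only [size]; omega, ?_⟩
        have := hS.insert a
        simp only [rootLabels, plain, dotted, Finset.insert_erase ha'] at this
        exact this
      · obtain ⟨p₁, p₂, rfl⟩ := List.append_of_mem ht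
        obtain ⟨⟨ht1, ht2⟩, ht3⟩ := hp t ht
        have e : allLabels t + allLabels (.node L (p₁ ++ p₂) d) = Multiset.Ico a (a + n) := by
          rw [← hl]
          simp only [allLabels, forestLabels_append, forestLabels]
          abel
        obtain ⟨s, hs0, hsn, e1, e2⟩ := allLabels_eq_Ico ht2 e ha
        obtain ⟨c, hc, hcs, hcS⟩ := ht3 a s e1
        obtain ⟨w, hw, hs, hS⟩ := ih (n - s) (by omega) _ _ (p₁ ++ p₂) d
          (fun u hu => hp u (by
            simp only [List.mem_append, List.mem_cons] at hu ⊢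
            tauto)) hd e2
        refine ⟨sub false c w, ⟨⟨hc.1, hc.2, by simp⟩, hw⟩, by simp only [size]; omega, ?_⟩
        rw [← hcs] at hS
        exact (Same.perm L List.perm_middle (.refl d)).trans (Same.cons_plain hcS hS)
      · obtain ⟨d₁, d₂, rfl⟩ := List.append_of_mem ht
        obtain ⟨⟨⟨ht1, ht2⟩, ht3⟩, ht4⟩ := hd t ht
        have e : allLabels t + allLabels (.node L p (d₁ ++ d₂)) = Multiset.Ico a (a + n) := by
          rw [← hl]
          simp only [allLabels, forestLabels_append, forestLabels]
          abel
        obtain ⟨s, hs0, hsn, e1, e2⟩ := allLabels_eq_Ico ht2 e ha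
        obtain ⟨c, hc, hcs, hcS⟩ := ht3 a s e1
        obtain ⟨w, hw, hs, hS⟩ := ih (n - s) (by omega) _ _ p (d₁ ++ d₂) hp
          (fun u hu => hd u (by
            simp only [List.mem_append, List.mem_cons] at hu ⊢
            tauto)) e2
        refine ⟨sub true c w, ⟨⟨hc.1, hc.2, fun _ => ?_⟩, hw⟩, by simp only [size]; omega, ?_⟩
        · rw [← isRed_toRTree a c, ← hcS.isRed_eq]
          simpa using ht4
        · rw [← hcs] at hS
          exact (Same.perm L (.refl p) List.perm_middle).trans (Same.cons_dotted hcS hS)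

theorem isPlanar (t : RTree) : IsRedWhite t → IsRecursive t → IsPlanar t := by
  induction t using RTree.ind with
  | h L p d hp hd =>
    intro h1 h2 a n hl
    have hrw := h1
    cases h1 with
    | node _ _ _ k1 k2 k3 k4 k5 =>
      cases h2 with
      | node _ _ _ _ r1 r2 =>
        obtain ⟨w, hw, hs, hS⟩ := exists_toRTree_same n a L p d
          (fun t ht => ⟨⟨k4 t ht, r1 t ht⟩, hp t ht (k4 t ht) (r1 t ht)⟩)
          (fun t ht => ⟨⟨⟨k5 t ht, r2 t ht⟩, hd t ht (k5 t ht) (r2 t ht)⟩, k3 t ht⟩) hl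
        refine ⟨w, ⟨hw, ?_, ?_, ?_⟩, hs, hS⟩
        · rintro rfl
          refine hrw.allLabels_ne_zero ?_
          rw [hl, ← hs]
          simp [size]
        -- The node would have no label and only one child.
        · rintro b c rfl
          obtain ⟨s1, s2, s3⟩ := hS.shape
          cases b <;>
          · simp only [toRTree, rootLabels, plain, dotted, List.length_cons,
              List.length_nil] at s1 s2 s3
            have := k1 s1
            omega
        · intro hr
          refine noDot_of_dotted_eq_nil (a := a) (List.length_eq_zero_iff.1 ?_)
          have hd0 := k2 (by rw [hS.isRed_eq, isRed_toRTree, hr])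
          rw [← hS.shape.2.2, dotted, hd0]
          rfl

theorem exists_toRTree {n : ℕ} {t : RTree} (h : IsRWTree n t) :
    ∃ w, IsTree w ∧ w.size = n ∧ Same t (toRTree 1 w) := by
  refine isPlanar t h.redWhite h.recursive 1 n ?_
  rw [h.labels]
  refine (Multiset.Nodup.ext (Finset.nodup _) Multiset.nodup_Ico).2 fun j => ?_
  rw [Finset.mem_val, Finset.mem_Icc, Multiset.mem_Ico]
  omega

-- Planar trees as representatives in `RW6`.

/-- Planar trees with `n` labels. -/
abbrev Tree (n : ℕ) : Type := {w : PWord // IsTree w ∧ w.size = n}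

/-- The class of the tree of a planar tree. -/
def toRW6 {n : ℕ} (w : Tree n) : RW6.Op n :=
  Quotient.mk _ ⟨toRTree 1 w.1, by
    have := isRWTree_toRTree w.2.1
    rwa [w.2.2] at this⟩

theorem toRW6_surjective (n : ℕ) : Function.Surjective (toRW6 : Tree n → RW6.Op n) := by
  intro a
  induction a using Quotient.inductionOn with
  | _ t =>
    obtain ⟨w, hw, hs, hS⟩ := exists_toRTree t.2
    exact ⟨⟨w, hw, hs⟩, Quotient.sound hS.symm⟩

theorem valueHom_toRW6_injective (n : ℕ) :
    Function.Injective fun w : Tree n => valueHom.app n (toRW6 w) := by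
  intro w w' h
  refine Subtype.ext (w.2.1.eq_of_frac_eq w'.2.1 (w.2.2.trans w'.2.2.symm) ?_ ?_)
  · exact congrArg (fun z => z.1.1) h
  · exact congrArg (fun z => z.2.1) h

/-- Planar trees with different classes are separated by their values, so `Same` never has to be
analysed directly. -/
theorem toRW6_bijective (n : ℕ) : Function.Bijective (toRW6 : Tree n → RW6.Op n) :=
  ⟨fun _ _ h => valueHom_toRW6_injective n (congrArg (valueHom.app n) h), toRW6_surjective n⟩

theorem valueHom_injective (n : ℕ) : Function.Injective (valueHom.app n) := by
  intro a b h
  obtain ⟨w, rfl⟩ := toRW6_surjective n a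
  obtain ⟨w', rfl⟩ := toRW6_surjective n b
  rw [valueHom_toRW6_injective n h]

theorem evalHom_eq_valueHom {n : ℕ} {t : (freeBinary Gen6).Op n} {w : Tree n}
    (h : ofBTree t.1 = w.1) :
    (PreOperad.hadamard Mon FF).evalAt genFrac n t = valueHom.app n (toRW6 w) := by
  obtain ⟨h1, h2⟩ := evalAt_genFrac t.1 n t.2
  rw [h] at h1 h2
  exact Prod.ext (Subtype.ext h1) (Subtype.ext h2)

end PWord

-- The two isomorphisms.

open PWord in
-- Both images consist of the values of planar trees: `ofBTree` and `toBTree` pass from one source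
-- to the other without changing the value.
theorem exists_iso_GR6_RW6 : ∃ e : PreOperad.Iso GR6 RW6,
    ∀ n a, RTree.valueHom.app n (e.equiv n a) = GR6.evalHom.app n a := by
  refine GR6.evalHom.exists_iso RTree.valueHom GR6.evalHom_injective valueHom_injective ?_ ?_
  · intro n a
    induction a using Quotient.inductionOn with
    | _ t =>
      have hw : IsTree (ofBTree t.1) ∧ (ofBTree t.1).size = n :=
        ⟨isTree_ofBTree t.1, (size_ofBTree t.1).trans t.2⟩
      exact ⟨toRW6 ⟨_, hw⟩, (evalHom_eq_valueHom (w := ⟨_, hw⟩) rfl).symm⟩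
  · intro n b
    obtain ⟨w, rfl⟩ := toRW6_surjective n b
    have e := ofBTree_toBTree w.2.1
    have hl : (toBTree w.1).leaves = n := by
      rw [← size_ofBTree, e, w.2.2]
    exact ⟨Quotient.mk _ ⟨toBTree w.1, hl⟩, evalHom_eq_valueHom (t := ⟨toBTree w.1, hl⟩) e⟩

theorem exists_iso_GR6_FF6 : ∃ e : PreOperad.Iso GR6 FF6,
    ∀ n a, (e.equiv n a).1 = GR6.evalHom.app n a := by
  refine GR6.evalHom.exists_iso (PreOperad.generatedByHom (PreOperad.hadamard Mon FF) _)
    GR6.evalHom_injective (fun _ => Subtype.val_injective) ?_ ?_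
  · intro n a
    induction a using Quotient.inductionOn with
    | _ t => exact ⟨⟨_, PreOperad.generated_evalAt genFrac (fun g => .mk g) t⟩, rfl⟩
  · intro n b
    obtain ⟨t, ht⟩ := PreOperad.Generated.exists_evalAt hadamard_isOperad genFrac
      (S := fun n => {a | IsGenFrac n a}) (by
        rintro n a ⟨g⟩
        exact ⟨freeGen g, hadamard_isOperad.evalAt_freeGen genFrac g⟩) b.2
    exact ⟨Quotient.mk _ t, ht⟩

/-! ### Generating series -/

/-- The generating series of the numbers of elements of each size in a set. -/
noncomputable def genSeries {α : Type} (sz : α → ℕ) (S : Set α) : PowerSeries ℤ :=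
  PowerSeries.mk fun n => ({a ∈ S | sz a = n}.ncard : ℤ)

/-- There are finitely many elements of each size. -/
def FiniteFibers {α : Type} (sz : α → ℕ) (S : Set α) : Prop := ∀ n, {a ∈ S | sz a = n}.Finite

section genSeries

variable {α β : Type} {sz : α → ℕ} {sz' : β → ℕ} {S T : Set α} {U : Set β}

theorem FiniteFibers.mono (h : FiniteFibers sz T) (hS : S ⊆ T) : FiniteFibers sz S :=
  fun n => (h n).subset fun _ ha => ⟨hS ha.1, ha.2⟩

/-- Finiteness of the fibres matters because `Set.ncard` is `0` on infinite sets. -/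
theorem genSeries_union (h : FiniteFibers sz (S ∪ T)) (hd : Disjoint S T) :
    genSeries sz (S ∪ T) = genSeries sz S + genSeries sz T := by
  ext n
  simp only [genSeries, PowerSeries.coeff_mk, map_add]
  rw [← Nat.cast_add, ← Set.ncard_union_eq
    (Set.disjoint_left.2 fun a ha ha' => Set.disjoint_left.1 hd ha.1 ha'.1)
    (h.mono Set.subset_union_left n) (h.mono Set.subset_union_right n)]
  congr 2
  ext a
  simp only [Set.mem_ofPred_eq, Set.mem_union]
  tauto

theorem genSeries_image (f : α → β) (hf : Function.Injective f) (hsz : ∀ a, sz' (f a) = sz a) :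
    genSeries sz' (f '' S) = genSeries sz S := by
  ext n
  simp only [genSeries, PowerSeries.coeff_mk]
  rw [← Set.ncard_image_of_injective _ hf]
  congr 2
  ext b
  simp only [Set.mem_ofPred_eq, Set.mem_image]
  constructor
  · rintro ⟨⟨a, ha, rfl⟩, h⟩
    exact ⟨a, ⟨ha, hsz a ▸ h⟩, rfl⟩
  · rintro ⟨a, ⟨ha, h⟩, rfl⟩
    exact ⟨⟨a, ha, rfl⟩, (hsz a).trans h⟩

theorem genSeries_image_succ (f : α → β) (hf : Function.Injective f)
    (hsz : ∀ a, sz' (f a) = sz a + 1) :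
    genSeries sz' (f '' S) = PowerSeries.X * genSeries sz S := by
  ext n
  rcases n with _ | n
  · simp only [genSeries, PowerSeries.coeff_mk, PowerSeries.coeff_zero_X_mul, Nat.cast_eq_zero]
    rw [Set.eq_empty_of_forall_notMem (s := {b ∈ f '' S | sz' b = 0}), Set.ncard_empty]
    rintro _ ⟨⟨a, _, rfl⟩, h⟩
    rw [hsz] at h
    omega
  · simp only [genSeries, PowerSeries.coeff_mk, PowerSeries.coeff_succ_X_mul]
    rw [← Set.ncard_image_of_injective _ hf]
    congr 2
    ext b
    simp only [Set.mem_ofPred_eq, Set.mem_image]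
    constructor
    · rintro ⟨⟨a, ha, rfl⟩, h⟩
      exact ⟨a, ⟨ha, by rw [hsz] at h; omega⟩, rfl⟩
    · rintro ⟨a, ⟨ha, h⟩, rfl⟩
      exact ⟨⟨a, ha, rfl⟩, by rw [hsz, h]⟩

theorem genSeries_prod (hS : FiniteFibers sz S) (hU : FiniteFibers sz' U) :
    genSeries (fun p : α × β => sz p.1 + sz' p.2) (S ×ˢ U) = genSeries sz S * genSeries sz' U := by
  classical
  ext n
  rw [PowerSeries.coeff_mul]
  simp only [genSeries, PowerSeries.coeff_mk]
  have e : {p ∈ S ×ˢ U | sz p.1 + sz' p.2 = n} =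
      ↑((Finset.HasAntidiagonal.antidiagonal n).biUnion fun q =>
        (hS q.1).toFinset ×ˢ (hU q.2).toFinset) := by
    ext p
    simp only [Set.mem_ofPred_eq, Set.mem_prod, Finset.coe_biUnion, Set.mem_iUnion, Finset.mem_coe,
      Finset.mem_product, Set.Finite.mem_toFinset,
      Finset.HasAntidiagonal.mem_antidiagonal, exists_prop]
    constructor
    · rintro ⟨⟨h1, h2⟩, h⟩
      exact ⟨(sz p.1, sz' p.2), h, ⟨h1, rfl⟩, h2, rfl⟩
    · rintro ⟨q, h, ⟨h1, h2⟩, h3, h4⟩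
      exact ⟨⟨h1, h3⟩, by rw [h2, h4, h]⟩
  rw [e, Set.ncard_coe_finset, Finset.card_biUnion, Nat.cast_sum]
  · refine Finset.sum_congr rfl fun q _ => ?_
    rw [Finset.card_product, Nat.cast_mul, Set.ncard_eq_toFinset_card _ (hS q.1),
      Set.ncard_eq_toFinset_card _ (hU q.2)]
  · intro q _ q' _ hne
    refine Finset.disjoint_left.2 fun p hp hp' => hne ?_
    simp only [Finset.mem_product, Set.Finite.mem_toFinset, Set.mem_ofPred_eq] at hp hp'
    exact Prod.ext (hp.1.2.symm.trans hp'.1.2) (hp.2.2.symm.trans hp'.2.2)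

end genSeries

-- Finiteness.

instance : Fintype Gen6 :=
  ⟨{.prec, .succ, .mid, .odot, .ll, .gg}, fun g => by cases g <;> decide⟩

theorem BTree.finite_leaves_le {G : Type} [Finite G] (n : ℕ) :
    {t : BTree G | t.leaves ≤ n}.Finite := by
  induction n with
  | zero =>
    refine Set.Finite.subset Set.finite_empty fun t ht => ?_
    have := t.leaves_pos
    simp only [Set.mem_ofPred_eq] at ht
    omega
  | succ n ih =>
    refine ((Set.finite_singleton BTree.leaf).union
      (Set.finite_iUnion fun g : G => ih.image2 (BTree.node g) ih)).subset fun t ht => ?_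
    rcases t with _ | ⟨g, l, r⟩
    · exact .inl rfl
    · have hl := l.leaves_pos
      have hr := r.leaves_pos
      simp only [Set.mem_ofPred_eq, BTree.leaves] at ht
      refine .inr (Set.mem_iUnion.2 ⟨g, Set.mem_image2_of_mem ?_ ?_⟩) <;>
      · simp only [Set.mem_ofPred_eq]
        omega

namespace PWord

/-- A label in front makes any word white, so that `toBTree` can be inverted on it. Words of size
`n` are thus embedded in the finite set of binary trees with at most `n + 1` leaves. -/
theorem finiteFibers_ok : FiniteFibers size {w | Ok w} := by
  intro n
  have key : ∀ w, Ok w → asWord (ofBTree (toBTree (lab w))) = lab w :=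
    fun w hw => asWord_ofBTree_toBTree (w := lab w) hw rfl
  refine Set.Finite.of_injOn (f := fun w => toBTree (lab w)) ?_ ?_
    (BTree.finite_leaves_le (n + 1))
  · rintro w ⟨hw, hs⟩
    rw [Set.mem_ofPred_eq, ← size_ofBTree, ← size_asWord, key w hw, size, hs]
  · rintro w ⟨hw, -⟩ w' ⟨hw', -⟩ h
    have := key w hw
    rw [show toBTree (lab w) = toBTree (lab w') from h, key w' hw'] at this
    exact (lab.inj this).symm

-- Decompositions of planar words and the functional equation.

/-- White trees. -/
def whites : Set PWord := {w | IsTree w ∧ w.isRed = false}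
/-- Red trees. -/
def reds : Set PWord := {w | IsTree w ∧ w.isRed = true}
/-- Words of white children. -/
def coreless : Set PWord := {w | Ok w ∧ w.isRed = true}
/-- Words with a label or a red child. -/
def cores : Set PWord := {w | Ok w ∧ w.isRed = false}
/-- Non-empty words of white children through plain edges. -/
def plains : Set PWord := {w | Ok w ∧ w.isRed = true ∧ w.noDot = true ∧ w ≠ nil}

theorem fin_whites : FiniteFibers size whites := finiteFibers_ok.mono fun _ h => h.1.1
theorem fin_reds : FiniteFibers size reds := finiteFibers_ok.mono fun _ h => h.1.1
theorem fin_coreless : FiniteFibers size coreless := finiteFibers_ok.mono fun _ h => h.1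
theorem fin_cores : FiniteFibers size cores := finiteFibers_ok.mono fun _ h => h.1
theorem fin_plains : FiniteFibers size plains := finiteFibers_ok.mono fun _ h => h.1

/-- Words whose first item is a child in `S`, followed by a word in `T`. -/
def subs (b : Bool) (S T : Set PWord) : Set PWord :=
  (fun p : PWord × PWord => sub b p.1 p.2) '' (S ×ˢ T)

theorem sub_mem_subs {b b' : Bool} {S T : Set PWord} {c w : PWord} :
    sub b' c w ∈ subs b S T ↔ b = b' ∧ c ∈ S ∧ w ∈ T := by
  simp only [subs, Set.mem_image, Prod.exists, Set.mem_prod, sub.injEq]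
  constructor
  · rintro ⟨_, _, ⟨h1, h2⟩, rfl, rfl, rfl⟩
    exact ⟨rfl, h1, h2⟩
  · rintro ⟨rfl, h1, h2⟩
    exact ⟨_, _, ⟨h1, h2⟩, rfl, rfl, rfl⟩

theorem nil_notMem_subs {b : Bool} {S T : Set PWord} : nil ∉ subs b S T := by
  simp [subs]

theorem lab_notMem_subs {b : Bool} {S T : Set PWord} {w : PWord} : lab w ∉ subs b S T := by
  simp [subs]

theorem genSeries_subs {b : Bool} {S T : Set PWord} (hS : FiniteFibers size S)
    (hT : FiniteFibers size T) :
    genSeries size (subs b S T) = genSeries size S * genSeries size T := by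
  rw [subs, ← genSeries_prod hS hT]
  refine genSeries_image _ ?_ fun _ => rfl
  rintro ⟨c, w⟩ ⟨c', w'⟩ h
  simpa using h

theorem genSeries_nil : genSeries size {nil} = 1 := by
  ext n
  rw [genSeries, PowerSeries.coeff_mk, PowerSeries.coeff_one]
  split_ifs with h
  · rw [Nat.cast_eq_one, Set.ncard_eq_one]
    exact ⟨nil, Set.Subset.antisymm (fun w hw => hw.1) fun w hw => ⟨hw, by rw [hw, h]; rfl⟩⟩
  · rw [Nat.cast_eq_zero, Set.ncard_eq_zero ((Set.finite_singleton nil).subset fun _ h => h.1)]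
    refine Set.eq_empty_of_forall_notMem ?_
    rintro _ ⟨rfl, h'⟩
    exact h h'.symm

theorem finiteFibers_nil : FiniteFibers size {nil} := fun _ =>
  (Set.finite_singleton nil).subset fun _ h => h.1

/-- The tail is non-empty because a red tree has at least two children. -/
theorem reds_eq : reds = subs false whites plains := by
  ext w
  rcases w with _ | w | ⟨b, c, w⟩
  · simp only [nil_notMem_subs, iff_false]
    exact fun h => h.1.2.ne_nil rfl
  · simp only [lab_notMem_subs, iff_false]
    exact fun h => by simpa [isRed] using h.2
  · rw [sub_mem_subs]
    constructor
    · rintro ⟨⟨⟨h1, h2⟩, h3⟩, h4⟩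
      have hd := h3.noDot h4
      simp only [isRed, Bool.and_eq_true, Bool.not_eq_true'] at h4
      simp only [noDot, Bool.and_eq_true, Bool.not_eq_true'] at hd
      refine ⟨hd.1.symm, ⟨⟨h1.1, h1.2.1⟩, h4.1⟩, h2, h4.2, hd.2, ?_⟩
      rintro rfl
      exact h3.ne_single _ _ rfl
    · rintro ⟨rfl, ⟨⟨h1, h2⟩, h3⟩, h4, h5, h6, h7⟩
      refine ⟨⟨⟨⟨h1, h2, by simp⟩, h4⟩, by simp, fun b d h => h7 ?_, fun _ => ?_⟩, ?_⟩
      · simp only [sub.injEq] at h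
        exact h.2.2
      · simp [noDot, h6]
      · simp [isRed, h3, h5]

theorem plains_eq : plains = subs false whites {nil} ∪ reds := by
  ext w
  constructor
  · rintro ⟨h1, h2, h3, h4⟩
    by_cases hs : ∃ b c, w = sub b c nil
    · obtain ⟨b, c, rfl⟩ := hs
      simp only [isRed, Bool.and_eq_true, Bool.not_eq_true'] at h2
      simp only [noDot, Bool.and_eq_true, Bool.not_eq_true'] at h3
      exact .inl (sub_mem_subs.2 ⟨h3.1.symm, ⟨⟨h1.1.1, h1.1.2.1⟩, h2.1⟩, rfl⟩)
    · push Not at hs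
      exact .inr ⟨⟨h1, h4, hs, fun _ => h3⟩, h2⟩
  · rintro (h | ⟨⟨h1, h2⟩, h3⟩)
    · rcases w with _ | w | ⟨b, c, w⟩
      · exact absurd h nil_notMem_subs
      · exact absurd h lab_notMem_subs
      · obtain ⟨rfl, ⟨⟨h1, h2⟩, h3⟩, rfl⟩ := sub_mem_subs.1 h
        exact ⟨⟨⟨h1, h2, by simp⟩, trivial⟩, by simp [isRed, h3], by simp [noDot], by simp⟩
    · exact ⟨h1, h3, h2.noDot h3, h2.ne_nil⟩

/-- The shape of a tree excludes only single children among these words, and a single child with a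
core is red, with a plain edge. Together with `cores_eq` the same set is counted twice, which closes
the system of equations. -/
theorem cores_eq_single : cores = subs false reds {nil} ∪ whites := by
  ext w
  constructor
  · rintro ⟨h1, h2⟩
    by_cases hs : ∃ b c, w = sub b c nil
    · obtain ⟨b, c, rfl⟩ := hs
      have hc : c.isRed = true := by simpa [isRed] using h2
      have hb : b = false := by
        cases b with
        | false => rfl
        | true => simpa [hc] using h1.1.2.2
      exact .inl (sub_mem_subs.2 ⟨hb.symm, ⟨⟨h1.1.1, h1.1.2.1⟩, hc⟩, rfl⟩)
    · push Not at hs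
      exact .inr ⟨⟨h1, ne_nil_of_not_red h2, hs, fun h => by simp [h2] at h⟩, h2⟩
  · rintro (h | ⟨⟨h1, h2⟩, h3⟩)
    · rcases w with _ | w | ⟨b, c, w⟩
      · exact absurd h nil_notMem_subs
      · exact absurd h lab_notMem_subs
      · obtain ⟨rfl, ⟨⟨h1, h2⟩, h3⟩, rfl⟩ := sub_mem_subs.1 h
        exact ⟨⟨⟨h1, h2, by simp⟩, trivial⟩, by simp [isRed, h3]⟩
    · exact ⟨h1, h3⟩

theorem coreless_eq : coreless = {nil} ∪ (subs false whites coreless ∪ subs true whites coreless) := by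
  ext w
  rcases w with _ | w | ⟨b, c, w⟩
  · simp [coreless, Ok, isRed]
  · simp [coreless, isRed, lab_notMem_subs]
  · simp only [coreless, whites, Set.mem_union, sub_mem_subs, Set.mem_ofPred_eq, Ok, isRed, IsTree,
      Bool.and_eq_true, Bool.not_eq_true', Set.mem_singleton_iff, reduceCtorEq, false_or]
    cases b <;> simp <;> tauto

/-- After a label or a red child any word may follow; after a white child, through either kind of
edge, the tail must still contain a core. -/
theorem cores_eq : cores = lab '' (coreless ∪ cores) ∪ (subs false reds (coreless ∪ cores) ∪
    (subs false whites cores ∪ subs true whites cores)) := by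
  ext w
  rcases w with _ | w | ⟨b, c, w⟩
  · simp [cores, isRed, nil_notMem_subs]
  · simp only [cores, coreless, Set.mem_union, Set.mem_image, lab_notMem_subs, or_false,
      Set.mem_ofPred_eq, Ok, isRed, lab.injEq, exists_eq_right]
    cases w.isRed <;> simp
  · simp only [cores, coreless, whites, reds, Set.mem_union, Set.mem_image, sub_mem_subs,
      Set.mem_ofPred_eq, Ok, isRed, IsTree, reduceCtorEq, and_false, exists_false, false_or]
    cases b <;> cases c.isRed <;> cases w.isRed <;> simp

theorem subs_disjoint {b b' : Bool} {S T S' T' : Set PWord} (h : b ≠ b' ∨ Disjoint S S') :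
    Disjoint (subs b S T) (subs b' S' T') := by
  refine Set.disjoint_left.2 fun w hw hw' => ?_
  rcases w with _ | w | ⟨d, c, w⟩
  · exact nil_notMem_subs hw
  · exact lab_notMem_subs hw
  · obtain ⟨rfl, h1, -⟩ := sub_mem_subs.1 hw
    obtain ⟨rfl, h2, -⟩ := sub_mem_subs.1 hw'
    rcases h with h | h
    · exact h rfl
    · exact Set.disjoint_left.1 h h1 h2

theorem reds_disjoint_whites : Disjoint reds whites :=
  Set.disjoint_left.2 fun _ h h' => absurd h'.2 (by simp [h.2])

theorem coreless_disjoint_cores : Disjoint coreless cores :=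
  Set.disjoint_left.2 fun _ h h' => absurd h'.2 (by simp [h.2])

theorem genSeries_reds :
    genSeries size reds = genSeries size whites * genSeries size plains := by
  conv_lhs => rw [reds_eq]
  exact genSeries_subs fin_whites fin_plains

theorem subs_nil_disjoint {S T : Set PWord} (hT : ∀ w ∈ T, IsTree w) :
    Disjoint (subs false S {nil}) T := by
  refine Set.disjoint_left.2 fun w hw hw' => ?_
  rcases w with _ | w | ⟨d, c, w⟩
  · exact nil_notMem_subs hw
  · exact lab_notMem_subs hw
  · obtain ⟨-, -, rfl⟩ := sub_mem_subs.1 hw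
    exact (hT _ hw').2.ne_single _ _ rfl

theorem genSeries_plains :
    genSeries size plains = genSeries size whites + genSeries size reds := by
  have h := fin_plains
  rw [plains_eq] at h ⊢
  rw [genSeries_union h (subs_nil_disjoint fun _ h => h.1),
    genSeries_subs fin_whites finiteFibers_nil, genSeries_nil, mul_one]

theorem genSeries_cores_single :
    genSeries size cores = genSeries size reds + genSeries size whites := by
  have h := fin_cores
  rw [cores_eq_single] at h ⊢
  rw [genSeries_union h (subs_nil_disjoint fun _ h => h.1),
    genSeries_subs fin_reds finiteFibers_nil, genSeries_nil, mul_one]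

theorem genSeries_coreless : genSeries size coreless =
    1 + 2 * (genSeries size whites * genSeries size coreless) := by
  have h := fin_coreless
  rw [coreless_eq] at h
  conv_lhs => rw [coreless_eq]
  rw [genSeries_union h, genSeries_union (h.mono Set.subset_union_right)
    (subs_disjoint (.inl (by simp))), genSeries_subs fin_whites fin_coreless,
    genSeries_subs fin_whites fin_coreless, genSeries_nil, two_mul]
  refine Set.disjoint_left.2 ?_
  rintro _ rfl (h | h)
  · exact nil_notMem_subs h
  · exact nil_notMem_subs h

theorem genSeries_cores : genSeries size cores =
    (PowerSeries.X + genSeries size reds) * (genSeries size coreless + genSeries size cores) +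
      2 * (genSeries size whites * genSeries size cores) := by
  have h := fin_cores
  rw [cores_eq] at h
  have hu : FiniteFibers size (coreless ∪ cores) := finiteFibers_ok.mono
    (Set.union_subset (fun _ h => h.1) fun _ h => h.1)
  conv_lhs => rw [cores_eq]
  have h' := h.mono Set.subset_union_right
  rw [genSeries_union h, genSeries_union h', genSeries_union (h'.mono Set.subset_union_right)
    (subs_disjoint (.inl (by simp))), genSeries_subs fin_reds hu,
    genSeries_subs fin_whites fin_cores, genSeries_subs fin_whites fin_cores,
    genSeries_image_succ (sz := size) lab (fun _ _ h => lab.inj h) (fun _ => rfl),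
    genSeries_union hu coreless_disjoint_cores]
  · ring
  · exact Set.disjoint_union_right.2
      ⟨subs_disjoint (.inr reds_disjoint_whites), subs_disjoint (.inl (by simp))⟩
  · refine Set.disjoint_left.2 ?_
    rintro _ ⟨w, -, rfl⟩ (h | h | h) <;> exact lab_notMem_subs h

theorem genSeries_isTree :
    genSeries size {w | IsTree w} = genSeries size reds + genSeries size whites := by
  have e : {w | IsTree w} = reds ∪ whites := by
    ext w
    simp only [reds, whites, Set.mem_union, Set.mem_ofPred_eq]
    cases w.isRed <;> simp
  rw [e, genSeries_union _ reds_disjoint_whites]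
  rw [← e]
  exact finiteFibers_ok.mono fun _ h => h.1

theorem genSeries_isTree_eq {F : PowerSeries ℤ} (hF : F = genSeries size {w | IsTree w}) :
    F = PowerSeries.X + 3 * PowerSeries.X * F + (3 + PowerSeries.X) * F ^ 2
      + (1 - PowerSeries.X) * F ^ 3 - F ^ 4 := by
  have h1 := genSeries_isTree
  have h2 := genSeries_reds
  have h3 := genSeries_plains
  have h4 := genSeries_cores_single
  have h5 := genSeries_coreless
  have h6 := genSeries_cores
  rw [← hF] at h1
  generalize genSeries size reds = R at *
  generalize genSeries size whites = W at *
  generalize genSeries size plains = Q at *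
  generalize genSeries size cores = C at *
  generalize genSeries size coreless = N at *
  generalize (PowerSeries.X : PowerSeries ℤ) = x at *
  have hQ : Q = F := by rw [h3, h1, add_comm]
  have hC : C = F := h4.trans h1.symm
  rw [hQ] at h2
  rw [hC] at h6
  -- Each unknown is eliminated after multiplication by `1 + F` or `1 - F`, so that no inverse of a
  -- power series is needed.
  have s1 : W * (1 + F) = F := by linear_combination -h1 - h2
  have s2 : R * (1 + F) = F ^ 2 := by linear_combination (1 + F) * h2 + F * s1
  have s3 : N * (1 - F) = 1 + F := by linear_combination (1 + F) * h5 + 2 * N * s1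
  have s4 : F * (1 - F) = (x * (1 + F) + F ^ 2) * (N + F) := by
    linear_combination (1 + F) * h6 + 2 * F * s1 + (N + F) * s2
  -- This combination amounts to `F (1 - F)² = (x (1 + F) + F²)(1 + 2 F - F²)`, whose expansion is
  -- the claim.
  linear_combination (1 - F) * s4 + (x * (1 + F) + F ^ 2) * s3

theorem finite_tree (n : ℕ) : Finite (Tree n) :=
  Set.Finite.subset (finiteFibers_ok n) fun _ h => ⟨h.1.1, h.2⟩

end PWord

-- Conclusion.

theorem nonempty_tree_equiv (n : ℕ) : Nonempty (PWord.Tree n ≃ FF6.Op n) := by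
  obtain ⟨e, -⟩ := exists_iso_GR6_FF6
  obtain ⟨e', -⟩ := exists_iso_GR6_RW6
  exact ⟨(Equiv.ofBijective _ (PWord.toRW6_bijective n)).trans
    ((e'.equiv n).symm.trans (e.equiv n))⟩

theorem mainTheorem10 :
    -- the three collections are set-operads
    FF6.IsOperad ∧ GR6.IsOperad ∧ RW6.IsOperad ∧
    -- they are isomorphic, by isomorphisms that match the generators
    (∃ e : PreOperad.Iso GR6 FF6, ∀ g : Gen6, (e.equiv 2 (gr6Gen g)).1 = genFrac g) ∧
    (∃ e : PreOperad.Iso GR6 RW6, ∀ g : Gen6, e.equiv 2 (gr6Gen g) = rw6Gen g) ∧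
    -- the generating series of the cardinalities
    (∀ n : ℕ, Finite (FF6.Op n)) ∧
    (∀ F : PowerSeries ℤ, F = PowerSeries.mk (fun n : ℕ => (Nat.card (FF6.Op n) : ℤ)) →
      F = PowerSeries.X + 3 * PowerSeries.X * F + (3 + PowerSeries.X) * F ^ 2
        + (1 - PowerSeries.X) * F ^ 3 - F ^ 4) := by
  refine ⟨(PreOperad.generatedByHom _ _).isOperad (fun _ => Subtype.val_injective)
      hadamard_isOperad, GR6.evalHom.isOperad GR6.evalHom_injective hadamard_isOperad,
    RTree.valueHom.isOperad PWord.valueHom_injective hadamard_isOperad, ?_, ?_, fun n => ?_,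
    fun F hF => PWord.genSeries_isTree_eq (hF.trans ?_)⟩
  · obtain ⟨e, he⟩ := exists_iso_GR6_FF6
    exact ⟨e, fun g => (he 2 _).trans (GR6.evalHom_gen g)⟩
  · obtain ⟨e, he⟩ := exists_iso_GR6_RW6
    exact ⟨e, fun g => PWord.valueHom_injective 2
      ((he 2 _).trans ((GR6.evalHom_gen g).trans (RTree.value_genTree g).symm))⟩
  · obtain ⟨e⟩ := nonempty_tree_equiv n
    have := PWord.finite_tree n
    exact Finite.of_equiv _ e
  · ext n
    obtain ⟨e⟩ := nonempty_tree_equiv n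
    rw [PowerSeries.coeff_mk, genSeries, PowerSeries.coeff_mk, ← Nat.card_congr e]
    rfl
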